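/- **Theorem 2.1.** *Tauberian condition.* Let $X\in\mathbb R$, $0\le\alpha<1$ and let $F,f:\mathbb R\to[0,\infty)$ vanish on $(-\infty,0)$ and satisfy $|F(x+y)-F(x)|\le f(x)|y|e^{|y|^\alpha}$ for all $x\ge X$, $y\in\mathbb R$. A function $S:\mathbb R\to\mathbb R$ satisfies $\mathfrak T(X,F,f,\alpha)$ if $S=0$ on $(-\infty,0)$, $S+F$ is non-decreasing on $[X,\infty)$ and $S(X)+F(X)\ge\sup_{y\le X}(S(y)+F(y))$. A function $S:\mathbb R\to\mathbb C$ satisfies it if $\Re S$ and $\Im S$ both do. *Boundary classes.* Below $N\in\mathbb N=\{0,1,2,\dots\}$; $B,D,\delta_0>0$; $1\le p,q\le\infty$ are conjugate exponents; $G,H,G_n$ are positive functions; $\omega$ is positive and non-decreasing on $(0,\infty)$ with $\omega(y)\gg_\omega y$ as $y\to0^+$; $(M_n)_{n\ge0}$ is a positive sequence with $M_n^2\le M_{n-1}M_{n+1}$ for $n\ge1$ and $M_n\gg L^nn^n$ for some $L>0$; $M(y)=\sup_n\log(y^n/M_n)$ is its associated function (with $\log 0=-\infty$); $A\ge1$ is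 an explicit implicit constant. A function $g:\mathbb R\to\mathbb C$ belongs to 1. $\mathcal T_{\mathrm{Dif}}(N,G,p,D)$ if it is $N$ times differentiable, $\|g^{(N)}/G\|_{L^p}\le A$ and $|g^{(j)}(0)|\le D$ for $0\le j<N$ ($G$ locally integrable on $\mathbb R$); 2. $\mathcal T_{\mathrm{DifI}}(N,G,D)$ if it is $N$ times differentiable, $\int_{-R}^R|g^{(N)}|\le A\,G(R)$ for all $R>0$ and $|g^{(j)}(0)|\le D$ for $0\le j<N$ ($G$ non-decreasing); 3. $\mathcal T_{\mathrm{HC}}(N,G,p,\omega,D,\delta_0)$ if it is $N$ times differentiable, $\big\|\sup_{|u|\le\delta}|g^{(N)}(t+u)-g^{(N)}(t)|/G(t)\big\|_{L^p(dt)}\le A\,\omega(\delta)$ for $0<\delta\le\delta_0$ and $|g^{(j)}(0)|\le D$ for $0\le j\le N$ ($G$ locally integrable on $\mathbb R$); 4. $\mathcal T_{\mathrm{HCI}}(N,G,\omega,D,\delta_0)$ if it is $N$ times differentiable, $\int_{-R}^R\sup_{|u|\le\delta}|g^{(N)}(t+u)-g^{(N)}(t)|\,dt\le A\,G(R)\omega(\delta)$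 for $R>0$, $0<\delta\le\delta_0$ and $|g^{(j)}(0)|\le D$ for $0\le j\le N$ ($G$ non-decreasing); 5. $\mathcal T_{\mathrm{SA}}(M_n,B,G,H,p)$ if it is smooth and there are locally integrable $G_n$ with $\|g^{(n)}/G_n\|_{L^p}\le A\,B^nM_n$ and $\|G_n\chi_{(-\lambda,\lambda)}\|_{L^q}\le G(\lambda)^nH(\lambda)$ for all $n\in\mathbb N$, $\lambda>0$; 6. $\mathcal T_{\mathrm{SAI}}(M_n,B,G,H)$ if it is smooth and $\int_{-R}^R|g^{(n)}|\le A\,B^nM_nG(R)^nH(R)$ for all $R>0$, $n\in\mathbb N$ ($G,H$ non-decreasing); 7. $\mathcal T_{\mathrm{An}}(G,H)$ if it extends to a function on $\{z:|\Im z|\le1/G(|\Re z|)\}$ that is continuous, analytic in the interior, and bounded in absolute value by $H(|z|)$; here $G$ is continuous, positive and non-decreasing on $[0,\infty)$, and $tH(t)$ is non-decreasing on $[0,\infty)$. *Theorem.* Let $S$ be locally integrable and satisfy $\mathfrak T(X,F,f,\alpha)$. Suppose that $\mathcal L\{S;s\}=\int_0^\infty e^{-su}S(u)\,du$ converges for $\Re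 s>0$ and that there is a locally integrable function $g$ with $$\lim_{\sigma\to0^+}\int_{-\infty}^\infty\mathcal L\{S;\sigma+it\}\phi(t)\,dt=\int_{-\infty}^\infty g(t)\phi(t)\,dt\qquad\text{for all }\phi\in C_c^\infty(\mathbb R),$$ and that $g$ belongs to one of the classes $\mathcal T_*$ above. Then, for all $x\ge X$ (respectively all $x\ge\max\{X,\pi/\delta_0,2\pi\}$ for the classes $\mathrm{HC}$ and $\mathrm{HCI}$), $$|S(x)|\le K A\,\inf_{\lambda\ge1}\Big(E_*(x,\lambda)+\frac{f(x)}\lambda\Big)$$ (with $A=1$ for the class $\mathrm{An}$), where $K$ depends only on $\alpha$ and on the parameters named in brackets, and - $E_{\mathrm{Dif}}=x^{-N}\big(1+\|G\chi_{(-\lambda,\lambda)}\|_{L^q}\big)$ $\;[N,D]$; - $E_{\mathrm{DifI}}=x^{-N}(1+G(\lambda))$ $\;[N,D]$; - $E_{\mathrm{HC}}=x^{-N}\omega(\pi/x)\big(1+\|G\chi_{(-\lambda,\lambda)}\|_{L^q}\big)$ $\;[N,\omega,D,\delta_0]$; - $E_{\mathrm{HCI}}=x^{-N}\omega(\pi/x)(1+G(\lambda))$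 $\;[N,\omega,D,\delta_0]$; - $E_{\mathrm{SA}}=E_{\mathrm{SAI}}=\exp\Big(-M\Big(\dfrac{x}{BG(\lambda)+\kappa\lambda^{-1}}\Big)\Big)H(\lambda)$ with $\kappa=124/L$, for every $L>0$ such that $M_n\gg L^nn^n$ $\;[(M_n),L]$; - $E_{\mathrm{An}}=\exp\Big(-\dfrac{x}{G(\lambda)(1+\kappa G(\lambda)^{-1}\lambda^{-1})}\Big)\Big\{\displaystyle\int_0^\lambda H(t)\,dt+G(0)^{-1}\sup_{0\le t\le5G(0)^{-1}}H(t)\Big\}$ with $\kappa=675$ if $\lambda\ge2G(0)^{-1}$, and $E_{\mathrm{An}}=\infty$ otherwise [no further dependence]. Moreover, if $H$ is bounded on $[0,5G(0)^{-1}]$, one may also take $E_{\mathrm{An}}=\exp\Big(-\dfrac{x}{G(\lambda)(1+\kappa'\lambda^{-1})}\Big)\displaystyle\int_0^\lambda H(t)\,dt$ with $\kappa'=675\max\{1,G(0)^{-1}\}$ if $\lambda\ge2G(0)^{-1}$, and $\infty$ otherwise $\;[G(0),H]$. When $x=0$ and $N\ge1$, $x^{-N}$ is read as $\infty$; for $x<0$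 one has $S(x)=0$ and nothing is claimed. -/

import Mathlib

open MeasureTheory Set Filter Topology
open scoped ENNReal

noncomputable section

namespace FlexTauberian

/-! ### The Tauberian condition -/

/-- The Tauberian condition `𝔗(X, F, f, α)` for a real-valued function `S`.
`F` and `f` take values in `[0, ∞)` and `S`, `F`, `f` vanish on the negative half-axis. -/
structure RealTauberianCondition (S : ℝ → ℝ) (X : ℝ) (F f : ℝ → ℝ) (α : ℝ) : Prop where
  zero_left : ∀ x < 0, S x = 0
  monotone_add : MonotoneOn (fun x => S x + F x) (Ici X)
  F_nonneg : ∀ x, 0 ≤ F x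
  f_nonneg : ∀ x, 0 ≤ f x
  F_zero_left : ∀ x < 0, F x = 0
  f_zero_left : ∀ x < 0, f x = 0
  regular : ∀ x, X ≤ x → ∀ y, |F (x + y) - F x| ≤ f x * |y| * Real.exp (|y| ^ α)
  alpha_nonneg : 0 ≤ α
  alpha_lt_one : α < 1
  sup_le : ∀ y ≤ X, S y + F y ≤ S X + F X

/-- The Tauberian condition `𝔗(X, F, f, α)` for `S : ℝ → ℂ`: either `S` is real-valued and satisfies
the condition for real-valued functions, or both its real and its imaginary part satisfy it.
(The first case is not contained in the second, as `F` itself need not be non-decreasing.) -/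
def TauberianCondition (S : ℝ → ℂ) (X : ℝ) (F f : ℝ → ℝ) (α : ℝ) : Prop :=
  RealTauberianCondition (fun x => (S x).re) X F f α ∧
    ((∀ x, (S x).im = 0) ∨ RealTauberianCondition (fun x => (S x).im) X F f α)

/-! ### The Laplace transform and its distributional boundary values -/

/-- The (possibly only conditionally convergent) integral `∫₀^∞ e^{-su} S(u) du` converges,
with value `l`. -/
def HasLaplaceTransform (S : ℝ → ℂ) (s l : ℂ) : Prop :=
  Tendsto (fun R : ℝ => ∫ u in (0 : ℝ)..R, Complex.exp (-s * u) * S u) atTop (𝓝 l)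

/-- The Laplace transform of `S` converges on `Re s > 0` and admits distributional boundary values
on `Re s = 0`, the boundary distribution being the locally integrable function `g`
(regarded as the distribution `φ ↦ ∫ g φ`). -/
def HasBoundaryFunction (S g : ℝ → ℂ) : Prop :=
  LocallyIntegrable g volume ∧
  ∃ L : ℂ → ℂ, (∀ s : ℂ, 0 < s.re → HasLaplaceTransform S s (L s)) ∧
    ∀ φ : ℝ → ℂ, ContDiff ℝ (⊤ : ℕ∞) φ → HasCompactSupport φ →
      Tendsto (fun σ : ℝ => ∫ t : ℝ, L ((σ : ℂ) + Complex.I * (t : ℂ)) * φ t) (𝓝[>] 0)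
        (𝓝 (∫ t : ℝ, g t * φ t))

/-- The hypotheses on `S` that are common to all boundary classes. -/
structure TauberianSetting (S : ℝ → ℂ) (X : ℝ) (F f : ℝ → ℝ) (α : ℝ) (g : ℝ → ℂ) : Prop where
  locallyIntegrable : LocallyIntegrable S volume
  tauberian : TauberianCondition S X F f α
  boundary : HasBoundaryFunction S g

/-! ### The function classes

In each class the number `A` is the implicit constant of the defining Vinogradov estimate. -/

/-- `g` is `N` times differentiable. -/
def DiffTimes (N : ℕ) (g : ℝ → ℂ) : Prop :=
  ∀ j < N, Differentiable ℝ (iteratedDeriv j g)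

/-- `sup_{|u| ≤ δ} |h(t + u) - h(t)|`. -/
def localOsc (h : ℝ → ℂ) (δ t : ℝ) : ℝ≥0∞ :=
  ⨆ u ∈ Icc (-δ) δ, ‖h (t + u) - h t‖ₑ

/-- `N` times differentiable functions with a weighted `L^p`-bound for the `N`-th derivative. -/
structure ClassDif (N : ℕ) (G : ℝ → ℝ) (p : ℝ≥0∞) (D A : ℝ) (g : ℝ → ℂ) : Prop where
  G_pos : ∀ t, 0 < G t
  G_locallyIntegrable : LocallyIntegrable G volume
  diff : DiffTimes N g
  bound : eLpNorm (fun t => iteratedDeriv N g t / (G t : ℂ)) p volume ≤ ENNReal.ofReal A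
  at_zero : ∀ j < N, ‖iteratedDeriv j g 0‖ ≤ D

/-- `N` times differentiable functions with bounds for the integrals of the `N`-th derivative. -/
structure ClassDifI (N : ℕ) (G : ℝ → ℝ) (D A : ℝ) (g : ℝ → ℂ) : Prop where
  G_pos : ∀ t > 0, 0 < G t
  G_mono : MonotoneOn G (Ioi 0)
  diff : DiffTimes N g
  bound : ∀ R > 0, ∫⁻ t in Ioo (-R) R, ‖iteratedDeriv N g t‖ₑ ≤ ENNReal.ofReal (A * G R)
  at_zero : ∀ j < N, ‖iteratedDeriv j g 0‖ ≤ D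

/-- Admissible moduli: `w` is positive and non-decreasing with `w(y) ≫ y` as `y → 0+`. -/
structure IsModulus (w : ℝ → ℝ) : Prop where
  pos : ∀ y > 0, 0 < w y
  mono : MonotoneOn w (Ioi 0)
  lower : ∃ c > 0, ∀ᶠ y in 𝓝[>] (0 : ℝ), c * y ≤ w y

/-- `N` times differentiable functions whose `N`-th derivative is uniformly Hölder continuous
with respect to `L^p`, `G` and `w`. -/
structure ClassHC (N : ℕ) (G : ℝ → ℝ) (p : ℝ≥0∞) (w : ℝ → ℝ) (D δ₀ A : ℝ) (g : ℝ → ℂ) :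
    Prop where
  G_pos : ∀ t, 0 < G t
  G_locallyIntegrable : LocallyIntegrable G volume
  diff : DiffTimes N g
  bound : ∀ δ, 0 < δ → δ ≤ δ₀ →
    eLpNorm (fun t => localOsc (iteratedDeriv N g) δ t / ENNReal.ofReal (G t)) p volume
      ≤ ENNReal.ofReal (A * w δ)
  at_zero : ∀ j ≤ N, ‖iteratedDeriv j g 0‖ ≤ D

/-- The integral variant of the Hölder class. -/
structure ClassHCI (N : ℕ) (G : ℝ → ℝ) (w : ℝ → ℝ) (D δ₀ A : ℝ) (g : ℝ → ℂ) : Prop where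
  G_pos : ∀ t > 0, 0 < G t
  G_mono : MonotoneOn G (Ioi 0)
  diff : DiffTimes N g
  bound : ∀ R > 0, ∀ δ, 0 < δ → δ ≤ δ₀ →
    ∫⁻ t in Ioo (-R) R, localOsc (iteratedDeriv N g) δ t ≤ ENNReal.ofReal (A * G R * w δ)
  at_zero : ∀ j ≤ N, ‖iteratedDeriv j g 0‖ ≤ D

/-- A logarithmically convex sequence of positive numbers. -/
def IsLogConvexSeq (M : ℕ → ℝ) : Prop :=
  (∀ n, 0 < M n) ∧ ∀ n, M (n + 1) ^ 2 ≤ M n * M (n + 2)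

/-- Subanalyticity with constant `L`: `M_n ≫ L^n n^n`. -/
def IsSubanalyticWith (M : ℕ → ℝ) (L : ℝ) : Prop :=
  ∃ c > 0, ∀ n : ℕ, c * L ^ n * (n : ℝ) ^ n ≤ M n

/-- The associated function `M(y) = sup_n log (y^n / M_n)`, with values in `[-∞, ∞]` and
with `log 0 = -∞`. -/
def associatedFunction (M : ℕ → ℝ) (y : ℝ) : EReal :=
  ⨆ n : ℕ, ENNReal.log (ENNReal.ofReal (y ^ n / M n))

/-- Ultradifferentiable functions with weighted `L^p`-bounds; `q` is the exponent conjugate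
to `p`. -/
structure ClassSA (M : ℕ → ℝ) (B : ℝ) (G H : ℝ → ℝ) (p q : ℝ≥0∞) (A : ℝ) (g : ℝ → ℂ) :
    Prop where
  G_pos : ∀ t > 0, 0 < G t
  H_pos : ∀ t > 0, 0 < H t
  smooth : ContDiff ℝ (⊤ : ℕ∞) g
  bound : ∃ Gn : ℕ → ℝ → ℝ,
    (∀ n t, 0 < Gn n t) ∧ (∀ n, LocallyIntegrable (Gn n) volume) ∧
    (∀ n, eLpNorm (fun t => iteratedDeriv n g t / (Gn n t : ℂ)) p volume
      ≤ ENNReal.ofReal (A * B ^ n * M n)) ∧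
    ∀ n, ∀ lam > 0, eLpNorm (indicator (Ioo (-lam) lam) (Gn n)) q volume
      ≤ ENNReal.ofReal (G lam ^ n * H lam)

/-- The integral variant of the ultradifferentiable class. -/
structure ClassSAI (M : ℕ → ℝ) (B : ℝ) (G H : ℝ → ℝ) (A : ℝ) (g : ℝ → ℂ) : Prop where
  G_pos : ∀ t > 0, 0 < G t
  H_pos : ∀ t > 0, 0 < H t
  G_mono : MonotoneOn G (Ioi 0)
  H_mono : MonotoneOn H (Ioi 0)
  smooth : ContDiff ℝ (⊤ : ℕ∞) g
  bound : ∀ n : ℕ, ∀ R > 0, ∫⁻ t in Ioo (-R) R, ‖iteratedDeriv n g t‖ₑ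
      ≤ ENNReal.ofReal (A * B ^ n * M n * G R ^ n * H R)

/-- The closed region `{z : |Im z| ≤ 1 / G(|Re z|)}`. -/
def analyticRegion (G : ℝ → ℝ) : Set ℂ := {z | |z.im| ≤ 1 / G |z.re|}

/-- Functions with an analytic extension to `{z : |Im z| ≤ 1 / G(|Re z|)}` (analytic on the interior
and continuous up to the boundary) that is bounded there by `H(|z|)`. -/
structure ClassAn (G H : ℝ → ℝ) (g : ℝ → ℂ) : Prop where
  G_pos : ∀ t ≥ 0, 0 < G t
  G_cont : ContinuousOn G (Ici 0)
  G_mono : MonotoneOn G (Ici 0)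
  H_pos : ∀ t ≥ 0, 0 < H t
  H_mono : MonotoneOn (fun t => t * H t) (Ici 0)
  extension : ∃ E : ℂ → ℂ, (∀ t : ℝ, E t = g t) ∧ ContinuousOn E (analyticRegion G) ∧
    DifferentiableOn ℂ E (interior (analyticRegion G)) ∧
    ∀ z ∈ analyticRegion G, ‖E z‖ ≤ H ‖z‖

/-! ### The error terms (with values in `[0, ∞]`) -/

/-- `x^{-N}` as an element of `[0, ∞]`, for `x ≥ 0`. -/
def invPow (N : ℕ) (x : ℝ) : ℝ≥0∞ := (ENNReal.ofReal x)⁻¹ ^ N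

/-- `x^{-N} (1 + ‖G χ_{(-λ,λ)}‖_{L^q})`. -/
def errDif (N : ℕ) (G : ℝ → ℝ) (q : ℝ≥0∞) (x lam : ℝ) : ℝ≥0∞ :=
  invPow N x * (1 + eLpNorm (indicator (Ioo (-lam) lam) G) q volume)

/-- `x^{-N} (1 + G(λ))`. -/
def errDifI (N : ℕ) (G : ℝ → ℝ) (x lam : ℝ) : ℝ≥0∞ :=
  invPow N x * (1 + ENNReal.ofReal (G lam))

/-- `x^{-N} w(π/x) (1 + ‖G χ_{(-λ,λ)}‖_{L^q})`. -/
def errHC (N : ℕ) (G : ℝ → ℝ) (q : ℝ≥0∞) (w : ℝ → ℝ) (x lam : ℝ) : ℝ≥0∞ :=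
  invPow N x * ENNReal.ofReal (w (Real.pi / x)) *
    (1 + eLpNorm (indicator (Ioo (-lam) lam) G) q volume)

/-- `x^{-N} w(π/x) (1 + G(λ))`. -/
def errHCI (N : ℕ) (G w : ℝ → ℝ) (x lam : ℝ) : ℝ≥0∞ :=
  invPow N x * ENNReal.ofReal (w (Real.pi / x)) * (1 + ENNReal.ofReal (G lam))

/-- `exp (-M (x / (B G(λ) + κ / λ))) H(λ)`, with `M` the associated function of the sequence. -/
def errSA (M : ℕ → ℝ) (B : ℝ) (G H : ℝ → ℝ) (κ x lam : ℝ) : ℝ≥0∞ :=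
  EReal.exp (-associatedFunction M (x / (B * G lam + κ / lam))) * ENNReal.ofReal (H lam)

/-- `exp (-x / (G(λ) (1 + κ / (G(λ) λ)))) {∫₀^λ H + G(0)⁻¹ max_{t ≤ 5 / G(0)} H(t)}` if
`λ ≥ 2 / G(0)`, and `∞` otherwise. -/
def errAn (G H : ℝ → ℝ) (κ x lam : ℝ) : ℝ≥0∞ :=
  if 2 / G 0 ≤ lam then
    ENNReal.ofReal (Real.exp (-(x / (G lam * (1 + κ / (G lam * lam)))))) *
      ((∫⁻ t in Ioo 0 lam, ENNReal.ofReal (H t)) +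
        ENNReal.ofReal (1 / G 0) * ⨆ t ∈ Icc 0 (5 / G 0), ENNReal.ofReal (H t))
  else ∞

/-- `exp (-x / (G(λ) (1 + κ / λ))) ∫₀^λ H` if `λ ≥ 2 / G(0)`, and `∞` otherwise. -/
def errAn' (G H : ℝ → ℝ) (κ x lam : ℝ) : ℝ≥0∞ :=
  if 2 / G 0 ≤ lam then
    ENNReal.ofReal (Real.exp (-(x / (G lam * (1 + κ / lam))))) *
      ∫⁻ t in Ioo 0 lam, ENNReal.ofReal (H t)
  else ∞

/-- `inf_{λ ≥ 1} (E(x, λ) + f(x) / λ)`. -/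
def rate (E : ℝ → ℝ → ℝ≥0∞) (f : ℝ → ℝ) (x : ℝ) : ℝ≥0∞ :=
  ⨅ lam ∈ Ici (1 : ℝ), (E x lam + ENNReal.ofReal (f x / lam))

end FlexTauberian

end

/-!
The argument is a direct (non-iterated) Tauberian estimate. By `exists_isTauberianKernel` there are,
for each order `n` and each sign, smooth functions `φ` supported in `[-1/2, 1/2]` with derivatives
`|φ^{(j)}| ≤ C (24 (n + 1))^j` for `j ≤ n + 1`, whose transform is `u κ(u)` with `κ ≥ 0`, so that it
changes sign exactly at the origin and has an integral of prescribed sign; `C` does not depend on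
`n`. The transform is integrable against `|u| e^{|u|^α}` because it contains the factor
`∏ sinc(2π a_j u)²`, which decays like `exp(-c |u|^β)` with `α < β < 1`, while the growth of the
derivatives is controlled by another `2 (n + 1)` factors `sinc`, each of which is a convolution with
an indicator function on the other side.

The Tauberian condition at `x` says that `(u - x) (S u - S x) + f(x) (u - x)² e^{|u - x|^α}` is
nonnegative for all `u`. Testing this against `λ² κ(λ (u - x))` and letting the Laplace transform
tend to its boundary values shows (`exists_enorm_le_of_pairing_le`) that `|S x|` is at most a
multiple of `|∫ g(t) e^{ixt} φ(t/λ) dt| + f(x)/λ`. It remains to bound these pairings by the error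
terms.

For the differentiable and the ultradifferentiable classes this is repeated integration by parts
(`IsCutoff.pow_mul_norm_pairing_le`), where in the ultradifferentiable case the order of the cutoff
is the number of integrations by parts, and logarithmic convexity together with subanalyticity
balances the derivatives of `g` and of the cutoff (`IsLogConvexSeq.exists_mul_pow_le`). For the
Hölder classes the last integral is compared with its translate by `π/x`, under which `e^{ixt}`
changes sign (`IsCutoff.two_mul_norm_pairing_le`); the bound for the oscillation also bounds
`g^{(N)}` itself (`OscIntegralLE.norm_sub_le`). For the analytic class the line of integration is
moved upwards by `1/G(λ)`. The cutoff is not analytic, and is replaced by an almost analytic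
extension of order `n`; Green's formula (`IsCutoff.green`) then produces an integral over a
rectangle, and the choice of `n` in `exists_rectangle_bound` makes all terms `O(e^{-Y})`, with `-Y`
the exponent of the claimed error term. As `t H(t)` is non-decreasing, `H` enters only through
`∫₀^λ H`, which also gives the second, simplified error term.
-/

namespace FlexTauberian

open scoped FourierTransform

/-! ### Functions with compactly supported Fourier transform -/

/-- `k` is integrable and its Fourier transform (with the character `e^{-2πi tu}`) vanishes outside
`(-r, r)`; in other words `k` is the Fourier transform of a function supported in `[-r, r]`. -/
structure FourierSupportedIn (r : ℝ) (k : ℝ → ℂ) : Prop where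
  integrable : Integrable k
  fourier_eq_zero : ∀ t, r ≤ |t| → 𝓕 k t = 0

theorem continuous_fourier {ψ : ℝ → ℂ} (hψ : Integrable ψ) : Continuous (𝓕 ψ) :=
  VectorFourier.fourierIntegral_continuous Real.continuous_fourierChar
    (by exact continuous_inner) hψ

theorem norm_fourier_le (ψ : ℝ → ℂ) (u : ℝ) : ‖𝓕 ψ u‖ ≤ ∫ t, ‖ψ t‖ :=
  VectorFourier.norm_fourierIntegral_le_integral_norm _ _ _ _ _

/-- A product of transforms is the transform of a convolution, so the supports add up. -/
theorem FourierSupportedIn.mul_fourier {r a : ℝ} {k ψ : ℝ → ℂ} (hk : FourierSupportedIn r k)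
    (hψ : Integrable ψ) (hsupp : ∀ s, a < |s| → ψ s = 0) :
    FourierSupportedIn (r + a) (fun u => k u * 𝓕 ψ u) := by
  refine ⟨?_, fun t ht => ?_⟩
  · have := hk.integrable.bdd_mul (c := ∫ t, ‖ψ t‖) (continuous_fourier hψ).aestronglyMeasurable
      (Eventually.of_forall fun u => norm_fourier_le ψ u)
    simpa [mul_comm] using this
  · have h1 : Integrable (Function.uncurry fun u s : ℝ =>
        Complex.exp (↑(-2 * Real.pi * u * t) * Complex.I) *
          (k u * (Complex.exp (↑(-2 * Real.pi * s * u) * Complex.I) * ψ s)))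
        (volume.prod volume) := by
      have h0 : Integrable (fun z : ℝ × ℝ => k z.1 * ψ z.2) (volume.prod volume) :=
        hk.integrable.mul_prod hψ
      have := h0.bdd_mul (c := 1)
        (f := fun z : ℝ × ℝ => Complex.exp (↑(-2 * Real.pi * z.1 * t) * Complex.I) *
          Complex.exp (↑(-2 * Real.pi * z.2 * z.1) * Complex.I))
        (by fun_prop) (Eventually.of_forall fun z => by
          rw [norm_mul, Complex.norm_exp_ofReal_mul_I, Complex.norm_exp_ofReal_mul_I, one_mul])
      refine this.congr (Eventually.of_forall fun z => ?_)
      simp only [Function.uncurry]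
      ring
    rw [Real.fourier_real_eq_integral_exp_smul]
    simp only [Real.fourier_real_eq_integral_exp_smul ψ, smul_eq_mul, ← integral_const_mul]
    rw [integral_integral_swap h1]
    have h2 : ∀ s : ℝ, (∫ u : ℝ, Complex.exp (↑(-2 * Real.pi * u * t) * Complex.I) *
          (k u * (Complex.exp (↑(-2 * Real.pi * s * u) * Complex.I) * ψ s))) = 0 := by
      intro s
      by_cases hs : a < |s|
      · simp [hsupp s hs]
      · have h3 := hk.fourier_eq_zero (t + s) (by
          have := abs_sub_abs_le_abs_sub t (-s)
          rw [abs_neg, sub_neg_eq_add] at this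
          linarith [not_lt.1 hs])
        rw [Real.fourier_real_eq_integral_exp_smul] at h3
        calc _ = ∫ u : ℝ, (Complex.exp (↑(-2 * Real.pi * u * (t + s)) * Complex.I) • k u) * ψ s :=
                 by
              congr 1; ext u
              have : Complex.exp (↑(-2 * Real.pi * u * (t + s)) * Complex.I) =
                Complex.exp (↑(-2 * Real.pi * u * t) * Complex.I) *
                Complex.exp (↑(-2 * Real.pi * s * u) * Complex.I) := by
                rw [← Complex.exp_add]; congr 1; push_cast; ring
              rw [this, smul_eq_mul]; ring
          _ = 0 := by rw [integral_mul_const, h3, zero_mul]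
    rw [integral_congr_ae (Eventually.of_forall h2), integral_zero]

/-- Stability under dominated pointwise limits. -/
theorem FourierSupportedIn.of_tendsto {r : ℝ} {k : ℕ → ℝ → ℂ} {k' : ℝ → ℂ} {b : ℝ → ℝ}
    (hk : ∀ m, FourierSupportedIn r (k m)) (hb : Integrable b) (hkb : ∀ m u, ‖k m u‖ ≤ b u)
    (hlim : ∀ u, Tendsto (fun m => k m u) atTop (𝓝 (k' u))) : FourierSupportedIn r k' := by
  have hmeas : AEStronglyMeasurable k' :=
    aestronglyMeasurable_of_tendsto_ae atTop (fun m => (hk m).integrable.aestronglyMeasurable)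
      (Eventually.of_forall hlim)
  refine ⟨hb.mono' hmeas (Eventually.of_forall fun u =>
    le_of_tendsto (hlim u).norm (Eventually.of_forall fun m => hkb m u)), fun t ht => ?_⟩
  rw [Real.fourier_real_eq_integral_exp_smul]
  have h1 : Tendsto (fun m => ∫ u : ℝ, Complex.exp (↑(-2 * Real.pi * u * t) * Complex.I) • k m u)
      atTop (𝓝 (∫ u : ℝ, Complex.exp (↑(-2 * Real.pi * u * t) * Complex.I) • k' u)) := by
    refine tendsto_integral_of_dominated_convergence b (fun m => ?_) hb (fun m => ?_) ?_
    · exact (Continuous.aestronglyMeasurable (f := fun u : ℝ =>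
        Complex.exp (↑(-2 * Real.pi * u * t) * Complex.I))
            (by fun_prop)).smul (hk m).integrable.aestronglyMeasurable
    · refine Eventually.of_forall fun u => ?_
      rw [norm_smul, Complex.norm_exp_ofReal_mul_I, one_mul]
      exact hkb m u
    · exact Eventually.of_forall fun u => (hlim u).const_smul _
  have h2 : ∀ m, (∫ u : ℝ, Complex.exp (↑(-2 * Real.pi * u * t) * Complex.I) • k m u) = 0 := by
    intro m
    rw [← Real.fourier_real_eq_integral_exp_smul]
    exact (hk m).fourier_eq_zero t ht
  simp only [h2] at h1
  exact (tendsto_nhds_unique h1 tendsto_const_nhds)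

/-- The transform of the normalised indicator function of `[-a, a]`. -/
theorem fourier_box {a : ℝ} (ha : 0 < a) (u : ℝ) :
    𝓕 (indicator (Icc (-a) a) fun _ => ((2 * a : ℝ) : ℂ)⁻¹) u = Real.sinc (2 * Real.pi * a * u) :=
        by
  rw [Real.fourier_real_eq_integral_exp_smul]
  have h1 : ∀ v : ℝ, Complex.exp (↑(-2 * Real.pi * v * u) * Complex.I) •
      (indicator (Icc (-a) a) (fun _ => ((2 * a : ℝ) : ℂ)⁻¹) v) =
      indicator (Icc (-a) a) (fun v : ℝ => Complex.exp (↑(-2 * Real.pi * v * u) * Complex.I) *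
        ((2 * a : ℝ) : ℂ)⁻¹) v := by
    intro v
    by_cases hv : v ∈ Icc (-a) a <;> simp [hv]
  simp only [h1]
  rw [integral_indicator measurableSet_Icc, integral_Icc_eq_integral_Ioc,
    ← intervalIntegral.integral_of_le (by linarith), intervalIntegral.integral_mul_const]
  have h2 : (∫ v in -a..a, Complex.exp (↑(-2 * Real.pi * v * u) * Complex.I)) =
      2 * a * Real.sinc (2 * Real.pi * a * u) := by
    by_cases hu : u = 0
    · subst hu
      simp [Real.sinc_zero]
      ring
    · have hc : -2 * Real.pi * u ≠ 0 := by simp [hu, Real.pi_ne_zero]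
      have := intervalIntegral.integral_comp_mul_left (a := -a) (b := a)
        (fun t : ℝ => Complex.exp (t * Complex.I)) hc
      have e : ∀ v : ℝ, -2 * Real.pi * v * u = -2 * Real.pi * u * v := fun v => by ring
      simp only [e]
      rw [this, show -2 * Real.pi * u * -a = - (-2 * Real.pi * u * a) by ring,
        integral_exp_mul_I_eq_sinc, show -2 * Real.pi * u * a = -(2 * Real.pi * a * u) by ring,
        Real.sinc_neg]
      simp only [Complex.real_smul]
      push_cast
      have hc' : (u : ℂ) ≠ 0 := by exact_mod_cast hu
      have hp : (Real.pi : ℂ) ≠ 0 := by exact_mod_cast Real.pi_ne_zero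
      field_simp
  rw [h2]
  push_cast
  have : (a : ℂ) ≠ 0 := by exact_mod_cast ha.ne'
  field_simp

theorem FourierSupportedIn.mul_sinc {r a : ℝ} {k : ℝ → ℂ} (hk : FourierSupportedIn r k)
    (ha : 0 < a) :
    FourierSupportedIn (r + a) (fun u => k u * Real.sinc (2 * Real.pi * a * u)) := by
  have := hk.mul_fourier (a := a) (ψ := indicator (Icc (-a) a) fun _ => ((2 * a : ℝ) : ℂ)⁻¹)
    ?_ ?_
  · simpa only [fourier_box ha] using this
  · exact (integrable_indicator_iff measurableSet_Icc).2 continuousOn_const.integrableOn_Icc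
  · intro s hs
    refine indicator_of_notMem (fun h => ?_) _
    exact absurd (abs_le.2 h) (not_le.2 hs)

theorem FourierSupportedIn.mono {r r' : ℝ} {k : ℝ → ℂ} (hk : FourierSupportedIn r k)
    (h : r ≤ r') : FourierSupportedIn r' k :=
  ⟨hk.integrable, fun t ht => hk.fourier_eq_zero t (h.trans ht)⟩

theorem FourierSupportedIn.mul_sinc_pow {r a : ℝ} {k : ℝ → ℂ} (hk : FourierSupportedIn r k)
    (ha : 0 < a) (m : ℕ) :
    FourierSupportedIn (r + m * a) (fun u => k u * (Real.sinc (2 * Real.pi * a * u) : ℂ) ^ m) := by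
  induction m with
  | zero => simpa using hk
  | succ m ih =>
    have := ih.mul_sinc ha
    convert this using 1
    · push_cast; ring
    · ext u; rw [pow_succ]; ring

theorem FourierSupportedIn.mul_prod_sinc {r : ℝ} {k : ℝ → ℂ} (hk : FourierSupportedIn r k)
    {a : ℕ → ℝ} (ha : ∀ j, 0 < a j) (m : ℕ) :
    FourierSupportedIn (r + 2 * ∑ j ∈ Finset.range m, a j)
      (fun u => k u * ((∏ j ∈ Finset.range m, Real.sinc (2 * Real.pi * a j * u) ^ 2 : ℝ) : ℂ)) := by
  induction m with
  | zero => simpa using hk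
  | succ m ih =>
    have := ih.mul_sinc_pow (ha m) 2
    convert this using 1
    · rw [Finset.sum_range_succ]; push_cast; ring
    · ext u; rw [Finset.prod_range_succ]; push_cast; ring

/-- A nonnegative even function with compactly supported Fourier transform. -/
theorem exists_nonneg_even_fourierSupportedIn (r : ℝ) (hr : 0 < r) : ∃ q : ℝ → ℝ, Continuous q ∧
    (∀ u, 0 ≤ q u) ∧
    (∀ u, q (-u) = q u) ∧ 0 < q 0 ∧ (∃ C, ∀ u, q u ≤ C) ∧
    FourierSupportedIn r (fun u => (q u : ℂ)) := by
  let β : ContDiffBump (0 : ℝ) := ⟨r / 4, r / 2, by positivity, by linarith⟩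
  let ψ : ℝ → ℂ := fun t => (β t : ℂ)
  have hψc : HasCompactSupport ψ := β.hasCompactSupport.comp_left (g := fun x : ℝ => (x : ℂ))
      (by simp)
  have hψs : ContDiff ℝ (⊤ : ℕ∞) ψ := Complex.ofRealCLM.contDiff.comp β.contDiff
  let σ := hψc.toSchwartzMap hψs
  have hψi : Integrable ψ := σ.integrable
  have hFi : Integrable (𝓕 ψ) := (𝓕 σ).integrable
  have hzero : ∀ t, r / 2 ≤ |t| → ψ t = 0 := by
    intro t ht
    have : β t = 0 := β.zero_of_le_dist (by simpa [β] using ht)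
    simp [ψ, this]
  have heven : ∀ t, ψ (-t) = ψ t := fun t => by simp [ψ, β.neg]
  have hFeven : ∀ u, 𝓕 ψ (-u) = 𝓕 ψ u := by
    intro u
    rw [Real.fourier_real_eq_integral_exp_smul, Real.fourier_real_eq_integral_exp_smul,
      ← integral_neg_eq_self]
    congr 1; ext v
    rw [heven]; congr 4; ring
  have hFconj : ∀ u, (starRingEnd ℂ) (𝓕 ψ u) = 𝓕 ψ u := by
    intro u
    conv_rhs => rw [← hFeven u]
    rw [Real.fourier_real_eq_integral_exp_smul, ← integral_conj,
      Real.fourier_real_eq_integral_exp_smul]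
    congr 1; ext v
    simp only [smul_eq_mul, map_mul, ← Complex.exp_conj, Complex.conj_ofReal, Complex.conj_I, ψ]
    congr 2; push_cast; ring
  have hbase : FourierSupportedIn (r / 2) (𝓕 ψ) := by
    refine ⟨hFi, fun t ht => ?_⟩
    have h1 := congrFun (hψs.continuous.fourierInv_fourier_eq hψi hFi) (-t)
    rw [Real.fourierInv_eq_fourier_neg, neg_neg] at h1
    rw [h1]
    exact hzero _ (by simpa using ht)
  have hsq := hbase.mul_fourier hψi (a := r / 2) (fun s hs => hzero s hs.le)
  refine ⟨fun u => ‖𝓕 ψ u‖ ^ 2, ((continuous_fourier hψi).norm.pow 2), fun u => by positivity,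
    fun u => by simp only [hFeven], ?_, ⟨(∫ t, ‖ψ t‖) ^ 2, fun u => ?_⟩, ?_⟩
  · have : 𝓕 ψ 0 = ((∫ t, β t : ℝ) : ℂ) := by
      rw [Real.fourier_real_eq_integral_exp_smul]
      simp only [mul_zero, Complex.ofReal_zero, zero_mul, Complex.exp_zero, one_smul]
      exact integral_ofReal
    simp only [this]
    have := β.integral_pos (μ := volume)
    simp only [Complex.norm_real]
    have h2 : ‖∫ t, β t‖ > 0 := norm_pos_iff.2 this.ne'
    positivity
  · dsimp only
    gcongr
    exact norm_fourier_le ψ u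
  · convert hsq using 1
    · ring
    · ext u
      have := hFconj u
      nth_rewrite 2 [← this]
      dsimp only
      rw [Complex.mul_conj, Complex.normSq_eq_norm_sq]

/-! ### A multiplier with subexponential decay -/

theorem one_sub_sq_le_sinc_sq (v : ℝ) : 1 - v ^ 2 / 3 ≤ Real.sinc v ^ 2 := by
  have key : ∀ v : ℝ, 0 < v → 1 - v ^ 2 / 3 ≤ Real.sinc v ^ 2 := by
    intro v hv
    have h1 : 1 - v ^ 2 / 6 ≤ Real.sinc v := by
      rw [Real.sinc_of_ne_zero hv.ne', le_div_iff₀ hv]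
      have := Real.sin_gt_sub_cube hv
      nlinarith
    rcases le_total (v ^ 2) 6 with h | h
    · nlinarith
    · nlinarith [sq_nonneg (Real.sinc v)]
  rcases lt_trichotomy v 0 with h | h | h
  · have := key (-v) (by linarith)
    rwa [Real.sinc_neg, neg_sq] at this
  · subst h; simp
  · exact key v h

theorem sinc_sq_le_one (v : ℝ) : Real.sinc v ^ 2 ≤ 1 := by
  rw [← sq_abs]
  exact pow_le_one₀ (abs_nonneg _) (Real.abs_sinc_le_one v)

theorem abs_mul_abs_sinc_le_one (v : ℝ) : |v| * |Real.sinc v| ≤ 1 := by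
  by_cases h : v = 0
  · simp [h]
  · rw [Real.sinc_of_ne_zero h, ← abs_mul, mul_div_cancel₀ _ h]
    exact Real.abs_sin_le_one v

theorem one_sub_sum_le_prod {s : Finset ℕ} {f g : ℕ → ℝ} (hg : ∀ i, 0 ≤ g i)
    (hf : ∀ i, 0 ≤ f i ∧ f i ≤ 1) (hfg : ∀ i, 1 - g i ≤ f i) :
    1 - ∑ i ∈ s, g i ≤ ∏ i ∈ s, f i := by
  induction s using Finset.induction_on with
  | empty => simp
  | insert a s ha ih =>
    rw [Finset.sum_insert ha, Finset.prod_insert ha]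
    have h1 : 0 ≤ ∏ i ∈ s, f i := Finset.prod_nonneg fun i _ => (hf i).1
    have h2 : ∏ i ∈ s, f i ≤ 1 := Finset.prod_le_one (fun i _ => (hf i).1) fun i _ => (hf i).2
    nlinarith [hfg a, hg a, (hf a).1, (hf a).2]

/-- The partial products of `∏ sinc(2π a_j u)²` decay as fast as `exp(-c |u|^β)` for
`a_j = c₀ (j + 1)^{-1/β}`: all factors with `2π a_j |u| ≥ e` are at most `e^{-2}`. -/
theorem exists_prod_sinc_sq_le {c₀ β : ℝ} (hc₀ : 0 < c₀) (hβ : 0 < β) (u : ℝ) :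
    ∃ m : ℕ, ∏ j ∈ Finset.range m, Real.sinc (2 * Real.pi * (c₀ * ((j : ℝ) + 1) ^ (-(1 / β))) * u)
        ^ 2
      ≤ Real.exp 2 * Real.exp (-(2 * (2 * Real.pi * c₀ / Real.exp 1) ^ β) * |u| ^ β) := by
  set z : ℝ := (2 * Real.pi * c₀ / Real.exp 1 * |u|) ^ β with hz
  have hpi := Real.pi_pos
  have hz0 : 0 ≤ z := by positivity
  refine ⟨⌊z⌋₊, ?_⟩
  have hfac : ∀ j ∈ Finset.range ⌊z⌋₊,
      Real.sinc (2 * Real.pi * (c₀ * ((j : ℝ) + 1) ^ (-(1 / β))) * u) ^ 2 ≤ Real.exp (-2) := by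
    intro j hj
    have hj1 : (j : ℝ) + 1 ≤ z := by
      have h1 : j + 1 ≤ ⌊z⌋₊ := Finset.mem_range.1 hj
      have h2 := (Nat.le_floor_iff hz0).1 h1
      exact_mod_cast h2
    have hj2 : ((j : ℝ) + 1) ^ (1 / β) ≤ 2 * Real.pi * c₀ / Real.exp 1 * |u| := by
      have := Real.rpow_le_rpow (by positivity) hj1 (z := 1 / β) (by positivity)
      rwa [hz, ← Real.rpow_mul (by positivity), mul_one_div_cancel hβ.ne', Real.rpow_one] at this
    set v := 2 * Real.pi * (c₀ * ((j : ℝ) + 1) ^ (-(1 / β))) * u with hv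
    have hv1 : Real.exp 1 ≤ |v| := by
      have hp : 0 < ((j : ℝ) + 1) ^ (1 / β) := by positivity
      rw [hv, abs_mul, abs_of_pos (by positivity), Real.rpow_neg (by positivity)]
      have : Real.exp 1 * ((j : ℝ) + 1) ^ (1 / β) ≤ 2 * Real.pi * c₀ * |u| := by
        calc _ ≤ Real.exp 1 * (2 * Real.pi * c₀ / Real.exp 1 * |u|) := by gcongr
          _ = _ := by field_simp
      calc Real.exp 1 = Real.exp 1 * ((j : ℝ) + 1) ^ (1 / β) * (((j : ℝ) + 1) ^ (1 / β))⁻¹ := by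
            field_simp
        _ ≤ 2 * Real.pi * c₀ * |u| * (((j : ℝ) + 1) ^ (1 / β))⁻¹ := by gcongr
        _ = _ := by ring
    have hv2 := abs_mul_abs_sinc_le_one v
    have hs : |Real.sinc v| ≤ Real.exp (-1) := by
      rw [Real.exp_neg, ← one_div, le_div_iff₀ (Real.exp_pos 1)]
      calc |Real.sinc v| * Real.exp 1 ≤ |Real.sinc v| * |v| := by gcongr
        _ ≤ 1 := by linarith
    rw [← sq_abs]
    calc |Real.sinc v| ^ 2 ≤ Real.exp (-1) ^ 2 := by gcongr
      _ = Real.exp (-2) := by rw [← Real.exp_nat_mul]; norm_num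
  calc _ ≤ ∏ j ∈ Finset.range ⌊z⌋₊, Real.exp (-2) :=
        Finset.prod_le_prod (fun _ _ => by positivity) hfac
    _ = Real.exp (-2 * ⌊z⌋₊) := by
        rw [Finset.prod_const, Finset.card_range, ← Real.exp_nat_mul]; ring_nf
    _ ≤ Real.exp (2 - 2 * z) := by
        apply Real.exp_le_exp.2
        have := Nat.lt_floor_add_one z
        linarith
    _ = _ := by
        rw [← Real.exp_add, hz, Real.mul_rpow (by positivity) (abs_nonneg _)]
        ring_nf

/-- For every `β < 1` there is a nonnegative multiplier that decays like `exp(-c |u|^β)` and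
enlarges the support of the Fourier transform by at most `1/16`. -/
theorem exists_multiplier {β : ℝ} (hβ : 0 < β) (hβ1 : β < 1) :
    ∃ Q : ℝ → ℝ, Continuous Q ∧ (∀ u, 0 ≤ Q u) ∧ (∀ u, Q u ≤ 1) ∧ (∀ u, Q (-u) = Q u) ∧
      (∀ u, |u| ≤ 1 → 1 / 2 ≤ Q u) ∧
      (∃ C c, 0 < C ∧ 0 < c ∧ ∀ u, Q u ≤ C * Real.exp (-c * |u| ^ β)) ∧
      ∀ r k, FourierSupportedIn r k → FourierSupportedIn (r + 1 / 16) (fun u => k u * (Q u : ℂ)) :=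
          by
  set s : ℝ := 1 / β with hs
  have hs1 : 1 < s := by rw [hs, lt_div_iff₀ hβ]; linarith
  have hpi := Real.pi_pos
  have hsum0 : Summable fun j : ℕ => ((j : ℝ) + 1) ^ (-s) := by
    have := (Real.summable_one_div_nat_add_rpow 1 s).2 hs1
    refine this.congr fun j => ?_
    rw [abs_of_pos (by positivity), Real.rpow_neg (by positivity), one_div]
  set T : ℝ := ∑' j : ℕ, ((j : ℝ) + 1) ^ (-s) with hT
  have hT1 : 0 < T := hsum0.tsum_pos (fun j => by positivity) 0 (by positivity)
  set c₀ : ℝ := 1 / (32 * T) with hc₀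
  have hc₀p : 0 < c₀ := by positivity
  set a : ℕ → ℝ := fun j => c₀ * ((j : ℝ) + 1) ^ (-s) with ha
  have hapos : ∀ j, 0 < a j := fun j => by positivity
  have hasum : Summable a := hsum0.mul_left c₀
  have hatsum : ∑' j, a j = 1 / 32 := by
    rw [ha, tsum_mul_left, ← hT, hc₀]; field_simp
  have hapart : ∀ F : Finset ℕ, ∑ j ∈ F, a j ≤ 1 / 32 := fun F =>
    hatsum ▸ hasum.sum_le_tsum F fun j _ => (hapos j).le
  have ha32 : ∀ j, a j ≤ 1 / 32 := fun j => by simpa using hapart {j}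
  set f : ℕ → ℝ → ℝ := fun j u => Real.sinc (2 * Real.pi * a j * u) ^ 2 with hf
  have hf01 : ∀ u j, 0 ≤ f j u ∧ f j u ≤ 1 := fun u j => ⟨by positivity, sinc_sq_le_one _⟩
  have hfcont : ∀ j, Continuous (f j) := fun j => by
    have := Real.continuous_sinc
    simp only [hf]; fun_prop
  have hunif : ∀ R : ℝ, HasProdUniformlyOn f (fun u => ∏' j, f j u) (Icc (-R) R) := by
    intro R
    have hu : Summable fun j => 2 * Real.pi * R * (2 * Real.pi * R) / 3 * a j := hasum.mul_left _
    have := hu.hasProdUniformlyOn_nat_one_add (K := Icc (-R) R) (f := fun j u => f j u - 1)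
      isCompact_Icc (Eventually.of_forall fun j u hu => ?_)
      (fun j => ((hfcont j).sub continuous_const).continuousOn)
    · simpa using this
    · have h1 := one_sub_sq_le_sinc_sq (2 * Real.pi * a j * u)
      have h2 := (hf01 u j).2
      rw [Real.norm_eq_abs, abs_sub_comm, abs_of_nonneg (by linarith)]
      have h3 : u ^ 2 ≤ R ^ 2 := by
        have : |u| ≤ R := abs_le.2 hu
        exact sq_le_sq.2 (this.trans (le_abs_self _))
      have h4 : a j ^ 2 ≤ a j := by nlinarith [hapos j, ha32 j]
      calc 1 - f j u ≤ (2 * Real.pi * a j * u) ^ 2 / 3 := by simp only [hf]; linarith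
        _ = (2 * Real.pi) ^ 2 / 3 * (a j ^ 2 * u ^ 2) := by ring
        _ ≤ (2 * Real.pi) ^ 2 / 3 * (a j * R ^ 2) := by
            have := (hapos j).le
            gcongr
        _ = _ := by ring
  set Q : ℝ → ℝ := fun u => ∏' j, f j u with hQ
  have hlim : ∀ u, Tendsto (fun m => ∏ j ∈ Finset.range m, f j u) atTop (𝓝 (Q u)) := fun u =>
    ((hunif |u|).hasProd (abs_le.1 le_rfl)).tendsto_prod_nat
  have hanti : ∀ u, Antitone fun m => ∏ j ∈ Finset.range m, f j u := fun u =>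
    antitone_nat_of_succ_le fun m => by
      rw [Finset.prod_range_succ]
      exact mul_le_of_le_one_right (Finset.prod_nonneg fun j _ => (hf01 u j).1) (hf01 u m).2
  have hQle : ∀ u m, Q u ≤ ∏ j ∈ Finset.range m, f j u := fun u m => (hanti u).le_of_tendsto
      (hlim u) m
  refine ⟨Q, ?_, ?_, ?_, ?_, ?_, ?_, ?_⟩
  · rw [continuous_iff_continuousAt]
    intro u
    have h1 : ContinuousOn Q (Icc (-(|u| + 1)) (|u| + 1)) :=
      (hunif (|u| + 1)).tendstoUniformlyOn_finsetRange.continuousOn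
        (Frequently.of_forall fun m => (continuous_finsetProd _ fun j _ => hfcont j).continuousOn)
    refine h1.continuousAt (Icc_mem_nhds ?_ ?_)
    · linarith [neg_abs_le u]
    · linarith [le_abs_self u]
  · exact fun u => ge_of_tendsto (hlim u) (Eventually.of_forall fun m =>
      Finset.prod_nonneg fun j _ => (hf01 u j).1)
  · exact fun u => by simpa using hQle u 0
  · intro u
    simp only [hQ, hf, mul_neg, Real.sinc_neg]
  · intro u hu
    refine ge_of_tendsto (hlim u) (Eventually.of_forall fun m => ?_)
    refine le_trans ?_ (one_sub_sum_le_prod (g := fun j => a j * 2) (fun j => ?_) (hf01 u) fun j =>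
        ?_)
    · rw [← Finset.sum_mul]
      linarith [hapart (Finset.range m)]
    · linarith [hapos j]
    · have h1 := one_sub_sq_le_sinc_sq (2 * Real.pi * a j * u)
      have hu2 : u ^ 2 ≤ 1 := by rw [← sq_abs]; exact pow_le_one₀ (abs_nonneg _) hu
      have hp2 : Real.pi ^ 2 ≤ 10 := by nlinarith [Real.pi_lt_d2, Real.pi_pos]
      have h4 : (2 * Real.pi * a j * u) ^ 2 / 3 ≤ a j * 2 := by
        calc (2 * Real.pi * a j * u) ^ 2 / 3 = 4 / 3 * Real.pi ^ 2 * (a j * a j) * u ^ 2 := by ring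
          _ ≤ 4 / 3 * 10 * (a j * (1 / 32)) * 1 := by
              have := (hapos j).le
              have := ha32 j
              gcongr
          _ ≤ a j * 2 := by nlinarith [hapos j]
      simp only [hf]; linarith
  · refine ⟨Real.exp 2, 2 * (2 * Real.pi * c₀ / Real.exp 1) ^ β, by
        positivity, by positivity, fun u => ?_⟩
    obtain ⟨m, hm⟩ := exists_prod_sinc_sq_le hc₀p hβ u
    exact (hQle u m).trans hm
  · intro r k hk
    refine FourierSupportedIn.of_tendsto (b := fun u => ‖k u‖) (fun m => ?_) hk.integrable.norm
      (fun m u => ?_) (fun u => ?_)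
      (k := fun m u => k u * ((∏ j ∈ Finset.range m, f j u : ℝ) : ℂ))
    · exact (hk.mul_prod_sinc hapos m).mono (by linarith [hapart (Finset.range m)])
    · rw [norm_mul, Complex.norm_real, Real.norm_of_nonneg
        (Finset.prod_nonneg fun j _ => (hf01 u j).1)]
      exact mul_le_of_le_one_right (norm_nonneg _)
        (Finset.prod_le_one (fun j _ => (hf01 u j).1) fun j _ => (hf01 u j).2)
    · exact ((Complex.continuous_ofReal.tendsto _).comp (hlim u)).const_mul _

/-! ### Even kernels with subexponential decay -/

theorem exists_one_add_pow_mul_exp_le {β c : ℝ} (hβ : 0 < β) (hc : 0 < c) (P : ℕ) :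
    ∃ C, ∀ y : ℝ, 0 ≤ y → (1 + y) ^ P * Real.exp (-c * y ^ β) ≤ C := by
  obtain ⟨m, hm⟩ := exists_nat_ge ((P : ℝ) / β)
  have hm' : (P : ℝ) ≤ β * m := by rw [div_le_iff₀ hβ] at hm; linarith
  refine ⟨2 ^ P * (1 + m.factorial / c ^ m), fun y hy => ?_⟩
  rcases le_total y 1 with h | h
  · have h1 : (1 + y) ^ P ≤ 2 ^ P := by gcongr; linarith
    have h2 : Real.exp (-c * y ^ β) ≤ 1 := by
      apply Real.exp_le_one_iff.2
      have : 0 ≤ c * y ^ β := by positivity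
      linarith
    calc _ ≤ (2 : ℝ) ^ P * 1 := by gcongr
      _ ≤ _ := by gcongr; linarith [show 0 ≤ (m.factorial : ℝ) / c ^ m by positivity]
  · have h1 : (1 + y) ^ P ≤ 2 ^ P * y ^ P := by rw [← mul_pow]; gcongr; linarith
    have h2 : y ^ P ≤ (y ^ β) ^ m := by
      rw [← Real.rpow_natCast y P, ← Real.rpow_natCast (y ^ β) m, ← Real.rpow_mul hy]
      exact Real.rpow_le_rpow_of_exponent_le h hm'
    have h3 := Real.pow_div_factorial_le_exp (c * y ^ β) (by positivity) m
    have h4 : y ^ P * Real.exp (-c * y ^ β) ≤ m.factorial / c ^ m := by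
      rw [neg_mul, Real.exp_neg, ← div_eq_mul_inv, div_le_iff₀ (Real.exp_pos _)]
      calc y ^ P ≤ (y ^ β) ^ m := h2
        _ = m.factorial / c ^ m * ((c * y ^ β) ^ m / m.factorial) := by
            rw [mul_pow]; field_simp
        _ ≤ _ := by gcongr
    calc _ ≤ 2 ^ P * y ^ P * Real.exp (-c * y ^ β) := by gcongr
      _ = 2 ^ P * (y ^ P * Real.exp (-c * y ^ β)) := by ring
      _ ≤ 2 ^ P * (m.factorial / c ^ m) := by gcongr
      _ ≤ _ := by gcongr; linarith

theorem exists_rpow_le_rpow_add {α β A c : ℝ} (hα : 0 ≤ α) (hαβ : α < β) (hA : 0 ≤ A)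
    (hc : 0 < c) : ∃ C, ∀ y : ℝ, 0 ≤ y → A * (1 + y) ^ α ≤ c * y ^ β + C := by
  set y₀ : ℝ := max 1 ((A * 2 ^ α / c) ^ (1 / (β - α))) with hy₀
  refine ⟨A * (1 + y₀) ^ α, fun y hy => ?_⟩
  have hbb : 0 < β - α := by linarith
  rcases le_total y y₀ with h | h
  · have : (1 + y) ^ α ≤ (1 + y₀) ^ α := Real.rpow_le_rpow (by linarith) (by linarith) hα
    have h2 : 0 ≤ c * y ^ β := by positivity
    nlinarith
  · have hy1 : 1 ≤ y := (le_max_left _ _).trans h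
    have hy0 : 0 < y := by linarith
    have h1 : (1 + y) ^ α ≤ 2 ^ α * y ^ α := by
      rw [← Real.mul_rpow (by norm_num) hy]
      exact Real.rpow_le_rpow (by linarith) (by linarith) hα
    have h2 : A * 2 ^ α / c ≤ y ^ (β - α) := by
      have := Real.rpow_le_rpow (by positivity) ((le_max_right _ _).trans h) hbb.le
      rwa [← Real.rpow_mul (by positivity), one_div_mul_cancel hbb.ne', Real.rpow_one] at this
    have h3 : y ^ β = y ^ (β - α) * y ^ α := by rw [← Real.rpow_add hy0]; ring_nf
    calc A * (1 + y) ^ α ≤ A * (2 ^ α * y ^ α) := by gcongr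
      _ = c * (A * 2 ^ α / c * y ^ α) := by field_simp
      _ ≤ c * y ^ β := by rw [h3]; gcongr
      _ ≤ _ := by linarith [show 0 ≤ A * (1 + y₀) ^ α by positivity]

theorem integrable_pow_mul_exp_mul {α β A c : ℝ} (hα : 0 ≤ α) (hαβ : α < β) (hA : 0 ≤ A)
    (hc : 0 < c) (P : ℕ) :
    Integrable fun u : ℝ => (1 + |u|) ^ P * Real.exp (A * (1 + |u|) ^ α) * Real.exp (-c * |u| ^ β)
        := by
  have hβ : 0 < β := hα.trans_lt hαβ
  obtain ⟨C₁, h₁⟩ := exists_rpow_le_rpow_add (c := c / 2) hα hαβ hA (by positivity)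
  obtain ⟨C₂, h₂⟩ := exists_one_add_pow_mul_exp_le (c := c / 2) hβ (by positivity) (P + 2)
  refine (integrable_inv_one_add_sq.const_mul (C₂ * Real.exp C₁)).mono' ?_
      (Eventually.of_forall fun u => ?_)
  · apply Measurable.aestronglyMeasurable
    fun_prop
  · rw [Real.norm_of_nonneg (by positivity)]
    have h3 := h₁ |u| (abs_nonneg u)
    have h4 := h₂ |u| (abs_nonneg u)
    have h5 : 1 + u ^ 2 ≤ (1 + |u|) ^ 2 := by nlinarith [abs_nonneg u, sq_abs u]
    rw [← div_eq_mul_inv, le_div_iff₀ (by positivity)]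
    have h6 : Real.exp (A * (1 + |u|) ^ α) * Real.exp (-c * |u| ^ β) ≤
        Real.exp C₁ * Real.exp (-(c / 2) * |u| ^ β) := by
      rw [← Real.exp_add, ← Real.exp_add]
      apply Real.exp_le_exp.2
      linarith
    calc (1 + |u|) ^ P * Real.exp (A * (1 + |u|) ^ α) * Real.exp (-c * |u| ^ β) * (1 + u ^ 2)
        = (1 + |u|) ^ P * (Real.exp (A * (1 + |u|) ^ α) * Real.exp (-c * |u| ^ β)) * (1 + u ^ 2) :=
            by
          ring
      _ ≤ (1 + |u|) ^ P * (Real.exp C₁ * Real.exp (-(c / 2) * |u| ^ β)) * (1 + |u|) ^ 2 := by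
          gcongr
      _ = (1 + |u|) ^ (P + 2) * Real.exp (-(c / 2) * |u| ^ β) * Real.exp C₁ := by ring
      _ ≤ _ := by gcongr

/-- Nonnegative even functions `k n` that are band-limited uniformly in `n`, share the integrable
majorant `W`, have mass bounded below, and gain a factor `16 (n + 1)` for each of the first `2n + 2`
powers of `2π u`. The gain comes from a factor `sinc(2πbu)^{2n+2}` with `b = 1/(16(n+1))`. -/
theorem exists_even_kernel {α : ℝ} (hα₀ : 0 ≤ α) (hα₁ : α < 1) :
    ∃ (W : ℝ → ℝ) (c₀ : ℝ), Continuous W ∧ 0 < c₀ ∧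
      (∀ A P, 0 ≤ A → Integrable fun u => (1 + |u|) ^ P * Real.exp (A * (1 + |u|) ^ α) * W u) ∧
      ∀ n : ℕ, ∃ k : ℝ → ℝ, Continuous k ∧ (∀ u, 0 ≤ k u) ∧ (∀ u, k u ≤ W u) ∧
        (∀ u, k (-u) = k u) ∧ FourierSupportedIn (5 / 16) (fun u => (k u : ℂ)) ∧
        (∀ u, ∀ j ≤ 2 * n + 2, |2 * Real.pi * u| ^ j * k u ≤ (16 * (n + 1)) ^ j * W u) ∧
        c₀ ≤ ∫ u, k u := by
  obtain ⟨β, hβα, hβ1⟩ := exists_between hα₁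
  have hβ0 : 0 < β := hα₀.trans_lt hβα
  obtain ⟨q, hqc, hq0, hqe, hqp, ⟨C₁, hC₁⟩, hqF⟩ := exists_nonneg_even_fourierSupportedIn (1 / 8)
      (by norm_num)
  obtain ⟨Q, hQc, hQ0, hQ1, hQe, hQl, ⟨C₂, c, hC₂, hc, hQd⟩, hQF⟩ := exists_multiplier hβ0 hβ1
  have hC₁0 : 0 ≤ C₁ := (hq0 0).trans (hC₁ 0)
  have hpi := Real.pi_pos
  have hqn : ∀ᶠ u in 𝓝 (0 : ℝ), q 0 / 2 < q u := hqc.continuousAt.eventually_const_lt (by linarith)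
  obtain ⟨δ, hδ, hqδ⟩ := Metric.eventually_nhds_iff.1 hqn
  set d : ℝ := min (δ / 2) 1 with hd
  have hd0 : 0 < d := by positivity
  have hW0 : ∀ u, 0 ≤ q u * Q u := fun u => mul_nonneg (hq0 u) (hQ0 u)
  have hWint : ∀ A P, 0 ≤ A → Integrable fun u =>
      (1 + |u|) ^ P * Real.exp (A * (1 + |u|) ^ α) * (q u * Q u) := by
    intro A P hA
    refine ((integrable_pow_mul_exp_mul hα₀ hβα hA hc P).const_mul (C₁ * C₂)).mono' ?_
      (Eventually.of_forall fun u => ?_)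
    · apply Measurable.aestronglyMeasurable
      have := hqc.measurable
      have := hQc.measurable
      fun_prop
    · rw [Real.norm_of_nonneg (by have := hW0 u; positivity)]
      calc (1 + |u|) ^ P * Real.exp (A * (1 + |u|) ^ α) * (q u * Q u)
          ≤ (1 + |u|) ^ P * Real.exp (A * (1 + |u|) ^ α) * (C₁ * (C₂ * Real.exp (-c * |u| ^ β))) :=
              by
            have := hq0 u; have := hQ0 u; have := hC₁ u; have := hQd u
            gcongr
        _ = _ := by ring
  refine ⟨fun u => q u * Q u, 2 * d * (q 0 / 8), hqc.mul hQc, by positivity, hWint, fun n => ?_⟩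
  have hn : (0 : ℝ) < n + 1 := by positivity
  set b : ℝ := 1 / (16 * (n + 1)) with hb
  have hb0 : 0 < b := by positivity
  set s : ℝ → ℝ := fun u => Real.sinc (2 * Real.pi * b * u) with hs
  have hsc : Continuous s := by
    have := Real.continuous_sinc
    simp only [hs]; fun_prop
  have hseven : ∀ u, 0 ≤ s u ^ (2 * n + 2) := fun u => by
    rw [show 2 * n + 2 = 2 * (n + 1) by ring, pow_mul]; positivity
  have hs1 : ∀ u, |s u| ≤ 1 := fun u => Real.abs_sinc_le_one _
  have hsabs : ∀ u, s u ^ (2 * n + 2) = |s u| ^ (2 * n + 2) := fun u => by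
    rw [show 2 * n + 2 = 2 * (n + 1) by ring, pow_mul, pow_mul, sq_abs]
  have hsle : ∀ u, s u ^ (2 * n + 2) ≤ 1 := fun u => by
    rw [hsabs]; exact pow_le_one₀ (abs_nonneg _) (hs1 u)
  have hkc : Continuous fun u => q u * s u ^ (2 * n + 2) * Q u := (hqc.mul (hsc.pow _)).mul hQc
  have hkle : ∀ u, q u * s u ^ (2 * n + 2) * Q u ≤ q u * Q u := fun u => by
    have := mul_le_mul_of_nonneg_left (hsle u) (hW0 u)
    linarith
  have hk0 : ∀ u, 0 ≤ q u * s u ^ (2 * n + 2) * Q u := fun u =>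
    mul_nonneg (mul_nonneg (hq0 u) (hseven u)) (hQ0 u)
  have hkF : FourierSupportedIn (5 / 16) (fun u => ((q u * s u ^ (2 * n + 2) * Q u : ℝ) : ℂ)) := by
    have := hQF _ _ (hqF.mul_sinc_pow hb0 (2 * n + 2))
    convert this using 1
    · rw [hb]; push_cast; field_simp; norm_num
    · ext u; simp only [hs]; push_cast; ring
  refine ⟨fun u => q u * s u ^ (2 * n + 2) * Q u, hkc, hk0, hkle, fun u => ?_, hkF, ?_, ?_⟩
  · simp only [hs, hqe, hQe, mul_neg, Real.sinc_neg]
  · intro u j hj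
    have h1 : |2 * Real.pi * u| ^ j * s u ^ (2 * n + 2) ≤ (16 * (n + 1)) ^ j := by
      rw [hsabs]
      calc |2 * Real.pi * u| ^ j * |s u| ^ (2 * n + 2) ≤ |2 * Real.pi * u| ^ j * |s u| ^ j := by
            gcongr ?_ * ?_
            exact pow_le_pow_of_le_one (abs_nonneg _) (hs1 u) hj
        _ = (16 * (n + 1)) ^ j * (|2 * Real.pi * b * u| * |s u|) ^ j := by
            rw [← mul_pow, ← mul_pow]
            congr 1
            rw [show 2 * Real.pi * b * u = b * (2 * Real.pi * u) by
                ring, abs_mul b, abs_of_pos hb0, hb]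
            field_simp
        _ ≤ (16 * (n + 1)) ^ j * 1 := by
            gcongr
            exact pow_le_one₀ (by positivity) (abs_mul_abs_sinc_le_one _)
        _ = _ := mul_one _
    calc |2 * Real.pi * u| ^ j * (q u * s u ^ (2 * n + 2) * Q u)
        = |2 * Real.pi * u| ^ j * s u ^ (2 * n + 2) * (q u * Q u) := by ring
      _ ≤ _ := mul_le_mul_of_nonneg_right h1 (hW0 u)
  · have hkint : Integrable fun u => q u * s u ^ (2 * n + 2) * Q u := by
      refine ((hWint 0 0 le_rfl).congr (Eventually.of_forall fun u => ?_)).mono'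
        (g := fun u => q u * Q u) hkc.aestronglyMeasurable (Eventually.of_forall fun u => ?_)
      · simp
      · rw [Real.norm_of_nonneg (hk0 u)]; exact hkle u
    have hlow : ∀ u ∈ Icc (-d) d, q 0 / 8 ≤ q u * s u ^ (2 * n + 2) * Q u := by
      intro u hu
      have hud : |u| ≤ d := abs_le.2 hu
      have hu1 : |u| ≤ 1 := hud.trans (min_le_right _ _)
      have h1 : q 0 / 2 < q u := hqδ (by
        rw [Real.dist_eq, sub_zero]
        exact (hud.trans (min_le_left _ _)).trans_lt (by linarith))
      have h2 := hQl u hu1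
      have h3 : 1 / 2 ≤ s u ^ (2 * n + 2) := by
        have h4 := one_sub_sq_le_sinc_sq (2 * Real.pi * b * u)
        have hx : (2 * Real.pi * b * u) ^ 2 / 3 ≤ 1 / (2 * (n + 1)) := by
          have hp2 : Real.pi ^ 2 ≤ 10 := by nlinarith [Real.pi_lt_d2, Real.pi_pos]
          have hu2 : u ^ 2 ≤ 1 := by rw [← sq_abs]; exact pow_le_one₀ (abs_nonneg _) hu1
          calc (2 * Real.pi * b * u) ^ 2 / 3 = 4 / 3 * Real.pi ^ 2 * b ^ 2 * u ^ 2 := by ring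
            _ ≤ 4 / 3 * 10 * b ^ 2 * 1 := by gcongr
            _ ≤ _ := by
              rw [hb, div_pow, one_pow, mul_one, ← mul_div_assoc, mul_one,
                div_le_div_iff₀ (by positivity) (by positivity)]
              nlinarith
        have h5 : 1 - 1 / (2 * (n + 1)) ≤ s u ^ 2 := by simp only [hs]; linarith
        have h6 : (1 : ℝ) / (2 * (n + 1)) ≤ 1 / 2 := by
          apply one_div_le_one_div_of_le (by norm_num); linarith
        have h7 := one_add_mul_le_pow (a := -(1 / (2 * ((n : ℝ) + 1)))) (by linarith) (n + 1)
        calc (1 : ℝ) / 2 = 1 + ((n + 1 : ℕ) : ℝ) * -(1 / (2 * ((n : ℝ) + 1))) := by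
              push_cast; field_simp; norm_num
          _ ≤ _ := h7
          _ ≤ (s u ^ 2) ^ (n + 1) := by
              gcongr
              · linarith
              · linarith
          _ = _ := by rw [← pow_mul]; ring_nf
      calc q 0 / 8 = q 0 / 2 * (1 / 2) * (1 / 2) := by ring
        _ ≤ _ := by
          have := hq0 u
          have := hseven u
          gcongr
    calc 2 * d * (q 0 / 8) = ∫ u in Icc (-d) d, q 0 / 8 := by
          rw [setIntegral_const]
          rw [Measure.real, Real.volume_Icc, ENNReal.toReal_ofReal (by linarith), smul_eq_mul]
          ring
      _ ≤ ∫ u in Icc (-d) d, q u * s u ^ (2 * n + 2) * Q u :=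
          setIntegral_mono_on continuousOn_const.integrableOn_Icc hkint.integrableOn
            measurableSet_Icc hlow
      _ ≤ _ := setIntegral_le_integral hkint (Eventually.of_forall hk0)

/-! ### Tauberian kernels -/

/-- A smooth function supported in `[-1/2, 1/2]` whose first `n + 1` derivatives grow at most
geometrically, with ratio `24 (n + 1)`. -/
structure IsCutoff (C : ℝ) (n : ℕ) (φ : ℝ → ℂ) : Prop where
  contDiff : ContDiff ℝ (⊤ : ℕ∞) φ
  iteratedDeriv_eq_zero : ∀ j t, 1 / 2 ≤ |t| → iteratedDeriv j φ t = 0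
  norm_iteratedDeriv_le : ∀ j ≤ n + 1, ∀ t, ‖iteratedDeriv j φ t‖ ≤ C * (24 * (n + 1)) ^ j

/-- A cutoff `φ` together with its transform `∫ φ(t) e^{-itu} dt = u κ(u)`, where `κ ≥ 0`. The
transform changes sign exactly at the origin and can therefore be tested against one-sided
conditions; its integral has the sign of `ε = ±1`. -/
structure IsTauberianKernel (α C ε : ℝ) (n : ℕ) (φ : ℝ → ℂ) (κ : ℝ → ℝ) : Prop
    extends IsCutoff C n φ where
  nonneg : ∀ u, 0 ≤ κ u
  fourier : ∀ u : ℝ, ∫ t : ℝ, Complex.exp (-(Complex.I * t * u)) * φ t = ((u * κ u : ℝ) : ℂ)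
  integrable : Integrable fun u => u * κ u
  integrable_exp : Integrable fun u => u ^ 2 * Real.exp (|u| ^ α) * κ u
  integral_exp_le : ∫ u, u ^ 2 * Real.exp (|u| ^ α) * κ u ≤ C
  one_le_integral : 1 ≤ ε * ∫ u, u * κ u

/-- The transform `u κ(u)` is proportional to `v k(v - ε)`, where `v = u / 2π` and `k` is the even
kernel of `exists_even_kernel`. The shift by `ε` makes the integral a positive multiple of `ε ∫ k`.
On the side of `φ` the shift is a modulation and the factor `v` a derivative, so that the support
does not grow. -/
theorem exists_isTauberianKernel {α : ℝ} (hα₀ : 0 ≤ α) (hα₁ : α < 1) :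
    ∃ C, 0 < C ∧ ∀ n : ℕ, ∀ ε : ℝ, ε ^ 2 = 1 → ∃ φ κ, IsTauberianKernel α C ε n φ κ := by
  obtain ⟨W, c₀, hWc, hc₀, hWint, hk⟩ := exists_even_kernel hα₀ hα₁
  have hpi := Real.pi_pos
  set N : ℝ := 1 / c₀ with hN
  have hN0 : 0 < N := by positivity
  set A : ℝ := (2 * Real.pi) ^ α with hA
  have hA0 : 0 ≤ A := by positivity
  set h : ℝ → ℝ := fun w => (2 * Real.pi) ^ 2 * ((1 + |w|) ^ 2 * Real.exp (A * (1 + |w|) ^ α) * W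
      w) with hh
  have hhint : Integrable h := (hWint A 2 hA0).const_mul _
  have hWmom : ∀ P, Integrable fun u => (1 + |u|) ^ P * W u := fun P => by
    simpa using hWint 0 P le_rfl
  have hW0 : ∀ w, 0 ≤ W w := by
    obtain ⟨k, -, hk0, hkW, -⟩ := hk 0
    exact fun w => (hk0 w).trans (hkW w)
  set C : ℝ := 1 + N * (∫ w, h w) + N * ∫ w, (1 + |w|) ^ 1 * W w with hC
  have hi1 : 0 ≤ ∫ w, h w := integral_nonneg fun w => by
    have := hW0 w
    simp only [hh, Pi.zero_apply]; positivity
  have hi2 : 0 ≤ ∫ w, (1 + |w|) ^ 1 * W w := integral_nonneg fun w => by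
    have := hW0 w
    simp only [Pi.zero_apply]; positivity
  have hC0 : 0 < C := by positivity
  refine ⟨C, hC0, fun n ε hε => ?_⟩
  obtain ⟨k, hkc, hk0, hkW, hke, hkF, hkd, hki⟩ := hk n
  have hεabs : |ε| = 1 := by
    have : |ε| ^ 2 = 1 := by rw [sq_abs, hε]
    nlinarith [abs_nonneg ε]
  set g : ℝ → ℂ := fun v => ((v * k (v + ε) : ℝ) : ℂ) with hg
  have hgc : Continuous g := by simp only [hg]; fun_prop
  -- moments of `g`, which make its transform smooth
  have hshift : ∀ v : ℝ, |v| ≤ 1 + |v + ε| := fun v => by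
    have := abs_sub_abs_le_abs_sub v (-ε)
    rw [abs_neg, sub_neg_eq_add, hεabs] at this
    linarith
  have hmom : ∀ P : ℕ, Integrable fun v => |v| ^ P * k (v + ε) := by
    intro P
    refine ((hWmom P).comp_add_right ε).mono' (by fun_prop) (Eventually.of_forall fun v => ?_)
    rw [Real.norm_of_nonneg (mul_nonneg (by positivity) (hk0 _))]
    have := hk0 (v + ε)
    have := hkW (v + ε)
    have := hshift v
    gcongr
  have hgmom : ∀ P : ℕ, Integrable fun v : ℝ => v ^ P • g v := by
    intro P
    refine (hmom (P + 1)).mono' (by fun_prop) (Eventually.of_forall fun v => ?_)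
    rw [norm_smul, norm_pow, Real.norm_eq_abs, Complex.norm_real, norm_mul, Real.norm_eq_abs,
      Real.norm_of_nonneg (hk0 _), pow_succ, mul_assoc]
  have hgint : Integrable g := by simpa using hgmom 0
  have hFsmooth : ContDiff ℝ (⊤ : ℕ∞) (𝓕 g) := by
    refine Real.contDiff_fourier fun P _ => ?_
    refine (hgmom P).norm.congr (Eventually.of_forall fun v => ?_)
    simp only [norm_smul, norm_pow]
  have hFiter : ∀ j, iteratedDeriv j (𝓕 g) =
      𝓕 (fun x : ℝ => (-2 * Real.pi * Complex.I * x) ^ j • g x) := fun j =>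
    Real.iteratedDeriv_fourier (N := ⊤) (fun P _ => hgmom P) (by exact_mod_cast le_top)
  -- up to a constant, `𝓕 g` is the derivative of a function that vanishes off `(-5/16, 5/16)`
  have hkint : Integrable fun v : ℝ => ((k (v + ε) : ℝ) : ℂ) := hkF.integrable.comp_add_right ε
  have hFk : ∀ t, 5 / 16 ≤ |t| → 𝓕 (fun v : ℝ => ((k (v + ε) : ℝ) : ℂ)) t = 0 := by
    intro t ht
    have h1 := hkF.fourier_eq_zero t ht
    rw [Real.fourier_real_eq_integral_exp_smul] at h1 ⊢
    rw [← integral_add_right_eq_self _ ε] at h1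
    have h2 : ∀ v : ℝ, Complex.exp (↑(-2 * Real.pi * (v + ε) * t) * Complex.I) •
        ((k (v + ε) : ℝ) : ℂ)
        = Complex.exp (↑(-2 * Real.pi * ε * t) * Complex.I) *
          (Complex.exp (↑(-2 * Real.pi * v * t) * Complex.I) • ((k (v + ε) : ℝ) : ℂ)) := by
      intro v
      rw [smul_eq_mul, smul_eq_mul, ← mul_assoc, ← Complex.exp_add]
      congr 2; push_cast; ring
    simp only [h2] at h1
    rw [integral_const_mul] at h1
    exact (mul_eq_zero.1 h1).resolve_left (Complex.exp_ne_zero _)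
  have hFg : ∀ t, 5 / 16 < |t| → 𝓕 g t = 0 := by
    intro t ht
    have h1 := Real.hasDerivAt_fourier hkint (by
      refine hgint.congr (Eventually.of_forall fun v => ?_)
      simp [hg]) t
    have h2 : 𝓕 (fun v : ℝ => ((k (v + ε) : ℝ) : ℂ)) =ᶠ[𝓝 t] fun _ => 0 := by
      filter_upwards [(isOpen_lt continuous_const continuous_abs).mem_nhds ht] with s hs
      exact hFk s (le_of_lt hs)
    have h3 := h1.unique (h2.hasDerivAt_iff.2 (hasDerivAt_const t (0 : ℂ)))
    have h4 : (fun x : ℝ => (-2 * (Real.pi : ℂ) * Complex.I * x) • ((k (x + ε) : ℝ) : ℂ)) =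
        fun x => (-2 * (Real.pi : ℂ) * Complex.I) • g x := by
      ext x; simp only [hg, smul_eq_mul]; push_cast; ring
    rw [h4] at h3
    rw [Real.fourier_real_eq_integral_exp_smul] at h3 ⊢
    simp only [smul_comm _ (-2 * (Real.pi : ℂ) * Complex.I)] at h3
    rw [integral_smul] at h3
    refine (smul_eq_zero.1 h3).resolve_left ?_
    have : (Real.pi : ℂ) ≠ 0 := by exact_mod_cast hpi.ne'
    simp [this]
  set φ : ℝ → ℂ := fun t => (-N : ℂ) * 𝓕 g t with hφ
  set κ : ℝ → ℝ := fun u => N / (2 * Real.pi) * k (u / (2 * Real.pi) - ε) with hκ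
  have hκ0 : ∀ u, 0 ≤ κ u := fun u => mul_nonneg (by positivity) (hk0 _)
  have hφiter : ∀ j t, iteratedDeriv j φ t = (-N : ℂ) * iteratedDeriv j (𝓕 g) t := by
    intro j t
    exact iteratedDeriv_const_mul_field (n := j) (-N : ℂ) (𝓕 g)
  have hFgint : Integrable (𝓕 g) := by
    have hcs : HasCompactSupport (𝓕 g) :=
      HasCompactSupport.of_support_subset_isCompact (isCompact_Icc (a := -(5 / 16)) (b := 5 / 16))
        fun t ht => by
          by_contra hcon
          refine ht (hFg t ?_)
          by_contra h2
          exact hcon (abs_le.1 (not_lt.1 h2))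
    exact hFsmooth.continuous.integrable_of_hasCompactSupport hcs
  have hexpbound : ∀ u : ℝ, u ^ 2 * Real.exp (|u| ^ α) * κ u ≤
      N / (2 * Real.pi) * h (u / (2 * Real.pi) - ε) := by
    intro u
    set w := u / (2 * Real.pi) - ε with hw
    have hu : |u| ≤ 2 * Real.pi * (1 + |w|) := by
      have h1 : u = 2 * Real.pi * (w + ε) := by rw [hw]; field_simp; ring
      rw [h1, abs_mul, abs_of_pos (by positivity : 0 < 2 * Real.pi)]
      gcongr
      calc |w + ε| ≤ |w| + |ε| := abs_add_le _ _
        _ = 1 + |w| := by rw [hεabs, add_comm]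
    have h2 : u ^ 2 ≤ (2 * Real.pi) ^ 2 * (1 + |w|) ^ 2 := by
      rw [← sq_abs, ← mul_pow]; gcongr
    have h3 : |u| ^ α ≤ A * (1 + |w|) ^ α := by
      rw [hA, ← Real.mul_rpow (by positivity) (by positivity)]
      exact Real.rpow_le_rpow (abs_nonneg _) hu hα₀
    have := hk0 w
    calc u ^ 2 * Real.exp (|u| ^ α) * κ u
        ≤ ((2 * Real.pi) ^ 2 * (1 + |w|) ^ 2) * Real.exp (A * (1 + |w|) ^ α) *
          (N / (2 * Real.pi) * W w) := by
          simp only [hκ, ← hw]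
          have := hkW w
          gcongr
      _ = _ := by simp only [hh]; ring
  have hhcomp : Integrable fun u : ℝ => N / (2 * Real.pi) * h (u / (2 * Real.pi) - ε) :=
    ((hhint.comp_sub_right ε).comp_div (by positivity : 2 * Real.pi ≠ 0)).const_mul _
  have hκmeas : Continuous κ := by simp only [hκ]; fun_prop
  have hexpint : Integrable fun u : ℝ => u ^ 2 * Real.exp (|u| ^ α) * κ u := by
    refine hhcomp.mono' (Measurable.aestronglyMeasurable ?_) (Eventually.of_forall fun u => ?_)
    · have := hκmeas.measurable
      fun_prop
    · rw [Real.norm_of_nonneg (mul_nonneg (by positivity) (hκ0 u))]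
      exact hexpbound u
  have hvk : Integrable fun v : ℝ => v * k (v + ε) := by
    refine (hmom 1).mono' (by fun_prop) (Eventually.of_forall fun v => ?_)
    rw [norm_mul, Real.norm_eq_abs, Real.norm_of_nonneg (hk0 _), pow_one]
  have hkid : ∀ u, u * κ u = N * (-((-u / (2 * Real.pi)) * k (-u / (2 * Real.pi) + ε))) := by
    intro u
    simp only [hκ]
    rw [← hke (u / (2 * Real.pi) - ε)]
    rw [show -(u / (2 * Real.pi) - ε) = -u / (2 * Real.pi) + ε by ring]
    ring
  refine ⟨φ, κ, ⟨contDiff_const.mul hFsmooth, ?_, ?_⟩, hκ0, ?_, ?_, hexpint, ?_, ?_⟩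
  · intro j t ht
    rw [hφiter]
    have : 𝓕 g =ᶠ[𝓝 t] fun _ => 0 := by
      filter_upwards [(isOpen_lt continuous_const continuous_abs).mem_nhds
        (show 5 / 16 < |t| by linarith)] with s hs
      exact hFg s hs
    rw [this.iteratedDeriv_eq]
    simp
  · intro j hj t
    rw [hφiter, norm_mul, norm_neg, Complex.norm_real, Real.norm_of_nonneg hN0.le, hFiter]
    have h1 : ∀ v : ℝ, ‖(-2 * Real.pi * Complex.I * v) ^ j • g v‖ ≤
        (24 * (n + 1)) ^ j * ((1 + |v + ε|) ^ 1 * W (v + ε)) := by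
      intro v
      set w := v + ε with hw
      have hv1 := hshift v
      rw [← hw] at hv1
      have hn : ‖(-2 * Real.pi * Complex.I * v) ^ j • g v‖ = |2 * Real.pi * v| ^ j * (|v| * k w) :=
          by
        rw [norm_smul, norm_pow]
        congr 1
        · simp [abs_mul]
        · rw [Complex.norm_real, norm_mul, Real.norm_eq_abs v, Real.norm_of_nonneg (hk0 _)]
      have h2 : |2 * Real.pi * v| ≤ |2 * Real.pi * w| + 2 * Real.pi := by
        rw [abs_mul _ v, abs_mul _ w, abs_of_pos (by positivity : 0 < 2 * Real.pi)]
        nlinarith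
      have h3 : (|2 * Real.pi * w| + 2 * Real.pi) ^ j * k w ≤ (16 * (n + 1) + 2 * Real.pi) ^ j * W
          w := by
        rw [add_pow, add_pow, Finset.sum_mul, Finset.sum_mul]
        refine Finset.sum_le_sum fun i hi => ?_
        have hi' : i ≤ 2 * n + 2 := by have := Finset.mem_range.1 hi; omega
        have h4 := hkd w i hi'
        calc |2 * Real.pi * w| ^ i * (2 * Real.pi) ^ (j - i) * (j.choose i) * k w
            = (|2 * Real.pi * w| ^ i * k w) * ((2 * Real.pi) ^ (j - i) * (j.choose i)) := by ring
          _ ≤ ((16 * (n + 1)) ^ i * W w) * ((2 * Real.pi) ^ (j - i) * (j.choose i)) := by gcongr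
          _ = _ := by ring
      have h5 : (16 * (n + 1) + 2 * Real.pi : ℝ) ≤ 24 * (n + 1) := by
        nlinarith [Real.pi_le_four, (Nat.cast_nonneg n : (0 : ℝ) ≤ n)]
      rw [hn]
      have := hk0 w
      have := hW0 w
      calc |2 * Real.pi * v| ^ j * (|v| * k w) ≤
          (|2 * Real.pi * w| + 2 * Real.pi) ^ j * ((1 + |w|) * k w) := by gcongr
        _ = (1 + |w|) * ((|2 * Real.pi * w| + 2 * Real.pi) ^ j * k w) := by ring
        _ ≤ (1 + |w|) * ((16 * (n + 1) + 2 * Real.pi) ^ j * W w) := by gcongr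
        _ ≤ (1 + |w|) * ((24 * (n + 1)) ^ j * W w) := by gcongr
        _ = _ := by ring
    have h6 : ‖𝓕 (fun x : ℝ => (-2 * Real.pi * Complex.I * x) ^ j • g x) t‖ ≤
        (24 * (n + 1)) ^ j * ∫ w, (1 + |w|) ^ 1 * W w := by
      refine (norm_fourier_le _ t).trans ?_
      have h7 : Integrable fun v : ℝ => (24 * ((n : ℝ) + 1)) ^ j * ((1 + |v + ε|) ^ 1 * W (v + ε))
          :=
        ((hWmom 1).comp_add_right ε).const_mul _
      calc _ ≤ ∫ v : ℝ, (24 * ((n : ℝ) + 1)) ^ j * ((1 + |v + ε|) ^ 1 * W (v + ε)) := by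
            refine integral_mono_of_nonneg (Eventually.of_forall fun v => norm_nonneg _) h7
              (Eventually.of_forall h1)
        _ = _ := by
            rw [integral_const_mul, integral_add_right_eq_self (fun w => (1 + |w|) ^ 1 * W w) ε]
    calc N * _ ≤ N * ((24 * (n + 1)) ^ j * ∫ w, (1 + |w|) ^ 1 * W w) := by gcongr
      _ = (N * ∫ w, (1 + |w|) ^ 1 * W w) * (24 * (n + 1)) ^ j := by ring
      _ ≤ C * (24 * (n + 1)) ^ j := by
          have : N * ∫ w, (1 + |w|) ^ 1 * W w ≤ C := by
            rw [hC]; linarith [mul_nonneg hN0.le hi1]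
          gcongr
  · intro u
    have h1 := congrFun (hgc.fourierInv_fourier_eq hgint hFgint) (-u / (2 * Real.pi))
    rw [Real.fourierInv_eq_fourier_neg, Real.fourier_real_eq_integral_exp_smul] at h1
    rw [hkid]
    calc _ = ∫ t : ℝ, (-N : ℂ) * (Complex.exp (↑(-2 * Real.pi * t * -(-u / (2 * Real.pi))) *
             Complex.I) • 𝓕 g t) := by
          congr 1; ext t
          simp only [hφ, smul_eq_mul]
          have : -2 * Real.pi * t * -(-u / (2 * Real.pi)) = -(t * u) := by field_simp
          rw [this, show -(Complex.I * (t : ℂ) * (u : ℂ)) = ((-(t * u) : ℝ) : ℂ) * Complex.I by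
            push_cast; ring]
          ring
      _ = _ := by
          rw [integral_const_mul, h1]
          simp only [hg]; push_cast; ring
  · have h1 : Integrable fun u : ℝ => (-u / (2 * Real.pi)) * k (-u / (2 * Real.pi) + ε) := by
      have := (hvk.comp_div (by positivity : 2 * Real.pi ≠ 0)).comp_neg
      exact this
    simp only [hkid]
    exact h1.neg.const_mul N
  · calc _ ≤ ∫ u : ℝ, N / (2 * Real.pi) * h (u / (2 * Real.pi) - ε) :=
          integral_mono hexpint hhcomp hexpbound
      _ = N * ∫ w, h w := by
          rw [integral_const_mul, Measure.integral_comp_div (fun w => h (w - ε)) (2 * Real.pi),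
            integral_sub_right_eq_self h ε, abs_of_pos (by positivity), smul_eq_mul]
          field_simp
      _ ≤ C := by rw [hC]; linarith [mul_nonneg hN0.le hi2]
  · have hodd : ∫ v : ℝ, v * k v = 0 := by
      have h1 : ∫ v : ℝ, v * k v = ∫ v : ℝ, -v * k (-v) :=
        (integral_neg_eq_self (fun v : ℝ => v * k v) volume).symm
      simp only [hke, neg_mul] at h1
      rw [integral_neg] at h1
      linarith
    have hkr : Integrable k := by
      have := hkF.integrable.re
      simpa using this
    have hvk0 : Integrable fun v : ℝ => v * k v := by
      have h1 := (hvk.comp_sub_right ε).add (hkr.const_mul ε)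
      refine h1.congr (Eventually.of_forall fun v => ?_)
      simp only [Pi.add_apply, sub_add_cancel]; ring
    have h1 : ∫ v : ℝ, v * k (v + ε) = -ε * ∫ v, k v := by
      calc ∫ v : ℝ, v * k (v + ε) = ∫ v : ℝ, (v + ε - ε) * k (v + ε) := by
            congr 1; ext v; ring
        _ = ∫ v : ℝ, (v - ε) * k v := integral_add_right_eq_self (fun v => (v - ε) * k v) ε
        _ = ∫ v : ℝ, (v * k v - ε * k v) := by congr 1; ext v; ring
        _ = _ := by
            rw [integral_sub hvk0 (hkr.const_mul ε), hodd, integral_const_mul]; ring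
    have h2 : ∫ u, u * κ u = 2 * Real.pi * N * (ε * ∫ v, k v) := by
      simp only [hkid]
      rw [integral_const_mul, integral_neg,
        integral_neg_eq_self (fun u : ℝ => u / (2 * Real.pi) * k (u / (2 * Real.pi) + ε)) volume,
        Measure.integral_comp_div (fun v => v * k (v + ε)) (2 * Real.pi), h1,
        abs_of_pos (by positivity), smul_eq_mul]
      ring
    rw [h2]
    calc (1 : ℝ) ≤ 2 * Real.pi := by linarith [Real.pi_gt_three]
      _ = 2 * Real.pi * N * c₀ := by rw [hN]; field_simp
      _ ≤ 2 * Real.pi * N * ∫ v, k v := by gcongr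
      _ = ε ^ 2 * (2 * Real.pi * N * ∫ v, k v) := by rw [hε, one_mul]
      _ = _ := by ring

/-! ### The Laplace transform and the boundary pairing -/

/-- The one-sided condition at the point `x` in a form that can be multiplied by a nonnegative
kernel; it only involves `S`, so that no measurability of `F` is needed. -/
theorem RealTauberianCondition.mul_sub_nonneg {S : ℝ → ℝ} {X : ℝ} {F f : ℝ → ℝ} {α : ℝ}
    (h : RealTauberianCondition S X F f α) {x : ℝ} (hx : X ≤ x) (u : ℝ) :
    0 ≤ (u - x) * (S u - S x) + f x * ((u - x) ^ 2 * Real.exp (|u - x| ^ α)) := by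
  have hF := h.regular x hx (u - x)
  rw [add_sub_cancel] at hF
  have hF' := abs_le.1 hF
  rcases le_total x u with hu | hu
  · have hT : S x + F x ≤ S u + F u := h.monotone_add hx (hx.trans hu) hu
    have hab : |u - x| = u - x := abs_of_nonneg (by linarith)
    have key : 0 ≤ S u - S x + f x * |u - x| * Real.exp (|u - x| ^ α) := by linarith
    have := mul_nonneg (sub_nonneg.2 hu) key
    rw [hab] at this ⊢
    linarith
  · have hT : S u + F u ≤ S x + F x := by
      rcases le_total X u with hu' | hu'
      · exact h.monotone_add hu' hx hu
      · exact (h.sup_le u hu').trans (h.monotone_add (mem_Ici.2 le_rfl) hx hx)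
    have hab : |u - x| = x - u := by rw [abs_sub_comm]; exact abs_of_nonneg (by linarith)
    have key : 0 ≤ S x - S u + f x * |u - x| * Real.exp (|u - x| ^ α) := by linarith
    have := mul_nonneg (sub_nonneg.2 hu) key
    rw [hab] at this ⊢
    linarith

/-- A one-sided bound upgrades conditional to absolute convergence of the Laplace integral. -/
theorem integrableOn_laplace {S : ℝ → ℝ} {x f₀ α σ l : ℝ} (hα₀ : 0 ≤ α) (hα₁ : α < 1)
    (hx : 0 ≤ x) (hf₀ : 0 ≤ f₀) (hσ : 0 < σ) (hloc : LocallyIntegrable S)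
    (hS : ∀ u, 0 ≤ (u - x) * (S u - S x) + f₀ * ((u - x) ^ 2 * Real.exp (|u - x| ^ α)))
    (hl : Tendsto (fun R : ℝ => ∫ u in (0 : ℝ)..R, Real.exp (-σ * u) * S u) atTop (𝓝 l)) :
    IntegrableOn (fun u => Real.exp (-σ * u) * S u) (Ioi 0) := by
  set q : ℝ → ℝ := fun u => |S x| + f₀ * (|u - x| * Real.exp (|u - x| ^ α)) with hq
  have hlocint : ∀ a b : ℝ, IntervalIntegrable (fun u => Real.exp (-σ * u) * S u) volume a b := by
    intro a b
    refine IntervalIntegrable.continuousOn_mul ?_ (by fun_prop)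
    exact intervalIntegrable_iff.2
      ((hloc.integrableOn_isCompact isCompact_uIcc).mono_set uIoc_subset_uIcc)
  have hqmeas : Measurable q := by simp only [hq]; fun_prop
  have hqint : IntegrableOn (fun u => Real.exp (-σ * u) * q u) (Ioi 0) := by
    have h1 := (integrable_pow_mul_exp_mul (β := 1) (A := 1) hα₀ hα₁ zero_le_one hσ
        1).comp_sub_right x
    refine ((h1.const_mul (Real.exp (σ * x) * (|S x| + f₀))).integrableOn (s := Ioi 0)).mono'
      (Measurable.aestronglyMeasurable (by fun_prop)) ?_
    refine (ae_restrict_iff' measurableSet_Ioi).2 (Eventually.of_forall fun u hu => ?_)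
    have hu0 : 0 < u := hu
    rw [Real.norm_of_nonneg (by simp only [hq]; positivity)]
    set y := |u - x| with hy
    have hy0 : 0 ≤ y := abs_nonneg _
    have h2 : Real.exp (-σ * u) ≤ Real.exp (σ * x) * Real.exp (-σ * y ^ (1 : ℝ)) := by
      rw [← Real.exp_add, Real.rpow_one]
      apply Real.exp_le_exp.2
      have : y ≤ u + x := abs_le.2 ⟨by linarith, by linarith⟩
      nlinarith
    have h3 : q u ≤ (|S x| + f₀) * ((1 + y) ^ 1 * Real.exp (1 * (1 + y) ^ α)) := by
      have h4 : Real.exp (y ^ α) ≤ Real.exp (1 * (1 + y) ^ α) := by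
        rw [one_mul]
        exact Real.exp_le_exp.2 (Real.rpow_le_rpow hy0 (by linarith) hα₀)
      have h5 : 1 ≤ (1 + y) ^ 1 * Real.exp (1 * (1 + y) ^ α) := by
        have : 1 ≤ Real.exp (1 * (1 + y) ^ α) := Real.one_le_exp (by positivity)
        nlinarith
      have h6 : y * Real.exp (y ^ α) ≤ (1 + y) ^ 1 * Real.exp (1 * (1 + y) ^ α) := by
        gcongr; linarith
      simp only [hq, ← hy]
      nlinarith [abs_nonneg (S x)]
    have h7 : 0 ≤ q u := by simp only [hq]; positivity
    calc Real.exp (-σ * u) * q u ≤ (Real.exp (σ * x) * Real.exp (-σ * y ^ (1 : ℝ))) *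
          ((|S x| + f₀) * ((1 + y) ^ 1 * Real.exp (1 * (1 + y) ^ α))) := by gcongr
      _ = _ := by ring
  have hlow : ∀ u, x < u → 0 ≤ S u + q u := by
    intro u hu
    have h1 := hS u
    have h2 : 0 < u - x := by linarith
    have h3 : 0 ≤ (u - x) * (S u - S x + f₀ * (|u - x| * Real.exp (|u - x| ^ α))) := by
      rw [abs_of_pos h2] at h1 ⊢
      linarith
    have h4 := nonneg_of_mul_nonneg_right h3 h2
    simp only [hq]
    linarith [neg_abs_le (S x)]
  have hqx : IntegrableOn (fun u => Real.exp (-σ * u) * q u) (Ioi x) :=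
    hqint.mono_set (Ioi_subset_Ioi hx)
  have hqii : ∀ R, x ≤ R → IntervalIntegrable (fun u => Real.exp (-σ * u) * q u) volume x R :=
    fun R hR => (intervalIntegrable_iff_integrableOn_Ioc_of_le hR).2
      (hqx.mono_set Ioc_subset_Ioi_self)
  have hsum : IntegrableOn (fun u => Real.exp (-σ * u) * S u + Real.exp (-σ * u) * q u) (Ioi x) :=
      by
    refine integrableOn_Ioi_of_intervalIntegral_norm_tendsto
      (l - (∫ u in (0 : ℝ)..x, Real.exp (-σ * u) * S u) + ∫ u in Ioi x, Real.exp (-σ * u) * q u) x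
      (b := fun R : ℝ => R) (l := atTop) (fun R => ?_) tendsto_id ?_
    · rcases le_total x R with hR | hR
      · exact (intervalIntegrable_iff_integrableOn_Ioc_of_le hR).1 ((hlocint x R).add (hqii R hR))
      · rw [Ioc_eq_empty (not_lt.2 hR)]; exact integrableOn_empty
    · have h1 := (hl.sub_const (∫ u in (0 : ℝ)..x, Real.exp (-σ * u) * S u)).add
        (intervalIntegral_tendsto_integral_Ioi x hqx tendsto_id)
      refine h1.congr' ?_
      filter_upwards [eventually_ge_atTop x] with R hR
      rw [intervalIntegral.integral_interval_sub_left (hlocint 0 R) (hlocint 0 x), id,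
        ← intervalIntegral.integral_add (hlocint x R) (hqii R hR)]
      refine intervalIntegral.integral_congr_ae (Eventually.of_forall fun u hu => ?_)
      rw [uIoc_of_le hR] at hu
      rw [← mul_add, Real.norm_of_nonneg (mul_nonneg (Real.exp_pos _).le (hlow u hu.1))]
  have hSx : IntegrableOn (fun u => Real.exp (-σ * u) * S u) (Ioi x) := by
    refine (hsum.sub hqx).congr (Eventually.of_forall fun u => ?_)
    simp only [Pi.sub_apply]; ring
  rw [← Ioc_union_Ioi_eq_Ioi hx]
  exact ((intervalIntegrable_iff_integrableOn_Ioc_of_le hx).1 (hlocint 0 x)).union hSx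

theorem TauberianSetting.integrableOn_laplace {S : ℝ → ℂ} {X : ℝ} {F f : ℝ → ℝ} {α : ℝ}
    {g : ℝ → ℂ} (h : TauberianSetting S X F f α g) {σ : ℝ} (hσ : 0 < σ) :
    IntegrableOn (fun u : ℝ => Complex.exp (-σ * u) * S u) (Ioi 0) := by
  obtain ⟨-, L, hL, -⟩ := h.boundary
  have hl := hL σ (by simpa using hσ)
  set x := max X 0 with hx
  have hre := h.tauberian.1
  have hre_loc : LocallyIntegrable fun u => (S u).re := fun u => by
    obtain ⟨U, hU, hi⟩ := h.locallyIntegrable u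
    exact ⟨U, hU, hi.re⟩
  have him_loc : LocallyIntegrable fun u => (S u).im := fun u => by
    obtain ⟨U, hU, hi⟩ := h.locallyIntegrable u
    exact ⟨U, hU, hi.im⟩
  have hii : ∀ R : ℝ, IntervalIntegrable (fun u : ℝ => Complex.exp (-σ * u) * S u) volume 0 R := by
    intro R
    refine IntervalIntegrable.continuousOn_mul ?_ (by fun_prop)
    exact intervalIntegrable_iff.2
      ((h.locallyIntegrable.integrableOn_isCompact isCompact_uIcc).mono_set uIoc_subset_uIcc)
  have hexp : ∀ u : ℝ, Complex.exp (-σ * u) * S u = (Real.exp (-σ * u) : ℂ) * S u := fun u => by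
    push_cast; rfl
  have hlre : Tendsto (fun R : ℝ => ∫ u in (0 : ℝ)..R, Real.exp (-σ * u) * (S u).re) atTop
      (𝓝 (L σ).re) := by
    refine ((Complex.continuous_re.tendsto _).comp hl).congr fun R => ?_
    have := Complex.reCLM.intervalIntegral_comp_comm (hii R)
    simp only [Complex.reCLM_apply] at this
    rw [Function.comp_apply, ← this]
    congr 1; ext u
    rw [hexp, Complex.re_ofReal_mul]
  have hlim : Tendsto (fun R : ℝ => ∫ u in (0 : ℝ)..R, Real.exp (-σ * u) * (S u).im) atTop
      (𝓝 (L σ).im) := by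
    refine ((Complex.continuous_im.tendsto _).comp hl).congr fun R => ?_
    have := Complex.imCLM.intervalIntegral_comp_comm (hii R)
    simp only [Complex.imCLM_apply] at this
    rw [Function.comp_apply, ← this]
    congr 1; ext u
    rw [hexp, Complex.im_ofReal_mul]
  have h1 := FlexTauberian.integrableOn_laplace hre.alpha_nonneg hre.alpha_lt_one (le_max_right X 0)
    (hre.f_nonneg x) hσ hre_loc (hre.mul_sub_nonneg (le_max_left X 0)) hlre
  have h2 : IntegrableOn (fun u => Real.exp (-σ * u) * (S u).im) (Ioi 0) := by
    rcases h.tauberian.2 with him | him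
    · simp [him]
    · exact FlexTauberian.integrableOn_laplace hre.alpha_nonneg hre.alpha_lt_one (le_max_right X 0)
        (him.f_nonneg x) hσ him_loc (him.mul_sub_nonneg (le_max_left X 0)) hlim
  have h3 : IntegrableOn (fun u => ((Real.exp (-σ * u) * (S u).re : ℝ) : ℂ) +
      ((Real.exp (-σ * u) * (S u).im : ℝ) : ℂ) * Complex.I) (Ioi 0) :=
    h1.ofReal.add (h2.ofReal.mul_const _)
  refine h3.congr (Eventually.of_forall fun u => ?_)
  dsimp only
  rw [hexp]
  conv_rhs => rw [← Complex.re_add_im (S u)]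
  push_cast; ring

/-- The boundary pairing, written as a limit of integrals of `S` against the transform of `ψ`. -/
theorem TauberianSetting.tendsto_integral {S : ℝ → ℂ} {X : ℝ} {F f : ℝ → ℝ} {α : ℝ}
    {g : ℝ → ℂ} (h : TauberianSetting S X F f α g) {ψ : ℝ → ℂ} (hψ : ContDiff ℝ (⊤ : ℕ∞) ψ)
    (hψc : HasCompactSupport ψ) :
    Tendsto (fun σ : ℝ => ∫ u in Ioi (0 : ℝ), Complex.exp (-σ * u) * S u *
      ∫ t : ℝ, Complex.exp (-(Complex.I * t * u)) * ψ t) (𝓝[>] 0) (𝓝 (∫ t : ℝ, g t * ψ t)) := by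
  obtain ⟨-, L, hL, hlim⟩ := h.boundary
  refine (hlim ψ hψ hψc).congr' ?_
  filter_upwards [self_mem_nhdsWithin] with σ hσ
  have hσ' : 0 < σ := hσ
  have hint := h.integrableOn_laplace hσ'
  have hψi : Integrable ψ := hψ.continuous.integrable_of_hasCompactSupport hψc
  have hLval : ∀ t : ℝ, L (σ + Complex.I * t) =
      ∫ u in Ioi (0 : ℝ), Complex.exp (-(Complex.I * t * u)) * (Complex.exp (-σ * u) * S u) := by
    intro t
    have h1 := hL (σ + Complex.I * t) (by simpa using hσ')
    have h2 : IntegrableOn (fun u : ℝ => Complex.exp (-(Complex.I * t * u)) *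
        (Complex.exp (-σ * u) * S u)) (Ioi 0) := by
      refine hint.bdd_mul (c := 1) (by fun_prop) (Eventually.of_forall fun u => ?_)
      rw [show -(Complex.I * (t : ℂ) * (u : ℂ)) = ((-(t * u) : ℝ) : ℂ) * Complex.I by
          push_cast; ring,
        Complex.norm_exp_ofReal_mul_I]
    have h3 := intervalIntegral_tendsto_integral_Ioi 0 h2 tendsto_id
    refine tendsto_nhds_unique h1 (h3.congr fun R => ?_)
    congr 1; ext u
    rw [← mul_assoc, ← Complex.exp_add]
    congr 2; ring
  simp only [hLval]
  have hprod : Integrable (Function.uncurry fun (t u : ℝ) =>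
      Complex.exp (-(Complex.I * t * u)) * (Complex.exp (-σ * u) * S u) * ψ t)
      (volume.prod (volume.restrict (Ioi 0))) := by
    have h0 : Integrable (fun z : ℝ × ℝ => ψ z.1 * (Complex.exp (-σ * z.2) * S z.2))
        (volume.prod (volume.restrict (Ioi 0))) := hψi.mul_prod hint
    have := h0.bdd_mul (c := 1) (f := fun z : ℝ × ℝ => Complex.exp (-(Complex.I * z.1 * z.2)))
      (by fun_prop) (Eventually.of_forall fun z => by
        rw [show -(Complex.I * (z.1 : ℂ) * (z.2 : ℂ)) = ((-(z.1 * z.2) : ℝ) : ℂ) * Complex.I by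
          push_cast; ring, Complex.norm_exp_ofReal_mul_I])
    refine this.congr (Eventually.of_forall fun z => ?_)
    simp only [Function.uncurry]; ring
  calc _ = ∫ t : ℝ, ∫ u in Ioi (0 : ℝ),
        Complex.exp (-(Complex.I * t * u)) * (Complex.exp (-σ * u) * S u) * ψ t := by
        congr 1; ext t; rw [integral_mul_const]
    _ = ∫ u in Ioi (0 : ℝ), ∫ t : ℝ,
        Complex.exp (-(Complex.I * t * u)) * (Complex.exp (-σ * u) * S u) * ψ t :=
        integral_integral_swap hprod
    _ = _ := by
        congr 1; ext u
        rw [← integral_const_mul]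
        congr 1; ext t; ring

/-- The pairing of `g` with the modulated and dilated test function `e^{ixt} φ(t/λ)`. -/
noncomputable def pairing (g φ : ℝ → ℂ) (x lam : ℝ) : ℂ :=
  ∫ t : ℝ, g t * (Complex.exp (Complex.I * x * t) * φ (t / lam))

/-! ### Pointwise bounds by pairings with the boundary function -/

theorem IsCutoff.eq_zero {C : ℝ} {n : ℕ} {φ : ℝ → ℂ} (h : IsCutoff C n φ) {t : ℝ}
    (ht : 1 / 2 ≤ |t|) : φ t = 0 := by
  simpa using h.iteratedDeriv_eq_zero 0 t ht

/-- Testing the one-sided condition at `x` against a kernel concentrated at scale `1 / λ` around `x`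
bounds `S x` from above (`ε = 1`) or from below (`ε = -1`). Here `P` is the limiting pairing. -/
theorem IsTauberianKernel.mul_integral_le {α C ε : ℝ} {n : ℕ} {φ : ℝ → ℂ} {κ : ℝ → ℝ}
    (hk : IsTauberianKernel α C ε n φ κ) (hα : 0 ≤ α) {S : ℝ → ℝ} {x f₀ lam P : ℝ}
    (hf₀ : 0 ≤ f₀) (hlam : 1 ≤ lam) (hS0 : ∀ u < 0, S u = 0)
    (hint : ∀ σ > 0, IntegrableOn (fun u => Real.exp (-σ * u) * S u) (Ioi 0))
    (hS : ∀ u, 0 ≤ (u - x) * (S u - S x) + f₀ * ((u - x) ^ 2 * Real.exp (|u - x| ^ α)))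
    (hP : Tendsto (fun σ : ℝ => ∫ u in Ioi (0 : ℝ), Real.exp (-σ * u) * S u *
      (lam * ((lam * (u - x)) * κ (lam * (u - x))))) (𝓝[>] 0) (𝓝 P)) :
    S x * (∫ u, u * κ u) ≤ P + C * f₀ / lam := by
  have hl0 : 0 < lam := by linarith
  -- the kernel at scale `1 / lam` and the error coming from the one-sided condition
  set ρ : ℝ → ℝ := fun u => lam * ((lam * (u - x)) * κ (lam * (u - x))) with hρ
  set e : ℝ → ℝ := fun u => f₀ * ((lam * (u - x)) ^ 2 * Real.exp (|lam * (u - x)| ^ α) *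
    κ (lam * (u - x))) with he
  have hρint : Integrable ρ :=
    ((hk.integrable.comp_mul_left' hl0.ne').comp_sub_right x).const_mul lam
  have heint : Integrable e :=
    ((hk.integrable_exp.comp_mul_left' hl0.ne').comp_sub_right x).const_mul f₀
  have hρval : ∫ u, ρ u = ∫ u, u * κ u := by
    simp only [hρ]
    rw [integral_const_mul, integral_sub_right_eq_self (fun u => (lam * u) * κ (lam * u)) x,
      Measure.integral_comp_mul_left (fun u => u * κ u) lam, abs_of_pos
          (by positivity), smul_eq_mul]
    field_simp
  have heval : ∫ u, e u ≤ C * f₀ / lam := by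
    simp only [he]
    rw [integral_const_mul, integral_sub_right_eq_self
        (fun u => (lam * u) ^ 2 * Real.exp (|lam * u| ^ α) * κ (lam * u)) x,
      Measure.integral_comp_mul_left (fun u => u ^ 2 * Real.exp (|u| ^ α) * κ u) lam,
      abs_of_pos (by positivity), smul_eq_mul]
    have := hk.integral_exp_le
    calc _ ≤ f₀ * (lam⁻¹ * C) := by gcongr
      _ = _ := by field_simp
  have hpoint : ∀ u, S x * ρ u ≤ S u * ρ u + e u := by
    intro u
    have h1 := mul_nonneg (hS u) (mul_nonneg (sq_nonneg lam) (hk.nonneg (lam * (u - x))))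
    have h2 : Real.exp (|u - x| ^ α) ≤ Real.exp (|lam * (u - x)| ^ α) := by
      apply Real.exp_le_exp.2
      apply Real.rpow_le_rpow (abs_nonneg _) _ hα
      rw [abs_mul, abs_of_pos hl0]
      exact le_mul_of_one_le_left (abs_nonneg _) hlam
    have h3 : f₀ * ((u - x) ^ 2 * Real.exp (|u - x| ^ α)) * (lam ^ 2 * κ (lam * (u - x))) ≤ e u :=
        by
      have := hk.nonneg (lam * (u - x))
      calc _ ≤ f₀ * ((u - x) ^ 2 * Real.exp (|lam * (u - x)| ^ α)) * (lam ^ 2 * κ (lam * (u - x)))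
               := by
            gcongr
        _ = e u := by simp only [he]; ring
    have h4 : (u - x) * (S u - S x) * (lam ^ 2 * κ (lam * (u - x))) = S u * ρ u - S x * ρ u := by
      simp only [hρ]; ring
    nlinarith
  have hw01 : ∀ σ > (0 : ℝ), ∀ u : ℝ, Real.exp (-σ * max u 0) ≤ 1 := fun σ hσ u => by
    apply Real.exp_le_one_iff.2
    have := mul_nonneg hσ.le (le_max_right u 0)
    linarith
  have hbdd : ∀ u, ‖ρ u‖ ≤ lam * ∫ t, ‖φ t‖ := by
    intro u
    simp only [hρ]
    rw [norm_mul, Real.norm_of_nonneg hl0.le]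
    gcongr
    rw [← Complex.norm_real, ← hk.fourier]
    refine (norm_integral_le_integral_norm _).trans (le_of_eq ?_)
    congr 1; ext t
    rw [norm_mul, show -(Complex.I * (t : ℂ) * ((lam * (u - x) : ℝ) : ℂ)) =
      ((-(t * (lam * (u - x))) : ℝ) : ℂ) * Complex.I by push_cast; ring,
      Complex.norm_exp_ofReal_mul_I, one_mul]
  have hSint : ∀ σ > (0 : ℝ), S x * (∫ u, Real.exp (-σ * max u 0) * ρ u) ≤
        (∫ u in Ioi (0 : ℝ), Real.exp (-σ * u) * S u * ρ u) + C * f₀ / lam := by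
    intro σ hσ
    have h1 : IntegrableOn (fun u => Real.exp (-σ * u) * S u * ρ u) (Ici 0) :=
      (integrableOn_Ici_iff_integrableOn_Ioi enorm_ne_top).2
        ((hint σ hσ).mul_bdd hρint.aestronglyMeasurable.restrict (Eventually.of_forall hbdd))
    have h2 := h1.integrable_indicator measurableSet_Ici
    have h3 : ∀ u, S x * (Real.exp (-σ * max u 0) * ρ u) ≤
        indicator (Ici 0) (fun u => Real.exp (-σ * u) * S u * ρ u) u + e u := by
      intro u
      have h4 := mul_le_mul_of_nonneg_left (hpoint u) (Real.exp_pos (-σ * max u 0)).le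
      have h5 : Real.exp (-σ * max u 0) * e u ≤ e u :=
        mul_le_of_le_one_left (by
          have := hk.nonneg (lam * (u - x))
          simp only [he]; positivity) (hw01 σ hσ u)
      have h6 : Real.exp (-σ * max u 0) * (S u * ρ u) =
          indicator (Ici 0) (fun u => Real.exp (-σ * u) * S u * ρ u) u := by
        by_cases hu : u < 0
        · rw [hS0 u hu, indicator_of_notMem (by simpa using hu)]; ring
        · rw [indicator_of_mem (by simpa using hu), max_eq_left (not_lt.1 hu)]; ring
      linarith
    have h7 : Integrable fun u => Real.exp (-σ * max u 0) * ρ u :=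
      hρint.bdd_mul (c := 1) (Continuous.aestronglyMeasurable (by fun_prop))
        (Eventually.of_forall fun u => by
          rw [Real.norm_of_nonneg (Real.exp_pos _).le]; exact hw01 σ hσ u)
    calc S x * (∫ u, Real.exp (-σ * max u 0) * ρ u)
        = ∫ u, S x * (Real.exp (-σ * max u 0) * ρ u) := (integral_const_mul _ _).symm
      _ ≤ ∫ u, indicator (Ici 0) (fun u => Real.exp (-σ * u) * S u * ρ u) u + e u :=
          integral_mono (h7.const_mul _) (h2.add heint) h3
      _ = (∫ u in Ioi (0 : ℝ), Real.exp (-σ * u) * S u * ρ u) + ∫ u, e u := by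
          rw [integral_add h2 heint, integral_indicator measurableSet_Ici,
            integral_Ici_eq_integral_Ioi]
      _ ≤ _ := by gcongr
  have hlim : Tendsto (fun σ : ℝ => S x * ∫ u, Real.exp (-σ * max u 0) * ρ u) (𝓝[>] 0)
      (𝓝 (S x * ∫ u, ρ u)) := by
    refine Tendsto.const_mul _ ?_
    refine tendsto_integral_filter_of_dominated_convergence (fun u => ‖ρ u‖) ?_ ?_ hρint.norm ?_
    · exact Eventually.of_forall fun σ => (Continuous.aestronglyMeasurable (by fun_prop)).mul
        hρint.aestronglyMeasurable
    · filter_upwards [self_mem_nhdsWithin] with σ hσ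
      refine Eventually.of_forall fun u => ?_
      rw [norm_mul, Real.norm_of_nonneg (Real.exp_pos _).le]
      exact mul_le_of_le_one_left (norm_nonneg _) (hw01 σ hσ u)
    · refine Eventually.of_forall fun u => ?_
      have : Tendsto (fun σ : ℝ => Real.exp (-σ * max u 0) * ρ u) (𝓝 0)
          (𝓝 (Real.exp (-0 * max u 0) * ρ u)) := by
        apply Continuous.tendsto; fun_prop
      simpa using this.mono_left nhdsWithin_le_nhds
  rw [← hρval]
  refine le_of_tendsto_of_tendsto hlim (hP.add_const _) ?_
  filter_upwards [self_mem_nhdsWithin] with σ hσ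
  exact hSint σ hσ

/-- The transform of the modulated and dilated test function is the kernel at scale `1 / lam`
centred at `x`. -/
theorem IsTauberianKernel.fourier_dilate {α C ε : ℝ} {n : ℕ} {φ : ℝ → ℂ} {κ : ℝ → ℝ}
    (hk : IsTauberianKernel α C ε n φ κ) {lam : ℝ} (hlam : 0 < lam) (x u : ℝ) :
    ∫ t : ℝ, Complex.exp (-(Complex.I * t * u)) * (Complex.exp (Complex.I * x * t) * φ (t / lam)) =
      ((lam * ((lam * (u - x)) * κ (lam * (u - x))) : ℝ) : ℂ) := by
  have h1 := hk.fourier (lam * (u - x))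
  have h2 := Measure.integral_comp_div
    (fun t : ℝ => Complex.exp (-(Complex.I * t * (lam * (u - x) : ℝ))) * φ t) lam
  rw [h1, abs_of_pos hlam] at h2
  calc _ = ∫ t : ℝ, Complex.exp (-(Complex.I * (t / lam : ℝ) * (lam * (u - x) : ℝ))) * φ (t / lam)
           := by
        congr 1; ext t
        rw [← mul_assoc, ← Complex.exp_add]
        congr 2
        have : (lam : ℂ) ≠ 0 := by exact_mod_cast hlam.ne'
        push_cast; field_simp; ring
    _ = _ := by rw [h2, Complex.real_smul]; push_cast; ring

theorem IsCutoff.hasCompactSupport_dilate {C : ℝ} {n : ℕ} {φ : ℝ → ℂ} (h : IsCutoff C n φ)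
    {lam : ℝ} (hlam : 0 < lam) (x : ℝ) :
    HasCompactSupport fun t : ℝ => Complex.exp (Complex.I * x * t) * φ (t / lam) := by
  refine HasCompactSupport.of_support_subset_isCompact (isCompact_Icc (a := -lam) (b := lam)) ?_
  intro t ht
  by_contra hcon
  refine ht ?_
  have h1 : lam < |t| := by
    by_contra h2
    exact hcon (abs_le.1 (not_lt.1 h2))
  dsimp only
  rw [h.eq_zero (t := t / lam) (by
    rw [abs_div, abs_of_pos hlam, le_div_iff₀ hlam]; linarith), mul_zero]

/-- The pairing as a limit of integrals of `S` against the kernel at scale `1 / lam` around `x`. -/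
theorem TauberianSetting.tendsto_pairing {S : ℝ → ℂ} {X : ℝ} {F f : ℝ → ℝ} {α C ε : ℝ}
    {n : ℕ} {φ : ℝ → ℂ} {κ : ℝ → ℝ} {g : ℝ → ℂ} (h : TauberianSetting S X F f α g)
    (hk : IsTauberianKernel α C ε n φ κ) {lam : ℝ} (hlam : 0 < lam) (x : ℝ) :
    Tendsto (fun σ : ℝ => ∫ u in Ioi (0 : ℝ), Complex.exp (-σ * u) * S u *
      ((lam * ((lam * (u - x)) * κ (lam * (u - x))) : ℝ) : ℂ)) (𝓝[>] 0)
      (𝓝 (pairing g φ x lam)) := by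
  have := h.tendsto_integral (ψ := fun t : ℝ => Complex.exp (Complex.I * x * t) * φ (t / lam)) ?_
    (hk.hasCompactSupport_dilate hlam x)
  · simp only [hk.fourier_dilate hlam] at this
    exact this
  · refine ContDiff.mul ?_ (hk.contDiff.comp (contDiff_id.div_const lam))
    exact (contDiff_const.mul Complex.ofRealCLM.contDiff).cexp

/-- Pointwise bound for `S` in terms of two pairings of the boundary function. -/
theorem TauberianSetting.norm_le_pairing {S : ℝ → ℂ} {X : ℝ} {F f : ℝ → ℝ} {α C : ℝ}
    {n : ℕ} {φ₁ φ₂ : ℝ → ℂ} {κ₁ κ₂ : ℝ → ℝ} {g : ℝ → ℂ} (h : TauberianSetting S X F f α g)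
    (hk₁ : IsTauberianKernel α C 1 n φ₁ κ₁) (hk₂ : IsTauberianKernel α C (-1) n φ₂ κ₂)
    {x lam : ℝ} (hx : X ≤ x) (hlam : 1 ≤ lam) :
    ‖S x‖ ≤ 2 * (‖pairing g φ₁ x lam‖ + ‖pairing g φ₂ x lam‖ + C * f x / lam) := by
  have hl0 : 0 < lam := by linarith
  have hα := h.tauberian.1.alpha_nonneg
  have hmeas : ∀ {ε φ κ}, IsTauberianKernel α C ε n φ κ → ∀ σ : ℝ, 0 < σ → IntegrableOn
      (fun u : ℝ =>
      Complex.exp (-σ * u) * S u * ((lam * ((lam * (u - x)) * κ (lam * (u - x))) : ℝ) : ℂ))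
      (Ioi 0) := by
    intro ε φ κ hk σ hσ
    have hm : AEStronglyMeasurable (fun u : ℝ => ((lam * ((lam * (u - x)) * κ (lam * (u - x))) : ℝ)
        : ℂ)) :=
      (((hk.integrable.comp_mul_left' hl0.ne').comp_sub_right x).const_mul
          lam).ofReal.aestronglyMeasurable
    refine (h.integrableOn_laplace hσ).mul_bdd (c := ∫ t : ℝ, ‖φ (t / lam)‖) hm.restrict
      (Eventually.of_forall fun u => ?_)
    rw [← hk.fourier_dilate hl0]
    refine (norm_integral_le_integral_norm _).trans (le_of_eq ?_)
    congr 1; ext t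
    rw [norm_mul, norm_mul, show -(Complex.I * (t : ℂ) * (u : ℂ)) = ((-(t * u) : ℝ) : ℂ) *
        Complex.I by
      push_cast; ring, show Complex.I * (x : ℂ) * (t : ℂ) = ((x * t : ℝ) : ℂ) * Complex.I by
      push_cast; ring, Complex.norm_exp_ofReal_mul_I, Complex.norm_exp_ofReal_mul_I, one_mul,
          one_mul]
  have hexp : ∀ (σ u : ℝ) (r : ℝ), Complex.exp (-σ * u) * S u * (r : ℂ) =
      ((Real.exp (-σ * u) * r : ℝ) : ℂ) * S u := fun σ u r => by push_cast; ring
  -- the same argument applies to the real and to the imaginary part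
  have main : ∀ T : ℂ →L[ℝ] ℝ, (∀ z, |T z| ≤ ‖z‖) →
      RealTauberianCondition (fun u => T (S u)) X F f α →
      |T (S x)| ≤ ‖pairing g φ₁ x lam‖ + ‖pairing g φ₂ x lam‖ + C * f x / lam := by
    intro T hT hR
    have hTmul : ∀ (r : ℝ) (z : ℂ), T ((r : ℂ) * z) = r * T z := fun r z => by
      rw [← Complex.real_smul, T.map_smul, smul_eq_mul]
    have hint : ∀ σ > 0, IntegrableOn (fun u => Real.exp (-σ * u) * T (S u)) (Ioi 0) := by
      intro σ hσ
      refine (T.integrable_comp (h.integrableOn_laplace hσ)).congr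
          (Eventually.of_forall fun u => ?_)
      have := hexp σ u 1
      rw [Complex.ofReal_one, mul_one, mul_one] at this
      dsimp only
      rw [this, hTmul]
    have hlimT : ∀ {ε φ κ}, IsTauberianKernel α C ε n φ κ →
        Tendsto (fun σ : ℝ => ∫ u in Ioi (0 : ℝ), Real.exp (-σ * u) * T (S u) *
          (lam * ((lam * (u - x)) * κ (lam * (u - x))))) (𝓝[>] 0) (𝓝 (T (pairing g φ x lam))) := by
      intro ε φ κ hk
      refine ((T.continuous.tendsto _).comp (h.tendsto_pairing hk hl0 x)).congr' ?_
      filter_upwards [self_mem_nhdsWithin] with σ hσ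
      rw [Function.comp_apply, ← T.integral_comp_comm (hmeas hk σ hσ)]
      congr 1; ext u
      rw [hexp, hTmul]; ring
    have h1 := hk₁.mul_integral_le hα (hR.f_nonneg x) hlam hR.zero_left hint
      (hR.mul_sub_nonneg hx) (hlimT hk₁)
    have h2 := hk₂.mul_integral_le hα (hR.f_nonneg x) hlam hR.zero_left hint
      (hR.mul_sub_nonneg hx) (hlimT hk₂)
    have h3 := hk₁.one_le_integral
    have h4 := hk₂.one_le_integral
    have h5 := (le_abs_self _).trans (hT (pairing g φ₁ x lam))
    have h6 := (le_abs_self _).trans (hT (pairing g φ₂ x lam))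
    have n1 := norm_nonneg (pairing g φ₁ x lam)
    have n2 := norm_nonneg (pairing g φ₂ x lam)
    rcases le_total 0 (T (S x)) with hs | hs
    · rw [abs_of_nonneg hs]
      nlinarith
    · rw [abs_of_nonpos hs]
      nlinarith
  have hre := main Complex.reCLM Complex.abs_re_le_norm h.tauberian.1
  have hn : ‖S x‖ ≤ |(S x).re| + |(S x).im| := Complex.norm_le_abs_re_add_abs_im _
  simp only [Complex.reCLM_apply] at hre
  rcases h.tauberian.2 with him | him
  · rw [him x, abs_zero] at hn
    have := abs_nonneg (S x).re
    linarith
  · have him := main Complex.imCLM Complex.abs_im_le_norm him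
    simp only [Complex.imCLM_apply] at him
    linarith

/-- Reduction of the theorem to bounds for pairings: any common bound `b` for the pairings of the
boundary function with the cutoffs of order `n` bounds `S x`, up to `f x / lam`. -/
theorem exists_enorm_le_of_pairing_le {α : ℝ} (hα₀ : 0 ≤ α) (hα₁ : α < 1) :
    ∃ C : ℝ, 0 < C ∧ ∀ (n : ℕ) (S : ℝ → ℂ) (X : ℝ) (F f : ℝ → ℝ) (g : ℝ → ℂ),
      TauberianSetting S X F f α g → ∀ x, X ≤ x → ∀ lam, 1 ≤ lam → ∀ b : ℝ≥0∞,
        (∀ φ, IsCutoff C n φ → ‖pairing g φ x lam‖ₑ ≤ b) →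
          ‖S x‖ₑ ≤ 4 * b + ENNReal.ofReal (2 * C) * ENNReal.ofReal (f x / lam) := by
  obtain ⟨C, hC, hker⟩ := exists_isTauberianKernel hα₀ hα₁
  refine ⟨C, hC, fun n S X F f g h x hx lam hlam b hb => ?_⟩
  obtain ⟨φ₁, κ₁, hk₁⟩ := hker n 1 (by norm_num)
  obtain ⟨φ₂, κ₂, hk₂⟩ := hker n (-1) (by norm_num)
  have h1 := h.norm_le_pairing hk₁ hk₂ hx hlam
  have hf := h.tauberian.1.f_nonneg x
  calc ‖S x‖ₑ = ENNReal.ofReal ‖S x‖ := (ofReal_norm _).symm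
    _ ≤ ENNReal.ofReal (2 * ‖pairing g φ₁ x lam‖ + 2 * ‖pairing g φ₂ x lam‖ + 2 * C * (f x / lam))
        := by
        apply ENNReal.ofReal_le_ofReal
        refine h1.trans (le_of_eq ?_); ring
    _ = 2 * ‖pairing g φ₁ x lam‖ₑ + 2 * ‖pairing g φ₂ x lam‖ₑ +
        ENNReal.ofReal (2 * C) * ENNReal.ofReal (f x / lam) := by
        rw [ENNReal.ofReal_add (by positivity) (by positivity),
          ENNReal.ofReal_add (by positivity) (by positivity), ENNReal.ofReal_mul zero_le_two,
          ENNReal.ofReal_mul zero_le_two, ENNReal.ofReal_mul (p := 2 * C) (by positivity),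
          ofReal_norm, ofReal_norm, ENNReal.ofReal_ofNat]
    _ ≤ 2 * b + 2 * b + ENNReal.ofReal (2 * C) * ENNReal.ofReal (f x / lam) := by
        gcongr
        · exact hb φ₁ hk₁.toIsCutoff
        · exact hb φ₂ hk₂.toIsCutoff
    _ = _ := by rw [← add_mul]; norm_num

/-! ### Integration by parts in the pairing -/

theorem TauberianSetting.eq_zero_of_neg {S : ℝ → ℂ} {X : ℝ} {F f : ℝ → ℝ} {α : ℝ} {g : ℝ → ℂ}
    (h : TauberianSetting S X F f α g) {x : ℝ} (hx : x < 0) : S x = 0 := by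
  refine Complex.ext (h.tauberian.1.zero_left x hx) ?_
  rcases h.tauberian.2 with him | him
  · exact him x
  · exact him.zero_left x hx

theorem le_mul_rate {s : ℝ≥0∞} {K : ℝ} {E : ℝ → ℝ → ℝ≥0∞} {f : ℝ → ℝ} {x : ℝ} (hK : 0 < K)
    (h : ∀ lam, 1 ≤ lam → s ≤ ENNReal.ofReal K * (E x lam + ENNReal.ofReal (f x / lam))) :
    s ≤ ENNReal.ofReal K * rate E f x := by
  have h0 : ENNReal.ofReal K ≠ 0 := by simpa using hK
  rw [rate, ENNReal.mul_iInf_of_ne h0 ENNReal.ofReal_ne_top]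
  refine le_iInf fun lam => ?_
  rw [ENNReal.mul_iInf_of_ne h0 ENNReal.ofReal_ne_top]
  exact le_iInf fun hlam => h lam hlam

theorem four_mul_add_le {b e y : ℝ≥0∞} {K C A : ℝ} (hK : 0 ≤ K) (hC : 0 ≤ C) (hA : 1 ≤ A)
    (hb : b ≤ ENNReal.ofReal (K * A) * e) :
    4 * b + ENNReal.ofReal (2 * C) * y ≤ ENNReal.ofReal ((4 * K + 2 * C) * A) * (e + y) := by
  have hA0 : 0 ≤ A := by linarith
  rw [mul_add]
  gcongr ?_ + ?_ * y
  · calc 4 * b ≤ 4 * (ENNReal.ofReal (K * A) * e) := by gcongr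
      _ = ENNReal.ofReal (4 * (K * A)) * e := by
          rw [ENNReal.ofReal_mul zero_le_four, ENNReal.ofReal_ofNat, mul_assoc]
      _ ≤ _ := by
          refine mul_le_mul_left (ENNReal.ofReal_le_ofReal ?_) e
          nlinarith [mul_nonneg hC hA0]
  · apply ENNReal.ofReal_le_ofReal
    nlinarith [mul_nonneg hK hA0]

theorem IsCutoff.iteratedDeriv_div_eq_zero {C : ℝ} {n : ℕ} {φ : ℝ → ℂ} (h : IsCutoff C n φ)
    {lam t : ℝ} (hlam : 0 < lam) (j : ℕ) (ht : lam / 2 ≤ |t|) : iteratedDeriv j φ (t / lam) = 0 :=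
        by
  apply h.iteratedDeriv_eq_zero
  rw [abs_div, abs_of_pos hlam, le_div_iff₀ hlam]
  linarith

theorem IsCutoff.continuous_iteratedDeriv {C : ℝ} {n : ℕ} {φ : ℝ → ℂ} (h : IsCutoff C n φ) (j : ℕ) :
    Continuous (iteratedDeriv j φ) :=
  h.contDiff.continuous_iteratedDeriv j (by exact_mod_cast le_top)

theorem IsCutoff.exists_norm_iteratedDeriv_le {C : ℝ} {n : ℕ} {φ : ℝ → ℂ} (h : IsCutoff C n φ)
    (j : ℕ) : ∃ c, ∀ t, ‖iteratedDeriv j φ t‖ ≤ c := by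
  obtain ⟨c, hc⟩ := (isCompact_Icc (a := (-1 : ℝ)) (b := 1)).exists_bound_of_continuousOn
    (h.continuous_iteratedDeriv j).continuousOn
  refine ⟨max c 0, fun t => ?_⟩
  by_cases ht : |t| ≤ 1
  · exact (hc t (abs_le.1 ht)).trans (le_max_left _ _)
  · rw [h.iteratedDeriv_eq_zero j t (by linarith [not_le.1 ht]), norm_zero]
    exact le_max_right _ _

theorem norm_exp_I_mul (x t : ℝ) : ‖Complex.exp (Complex.I * x * t)‖ = 1 := by
  rw [show Complex.I * (x : ℂ) * (t : ℂ) = ((x * t : ℝ) : ℂ) * Complex.I by push_cast; ring,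
    Complex.norm_exp_ofReal_mul_I]

theorem IsCutoff.integrable_pairing {C : ℝ} {n : ℕ} {φ : ℝ → ℂ} (h : IsCutoff C n φ)
    {lam : ℝ} (hlam : 0 < lam) {H : ℝ → ℂ} (hH : IntegrableOn H (Ioo (-lam) lam)) (x : ℝ) (j : ℕ) :
    Integrable fun t : ℝ => H t * (Complex.exp (Complex.I * x * t) * iteratedDeriv j φ (t / lam))
        := by
  obtain ⟨c, hc⟩ := h.exists_norm_iteratedDeriv_le j
  have hcont := h.continuous_iteratedDeriv j
  have h1 : IntegrableOn (fun t : ℝ =>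
      H t * (Complex.exp (Complex.I * x * t) * iteratedDeriv j φ (t / lam))) (Ioo (-lam) lam) :=
    hH.mul_bdd (c := c) (Continuous.aestronglyMeasurable
        (by fun_prop)) (Eventually.of_forall fun t => by
      rw [norm_mul, norm_exp_I_mul, one_mul]; exact hc _)
  refine h1.integrable_of_forall_notMem_eq_zero fun t ht => ?_
  have : lam ≤ |t| := by
    by_contra h2
    exact ht (abs_lt.1 (not_le.1 h2))
  rw [h.iteratedDeriv_div_eq_zero hlam j (by linarith), mul_zero, mul_zero]

/-- One integration by parts; the boundary terms vanish because the cutoff does. -/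
theorem IsCutoff.mul_norm_pairing_le {C : ℝ} {n : ℕ} {φ : ℝ → ℂ} (hφ : IsCutoff C n φ)
    {lam x : ℝ} (hlam : 0 < lam) (hx : 0 ≤ x) {h : ℝ → ℂ} (hd : Differentiable ℝ h)
    (hint : IntegrableOn (deriv h) (Ioo (-lam) lam)) (j : ℕ) :
    x * ‖pairing h (iteratedDeriv j φ) x lam‖ ≤
      ‖pairing (deriv h) (iteratedDeriv j φ) x lam‖ +
        lam⁻¹ * ‖pairing h (iteratedDeriv (j + 1) φ) x lam‖ := by
  have hhint : IntegrableOn h (Ioo (-lam) lam) :=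
    (hd.continuous.integrableOn_Icc (a := -lam) (b := lam)).mono_set Ioo_subset_Icc_self
  have i1 := hφ.integrable_pairing hlam hint x j
  have i2 := hφ.integrable_pairing hlam hhint x j
  have i3 := hφ.integrable_pairing hlam hhint x (j + 1)
  have hder : ∀ t : ℝ, HasDerivAt
      (fun t : ℝ => h t * (Complex.exp (Complex.I * x * t) * iteratedDeriv j φ (t / lam)))
      (deriv h t * (Complex.exp (Complex.I * x * t) * iteratedDeriv j φ (t / lam)) +
        ((Complex.I * x) * (h t * (Complex.exp (Complex.I * x * t) * iteratedDeriv j φ (t / lam))) +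
        (lam⁻¹ : ℂ) * (h t * (Complex.exp (Complex.I * x * t) * iteratedDeriv (j + 1) φ
            (t / lam))))) t := by
    intro t
    have h1 : HasDerivAt (fun t : ℝ => Complex.exp (Complex.I * x * t))
        (Complex.exp (Complex.I * x * t) * (Complex.I * x * 1)) t :=
      ((Complex.ofRealCLM.hasDerivAt (x := t)).const_mul (Complex.I * x)).cexp
    have h2 : HasDerivAt (iteratedDeriv j φ) (iteratedDeriv (j + 1) φ (t / lam)) (t / lam) := by
      rw [iteratedDeriv_succ]
      exact (hφ.contDiff.differentiable_iteratedDeriv j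
        (by exact_mod_cast WithTop.coe_lt_top _)).differentiableAt.hasDerivAt
    have h3 : HasDerivAt (fun t : ℝ => iteratedDeriv j φ (t / lam))
        (lam⁻¹ • iteratedDeriv (j + 1) φ (t / lam)) t := by
      have := HasDerivAt.scomp t h2 ((hasDerivAt_id t).div_const lam)
      simpa [Function.comp_def] using this
    have h4 := (hd t).hasDerivAt.mul (h1.mul h3)
    refine h4.congr_deriv ?_
    rw [Complex.real_smul, Pi.mul_apply]; push_cast; ring
  have i4 : Integrable fun t : ℝ =>
      (Complex.I * x) * (h t * (Complex.exp (Complex.I * x * t) * iteratedDeriv j φ (t / lam))) +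
      (lam⁻¹ : ℂ) * (h t * (Complex.exp (Complex.I * x * t) * iteratedDeriv (j + 1) φ (t / lam))) :=
    (i2.const_mul _).add (i3.const_mul _)
  have hz := integral_eq_zero_of_hasDerivAt_of_integrable hder (i1.add i4) i2
  rw [integral_add i1 i4,
    integral_add (i2.const_mul _) (i3.const_mul _), integral_const_mul, integral_const_mul] at hz
  have hkey : Complex.I * x * pairing h (iteratedDeriv j φ) x lam =
      -(pairing (deriv h) (iteratedDeriv j φ) x lam +
        (lam⁻¹ : ℂ) * pairing h (iteratedDeriv (j + 1) φ) x lam) := by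
    simp only [pairing]
    linear_combination hz
  calc x * ‖pairing h (iteratedDeriv j φ) x lam‖ = ‖Complex.I * x * pairing h (iteratedDeriv j φ) x
           lam‖ := by
        rw [norm_mul, norm_mul, Complex.norm_I, one_mul, Complex.norm_real, Real.norm_of_nonneg hx]
    _ ≤ _ := by
        rw [hkey, norm_neg]
        refine (norm_add_le _ _).trans (le_of_eq ?_)
        rw [norm_mul, norm_inv, Complex.norm_real, Real.norm_of_nonneg hlam.le]

theorem IsCutoff.norm_pairing_le {C : ℝ} {n : ℕ} {φ : ℝ → ℂ} (hφ : IsCutoff C n φ)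
    {lam : ℝ} (hlam : 0 < lam) {H : ℝ → ℂ} {V c : ℝ} {j : ℕ} (hV : 0 ≤ V)
    (hc : ∀ t, ‖iteratedDeriv j φ t‖ ≤ c)
    (hH : ∫⁻ t in Ioo (-lam) lam, ‖H t‖ₑ ≤ ENNReal.ofReal V) (x : ℝ) :
    ‖pairing H (iteratedDeriv j φ) x lam‖ ≤ c * V := by
  have hc0 : 0 ≤ c := (norm_nonneg _).trans (hc 0)
  rw [← ENNReal.ofReal_le_ofReal_iff (by positivity), ofReal_norm]
  calc ‖pairing H (iteratedDeriv j φ) x lam‖ₑ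
      ≤ ∫⁻ t, ‖H t * (Complex.exp (Complex.I * x * t) * iteratedDeriv j φ (t / lam))‖ₑ :=
        enorm_integral_le_lintegral_enorm _
    _ ≤ ∫⁻ t, indicator (Ioo (-lam) lam) (fun t => ENNReal.ofReal c * ‖H t‖ₑ) t := by
        refine lintegral_mono fun t => ?_
        by_cases ht : t ∈ Ioo (-lam) lam
        · rw [indicator_of_mem ht, enorm_mul, enorm_mul, mul_comm]
          gcongr
          rw [← ofReal_norm (Complex.exp _), norm_exp_I_mul, ENNReal.ofReal_one, one_mul,
            ← ofReal_norm]
          exact ENNReal.ofReal_le_ofReal (hc _)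
        · have : lam ≤ |t| := by
            by_contra h2
            exact ht (abs_lt.1 (not_le.1 h2))
          rw [hφ.iteratedDeriv_div_eq_zero hlam j (by linarith)]
          simp
    _ = ENNReal.ofReal c * ∫⁻ t in Ioo (-lam) lam, ‖H t‖ₑ := by
        rw [lintegral_indicator measurableSet_Ioo, lintegral_const_mul' _ _ ENNReal.ofReal_ne_top]
    _ ≤ ENNReal.ofReal c * ENNReal.ofReal V := by gcongr
    _ = _ := (ENNReal.ofReal_mul hc0).symm

/-- Iterating the recurrence that integration by parts produces: each of the `n` steps moves one
derivative to the first or to the second index. -/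
theorem pow_mul_le_of_recurrence {J : ℕ → ℕ → ℝ} {n : ℕ} {x U a b : ℝ} (hx : 0 ≤ x)
    (hrec : ∀ k j, k + j < n → x * J k j ≤ J (k + 1) j + J k (j + 1))
    (htop : ∀ k j, k + j = n → J k j ≤ U * a ^ k * b ^ j) : x ^ n * J 0 0 ≤ U * (a + b) ^ n := by
  have key : ∀ m k j, k + j + m = n → x ^ m * J k j ≤ U * a ^ k * b ^ j * (a + b) ^ m := by
    intro m
    induction m with
    | zero => intro k j h; simpa using htop k j (by omega)
    | succ m ih =>
      intro k j h
      calc x ^ (m + 1) * J k j = x ^ m * (x * J k j) := by ring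
        _ ≤ x ^ m * (J (k + 1) j + J k (j + 1)) := by
            gcongr; exact hrec k j (by omega)
        _ = x ^ m * J (k + 1) j + x ^ m * J k (j + 1) := by ring
        _ ≤ U * a ^ (k + 1) * b ^ j * (a + b) ^ m + U * a ^ k * b ^ (j + 1) * (a + b) ^ m :=
            add_le_add (ih _ _ (by omega)) (ih _ _ (by omega))
        _ = _ := by ring
  simpa using key n 0 0 (by omega)

theorem stronglyMeasurable_iteratedDeriv {g : ℝ → ℂ} {N : ℕ} (hN : N ≠ 0) :
    StronglyMeasurable (iteratedDeriv N g) := by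
  obtain ⟨m, rfl⟩ := Nat.exists_eq_succ_of_ne_zero hN
  rw [Nat.succ_eq_add_one, iteratedDeriv_succ]
  exact stronglyMeasurable_deriv _

theorem aestronglyMeasurable_iteratedDeriv {g : ℝ → ℂ} (hg : LocallyIntegrable g) (N : ℕ) :
    AEStronglyMeasurable (iteratedDeriv N g) := by
  rcases eq_or_ne N 0 with rfl | hN
  · simpa using hg.aestronglyMeasurable
  · exact (stronglyMeasurable_iteratedDeriv hN).aestronglyMeasurable

/-- `N` integrations by parts: the derivatives of `g` up to order `N` fall on `g` or on the cutoff.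
-/
theorem IsCutoff.pow_mul_norm_pairing_le {C : ℝ} {N : ℕ} {φ : ℝ → ℂ} (hφ : IsCutoff C N φ)
    (hC : 0 ≤ C) {g : ℝ → ℂ} (hg : LocallyIntegrable g) (hd : DiffTimes N g) {lam x U a b : ℝ}
    (hlam : 0 < lam) (hx : 0 ≤ x) {V : ℕ → ℝ} (hV0 : ∀ k, 0 ≤ V k)
    (hV : ∀ k ≤ N, ∫⁻ t in Ioo (-lam) lam, ‖iteratedDeriv k g t‖ₑ ≤ ENNReal.ofReal (V k))
    (hU : ∀ k j, k + j = N → lam⁻¹ ^ j * ((24 * (N + 1)) ^ j * V k) ≤ U * a ^ k * b ^ j) :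
    x ^ N * ‖pairing g φ x lam‖ ≤ C * U * (a + b) ^ N := by
  have hint : ∀ k ≤ N, IntegrableOn (iteratedDeriv k g) (Ioo (-lam) lam) := fun k hk =>
    ⟨(aestronglyMeasurable_iteratedDeriv hg k).restrict,
      (hV k hk).trans_lt ENNReal.ofReal_lt_top⟩
  have := pow_mul_le_of_recurrence (n := N) (x := x) (U := C * U) (a := a) (b := b)
    (J := fun k j => lam⁻¹ ^ j * ‖pairing (iteratedDeriv k g) (iteratedDeriv j φ) x lam‖) hx ?_ ?_
  · simpa using this
  · intro k j hkj
    have h1 := hφ.mul_norm_pairing_le hlam hx (hd k (by omega))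
      (by rw [← iteratedDeriv_succ]; exact hint (k + 1) (by omega)) j
    rw [← iteratedDeriv_succ] at h1
    calc _ = lam⁻¹ ^ j * (x * ‖pairing (iteratedDeriv k g) (iteratedDeriv j φ) x lam‖) := by ring
      _ ≤ lam⁻¹ ^ j * _ := mul_le_mul_of_nonneg_left h1 (by positivity)
      _ = _ := by ring
  · intro k j hkj
    have h1 := hφ.norm_pairing_le hlam (hV0 k) (hφ.norm_iteratedDeriv_le j (by omega))
      (hV k (by omega)) x
    calc _ ≤ lam⁻¹ ^ j * (C * (24 * (N + 1)) ^ j * V k) := by gcongr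
      _ = C * (lam⁻¹ ^ j * ((24 * (N + 1)) ^ j * V k)) := by ring
      _ ≤ C * (U * a ^ k * b ^ j) := mul_le_mul_of_nonneg_left (hU k j hkj) hC
      _ = _ := by ring

/-- Fundamental theorem of calculus with an `L¹`-bound for the derivative. -/
theorem norm_sub_le_of_lintegral_deriv {h : ℝ → ℂ} (hd : Differentiable ℝ h) {lam V t : ℝ}
    (hV0 : 0 ≤ V) (hV : ∫⁻ t in Ioo (-lam) lam, ‖deriv h t‖ₑ ≤ ENNReal.ofReal V)
    (ht : t ∈ Ioo (-lam) lam) : ‖h t - h 0‖ ≤ V := by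
  have hl : (0 : ℝ) ∈ Ioo (-lam) lam := by
    constructor <;> linarith [ht.1, ht.2]
  have hsub : uIcc 0 t ⊆ Ioo (-lam) lam := (convex_Ioo _ _).ordConnected.uIcc_subset hl ht
  have hint : IntegrableOn (deriv h) (Ioo (-lam) lam) :=
    ⟨(stronglyMeasurable_deriv h).aestronglyMeasurable, hV.trans_lt ENNReal.ofReal_lt_top⟩
  have hii : IntervalIntegrable (deriv h) volume 0 t :=
    intervalIntegrable_iff.2 (hint.mono_set (uIoc_subset_uIcc.trans hsub))
  rw [← intervalIntegral.integral_eq_sub_of_hasDerivAt (fun s _ => (hd s).hasDerivAt) hii]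
  rw [← ENNReal.ofReal_le_ofReal_iff hV0, ofReal_norm]
  refine le_trans ?_ hV
  rw [← ofReal_norm, intervalIntegral.norm_integral_eq_norm_integral_uIoc, ofReal_norm]
  exact (enorm_integral_le_lintegral_enorm _).trans
    (lintegral_mono_set (uIoc_subset_uIcc.trans hsub))

theorem lintegral_Ioo_le_of_norm_le {h : ℝ → ℂ} {lam c : ℝ} (hlam : 0 < lam)
    (hc : ∀ t ∈ Ioo (-lam) lam, ‖h t‖ ≤ c) :
    ∫⁻ t in Ioo (-lam) lam, ‖h t‖ₑ ≤ ENNReal.ofReal (2 * lam * c) := by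
  have hc0 : 0 ≤ c := (norm_nonneg _).trans (hc 0 (by constructor <;> linarith))
  calc ∫⁻ t in Ioo (-lam) lam, ‖h t‖ₑ ≤ ∫⁻ t in Ioo (-lam) lam, ENNReal.ofReal c := by
        refine setLIntegral_mono measurable_const fun t ht => ?_
        rw [← ofReal_norm]
        exact ENNReal.ofReal_le_ofReal (hc t ht)
    _ = ENNReal.ofReal (2 * lam * c) := by
        rw [setLIntegral_const, Real.volume_Ioo, ← ENNReal.ofReal_mul hc0]
        congr 1; ring

/-- The `L¹`-norm of `g^{(N-j)}` on `(-lam, lam)` is controlled by that of `g^{(N)}` and by the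
derivatives at the origin, at the price of a factor `(4 lam)^j`. -/
theorem lintegral_iteratedDeriv_le {g : ℝ → ℂ} {N : ℕ} (hd : DiffTimes N g) {lam V D : ℝ}
    (hlam : 1 ≤ lam) (hV0 : 0 ≤ V) (hD : 0 ≤ D) (h0 : ∀ j < N, ‖iteratedDeriv j g 0‖ ≤ D)
    (hV : ∫⁻ t in Ioo (-lam) lam, ‖iteratedDeriv N g t‖ₑ ≤ ENNReal.ofReal V) :
    ∀ j k, k + j = N →
      ∫⁻ t in Ioo (-lam) lam, ‖iteratedDeriv k g t‖ₑ ≤ ENNReal.ofReal (lam ^ j * (4 ^ j * (V + D)))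
          := by
  intro j
  induction j with
  | zero =>
    intro k hk
    obtain rfl : k = N := by omega
    refine hV.trans (ENNReal.ofReal_le_ofReal ?_)
    simp [hD]
  | succ j ih =>
    intro k hk
    have h1 := ih (k + 1) (by omega)
    rw [iteratedDeriv_succ] at h1
    have h2 : ∀ t ∈ Ioo (-lam) lam, ‖iteratedDeriv k g t‖ ≤ D + lam ^ j * (4 ^ j * (V + D)) := by
      intro t ht
      have h3 := norm_sub_le_of_lintegral_deriv (hd k (by omega)) (by positivity) h1 ht
      have h4 := norm_le_norm_add_norm_sub' (iteratedDeriv k g t) (iteratedDeriv k g 0)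
      linarith [h0 k (by omega)]
    refine (lintegral_Ioo_le_of_norm_le (by linarith) h2).trans (ENNReal.ofReal_le_ofReal ?_)
    have h5 : D ≤ lam ^ j * (4 ^ j * (V + D)) := by
      have h6 : 1 ≤ lam ^ j := one_le_pow₀ hlam
      have h7 : (1 : ℝ) ≤ 4 ^ j := one_le_pow₀ (by norm_num)
      have h8 : 1 ≤ lam ^ j * 4 ^ j := one_le_mul_of_one_le_of_one_le h6 h7
      nlinarith
    calc 2 * lam * (D + lam ^ j * (4 ^ j * (V + D)))
        ≤ 2 * lam * (lam ^ j * (4 ^ j * (V + D)) + lam ^ j * (4 ^ j * (V + D))) := by gcongr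
      _ = _ := by ring

/-! ### The classes of finitely differentiable functions -/

theorem ofReal_div_pow_eq {N : ℕ} {x a : ℝ} (hx : 0 < x) :
    ENNReal.ofReal (a / x ^ N) = ENNReal.ofReal a * invPow N x := by
  rw [invPow, div_eq_mul_inv, ENNReal.ofReal_mul' (by positivity), ← inv_pow,
    ENNReal.ofReal_pow (by positivity), ENNReal.ofReal_inv_of_pos hx]

theorem invPow_ne_zero (N : ℕ) (x : ℝ) : invPow N x ≠ 0 := by
  simp [invPow]

/-- Passing from a bound for `x ^ N * z` to one for `z`; at `x = 0` the right-hand side is infinite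
unless `N = 0`. -/
theorem enorm_le_ofReal_mul_invPow {z : ℂ} {N : ℕ} {x a : ℝ} (hx : 0 ≤ x) (ha : 0 < a)
    (h : x ^ N * ‖z‖ ≤ a) : ‖z‖ₑ ≤ ENNReal.ofReal a * invPow N x := by
  rcases hx.eq_or_lt with rfl | hx
  · rcases eq_or_ne N 0 with rfl | hN
    · have h1 := ENNReal.ofReal_le_ofReal (show ‖z‖ ≤ a by simpa using h)
      rw [ofReal_norm] at h1
      simpa [invPow] using h1
    · simp [invPow, hN, ENNReal.mul_top, ha]
  · rw [← ofReal_div_pow_eq hx, ← ofReal_norm]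
    apply ENNReal.ofReal_le_ofReal
    rw [le_div_iff₀ (by positivity)]
    linarith

/-- Common core of the classes `Dif` and `DifI`; `Q` is the quantity that multiplies `x^{-N}`. -/
theorem pairing_le_of_dif {C D : ℝ} {N : ℕ} (hC : 0 < C) (hD : 0 < D) {φ : ℝ → ℂ}
    (hφ : IsCutoff C N φ) {g : ℝ → ℂ} (hg : LocallyIntegrable g) (hd : DiffTimes N g)
    (h0 : ∀ j < N, ‖iteratedDeriv j g 0‖ ≤ D) {lam x A : ℝ} (hA : 1 ≤ A) (hlam : 1 ≤ lam)
    (hx : 0 ≤ x) {Q : ℝ≥0∞}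
    (hQ : ∫⁻ t in Ioo (-lam) lam, ‖iteratedDeriv N g t‖ₑ ≤ ENNReal.ofReal A * Q) :
    ‖pairing g φ x lam‖ₑ ≤
      ENNReal.ofReal (C * (1 + D) * (1 + 96 * (N + 1)) ^ N * A) * (invPow N x * (1 + Q)) := by
  set c : ℝ := C * (1 + D) * (1 + 96 * (N + 1)) ^ N with hc
  have hc0 : 0 < c := by positivity
  rcases eq_or_ne Q ∞ with rfl | hQt
  · rw [add_top, ENNReal.mul_top (invPow_ne_zero N x), ENNReal.mul_top (by
      rw [Ne, ENNReal.ofReal_eq_zero, not_le]; positivity)]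
    exact le_top
  · set V : ℝ := A * Q.toReal with hV
    have hV0 : 0 ≤ V := by positivity
    have hQV : ENNReal.ofReal A * Q = ENNReal.ofReal V := by
      rw [hV, ENNReal.ofReal_mul (by linarith), ENNReal.ofReal_toReal hQt]
    rw [hQV] at hQ
    have h1 := hφ.pow_mul_norm_pairing_le hC.le hg hd (lam := lam) (x := x) (U := V + D) (a := 1)
      (b := 96 * (N + 1)) (V := fun k => lam ^ (N - k) * (4 ^ (N - k) * (V + D))) (by linarith) hx
      (fun k => by positivity)
      (fun k hk => lintegral_iteratedDeriv_le hd hlam hV0 hD.le h0 hQ (N - k) k (by omega)) ?_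
    · have h2 : x ^ N * ‖pairing g φ x lam‖ ≤ c * A * (1 + Q.toReal) := by
        refine h1.trans ?_
        have h3 : V + D ≤ (1 + D) * (A * (1 + Q.toReal)) := by
          have : 0 ≤ Q.toReal := ENNReal.toReal_nonneg
          rw [hV]
          nlinarith [mul_nonneg hD.le this, mul_nonneg (mul_nonneg hD.le this)
              (by linarith : 0 ≤ A)]
        calc C * (V + D) * (1 + 96 * (N + 1)) ^ N
            ≤ C * ((1 + D) * (A * (1 + Q.toReal))) * (1 + 96 * (N + 1)) ^ N := by gcongr
          _ = _ := by rw [hc]; ring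
      have h3 := enorm_le_ofReal_mul_invPow hx (by positivity) h2
      refine h3.trans (le_of_eq ?_)
      rw [ENNReal.ofReal_mul (by positivity), ENNReal.ofReal_add zero_le_one (by positivity),
        ENNReal.ofReal_toReal hQt, ENNReal.ofReal_one]
      ring
    · intro k j hkj
      have hj : N - k = j := by omega
      rw [hj, one_pow, mul_one]
      have hl : lam⁻¹ ^ j * lam ^ j = 1 := by
        rw [← mul_pow, inv_mul_cancel₀ (by linarith), one_pow]
      calc _ = (lam⁻¹ ^ j * lam ^ j) * ((V + D) * (24 * ((N : ℝ) + 1) * 4) ^ j) := by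
            rw [mul_pow (24 * ((N : ℝ) + 1)) 4]; ring
        _ ≤ _ := by rw [hl, one_mul]; ring_nf; exact le_refl _

/-- Hölder's inequality for `F = (F / G) * G` on `(-lam, lam)`. -/
theorem lintegral_Ioo_le_eLpNorm_mul {F : ℝ → ℂ} {G : ℝ → ℝ} {p q : ℝ≥0∞}
    (hpq : p.HolderConjugate q)
    (hG : ∀ t, 0 < G t) (hGm : AEStronglyMeasurable G) (hF : AEStronglyMeasurable F) (lam : ℝ) :
    ∫⁻ t in Ioo (-lam) lam, ‖F t‖ₑ ≤
      eLpNorm (fun t => F t / (G t : ℂ)) p volume *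
        eLpNorm (indicator (Ioo (-lam) lam) G) q volume := by
  have h1 := eLpNorm_smul_le_mul_eLpNorm (p := q) (q := p) (r := 1) (μ := volume)
    (f := fun t => F t / (G t : ℂ)) (φ := indicator (Ioo (-lam) lam) G)
    (hF.div₀ (Complex.continuous_ofReal.comp_aestronglyMeasurable hGm))
    (hGm.indicator measurableSet_Ioo)
  rw [eLpNorm_one_eq_lintegral_enorm, mul_comm] at h1
  refine le_trans (le_of_eq ?_) h1
  rw [← lintegral_indicator measurableSet_Ioo]
  congr 1; ext t
  by_cases ht : t ∈ Ioo (-lam) lam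
  · rw [indicator_of_mem ht, Pi.smul_apply', indicator_of_mem ht, Complex.real_smul,
      mul_div_cancel₀ _ (by exact_mod_cast (hG t).ne')]
  · rw [indicator_of_notMem ht, Pi.smul_apply', indicator_of_notMem ht, zero_smul, enorm_zero]

/-- `exists_enorm_le_of_pairing_le` for a fixed order `n` of the cutoffs, with the infimum over
`lam`. -/
theorem exists_le_rate {α : ℝ} (hα₀ : 0 ≤ α) (hα₁ : α < 1) :
    ∃ C : ℝ, 0 < C ∧ ∀ (n : ℕ) (S : ℝ → ℂ) (X : ℝ) (F f : ℝ → ℝ) (g : ℝ → ℂ) (K A : ℝ)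
      (E : ℝ → ℝ → ℝ≥0∞), TauberianSetting S X F f α g → 0 ≤ K → 1 ≤ A → ∀ x, X ≤ x →
        (0 ≤ x → ∀ lam, 1 ≤ lam → ∀ φ, IsCutoff C n φ →
          ‖pairing g φ x lam‖ₑ ≤ ENNReal.ofReal (K * A) * E x lam) →
        ‖S x‖ₑ ≤ ENNReal.ofReal ((4 * K + 2 * C) * A) * rate E f x := by
  obtain ⟨C, hC, h⟩ := exists_enorm_le_of_pairing_le hα₀ hα₁
  refine ⟨C, hC, fun n S X F f g K A E hS hK hA x hx hE => ?_⟩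
  rcases lt_or_ge x 0 with hx0 | hx0
  · rw [hS.eq_zero_of_neg hx0, enorm_zero]; exact zero_le
  · exact le_mul_rate (by positivity) fun lam hlam =>
      (h n S X F f g hS x hx lam hlam _ (hE hx0 lam hlam)).trans
        (four_mul_add_le hK hC.le hA le_rfl)

theorem bound_classDif {α : ℝ} (hα₀ : 0 ≤ α) (hα₁ : α < 1) (N : ℕ) (D : ℝ) (hD : 0 < D) :
    ∃ K : ℝ, 0 < K ∧
      ∀ (G : ℝ → ℝ) (p q : ℝ≥0∞) (A : ℝ) (g : ℝ → ℂ),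
        ENNReal.HolderConjugate p q → 1 ≤ A → ClassDif N G p D A g →
        ∀ (S : ℝ → ℂ) (X : ℝ) (F f : ℝ → ℝ), TauberianSetting S X F f α g →
        ∀ x, X ≤ x → ‖S x‖ₑ ≤ ENNReal.ofReal (K * A) * rate (errDif N G q) f x := by
  obtain ⟨C, hC, h⟩ := exists_le_rate hα₀ hα₁
  refine ⟨4 * (C * (1 + D) * (1 + 96 * (N + 1)) ^ N) + 2 * C, by positivity, ?_⟩
  intro G p q A g hpq hA hg S X F f hS x hx
  refine h N S X F f g _ A _ hS (by positivity) hA x hx fun hx0 lam hlam φ hφ => ?_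
  refine pairing_le_of_dif hC hD hφ hS.boundary.1 hg.diff hg.at_zero hA hlam hx0 ?_
  exact (lintegral_Ioo_le_eLpNorm_mul hpq hg.G_pos hg.G_locallyIntegrable.aestronglyMeasurable
    (aestronglyMeasurable_iteratedDeriv hS.boundary.1 N) lam).trans (by gcongr; exact hg.bound)

theorem bound_classDifI {α : ℝ} (hα₀ : 0 ≤ α) (hα₁ : α < 1) (N : ℕ) (D : ℝ) (hD : 0 < D) :
    ∃ K : ℝ, 0 < K ∧
      ∀ (G : ℝ → ℝ) (A : ℝ) (g : ℝ → ℂ), 1 ≤ A → ClassDifI N G D A g →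
        ∀ (S : ℝ → ℂ) (X : ℝ) (F f : ℝ → ℝ), TauberianSetting S X F f α g →
        ∀ x, X ≤ x → ‖S x‖ₑ ≤ ENNReal.ofReal (K * A) * rate (errDifI N G) f x := by
  obtain ⟨C, hC, h⟩ := exists_le_rate hα₀ hα₁
  refine ⟨4 * (C * (1 + D) * (1 + 96 * (N + 1)) ^ N) + 2 * C, by positivity, ?_⟩
  intro G A g hA hg S X F f hS x hx
  refine h N S X F f g _ A _ hS (by positivity) hA x hx fun hx0 lam hlam φ hφ => ?_
  refine pairing_le_of_dif hC hD hφ hS.boundary.1 hg.diff hg.at_zero hA hlam hx0 ?_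
  rw [← ENNReal.ofReal_mul (by linarith)]
  exact hg.bound lam (by linarith)

/-! ### The ultradifferentiable classes -/

/-- Logarithmic convexity in the form `M_k^{k+j} ≤ M_0^j M_{k+j}^k`. -/
theorem IsLogConvexSeq.pow_le {M : ℕ → ℝ} (h : IsLogConvexSeq M) (k j : ℕ) :
    M k ^ (k + j) ≤ M 0 ^ j * M (k + j) ^ k := by
  have hpos := h.1
  set m : ℕ → ℝ := fun i => M (i + 1) / M i with hm
  have hm0 : ∀ i, 0 < m i := fun i => div_pos (hpos _) (hpos _)
  have hmono : Monotone m := monotone_nat_of_le_succ fun i => by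
    simp only [hm]
    rw [div_le_div_iff₀ (hpos _) (hpos _)]
    have := h.2 i
    nlinarith
  have hstep : ∀ i, M (i + 1) = M i * m i := fun i => by
    simp only [hm]; field_simp [(hpos i).ne']
  have h1 : ∀ i, M i ≤ M 0 * m i ^ i := by
    intro i
    induction i with
    | zero => simp
    | succ i ih =>
      have := (hpos 0).le
      have := (hm0 i).le
      calc M (i + 1) = M i * m i := hstep i
        _ ≤ M 0 * m i ^ i * m i := by gcongr
        _ = M 0 * m i ^ (i + 1) := by ring
        _ ≤ _ := by gcongr; exact hmono (Nat.le_succ i)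
  have h2 : ∀ j, M k * m k ^ j ≤ M (k + j) := by
    intro j
    induction j with
    | zero => simp
    | succ j ih =>
      have := (hm0 k).le
      have := (hpos (k + j)).le
      calc M k * m k ^ (j + 1) = M k * m k ^ j * m k := by ring
        _ ≤ M (k + j) * m (k + j) := by gcongr; exact hmono (Nat.le_add_right k j)
        _ = _ := (hstep (k + j)).symm
  have hk := (hpos k).le
  have := (hpos 0).le
  have := (hm0 k).le
  calc M k ^ (k + j) = M k ^ j * M k ^ k := by ring
    _ ≤ (M 0 * m k ^ k) ^ j * M k ^ k := by gcongr; exact h1 k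
    _ = M 0 ^ j * (M k * m k ^ j) ^ k := by rw [mul_pow, mul_pow, ← pow_mul, ← pow_mul, mul_comm k j]; ring
    _ ≤ _ := by gcongr; exact h2 j

/-- For a subanalytic logarithmically convex sequence, derivatives that fall on a cutoff of order
`n` (each costing a factor of the order `n`) are no worse than derivatives that fall on `g`. -/
theorem IsLogConvexSeq.exists_mul_pow_le {M : ℕ → ℝ} {L : ℝ} (h : IsLogConvexSeq M) (hL : 0 < L)
    (hs : IsSubanalyticWith M L) :
    ∃ c, 1 ≤ c ∧ ∀ k j n : ℕ, k + j = n → M k * (L * n) ^ j ≤ c * M n := by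
  obtain ⟨c₁, hc₁, hM⟩ := hs
  have hpos := h.1
  refine ⟨max 1 (M 0 / c₁), le_max_left _ _, ?_⟩
  rintro k j n rfl
  rcases Nat.eq_zero_or_pos (k + j) with h0 | hn
  · obtain ⟨rfl, rfl⟩ : k = 0 ∧ j = 0 := by omega
    simpa using mul_le_mul_of_nonneg_right (le_max_left 1 (M 0 / c₁)) (hpos 0).le
  set c := max 1 (M 0 / c₁) with hc
  have hc1 : 1 ≤ c := le_max_left _ _
  set n := k + j with hnn
  have hMn := (hpos n).le
  have hMk := (hpos k).le
  have hM0 := (hpos 0).le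
  have h1 : (L * n) ^ n ≤ M n / c₁ := by
    rw [le_div_iff₀ hc₁, mul_pow]
    linarith [hM n]
  refine le_of_pow_le_pow_left₀ (n := n) (by omega) (by positivity) ?_
  calc (M k * (L * n) ^ j) ^ n = M k ^ (k + j) * ((L * n) ^ n) ^ j := by
        rw [mul_pow, ← pow_mul, ← pow_mul, mul_comm j n]
    _ ≤ (M 0 ^ j * M n ^ k) * (M n / c₁) ^ j := by
        gcongr
        exact h.pow_le k j
    _ = (M 0 / c₁) ^ j * M n ^ n := by rw [div_pow, div_pow, hnn, pow_add]; ring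
    _ ≤ c ^ j * M n ^ n := by gcongr; exact le_max_right _ _
    _ ≤ c ^ n * M n ^ n := by exact mul_le_mul_of_nonneg_right (pow_le_pow_right₀ hc1 (by omega)) (by positivity)
    _ = _ := (mul_pow _ _ _).symm

/-- The weight in `errSA`; terms with `y ^ n = 0` are infinite, in accordance with `log 0 = -∞`. -/
theorem exp_neg_associatedFunction (M : ℕ → ℝ) (y : ℝ) :
    EReal.exp (-associatedFunction M y) = ⨅ n, (ENNReal.ofReal (y ^ n / M n))⁻¹ := by
  have h : EReal.exp (associatedFunction M y) = ⨆ n, ENNReal.ofReal (y ^ n / M n) := by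
    have h1 := OrderIso.map_iSup EReal.expOrderIso
      fun n => ENNReal.log (ENNReal.ofReal (y ^ n / M n))
    simp only [EReal.expOrderIso_apply, ENNReal.exp_log] at h1
    exact h1
  rw [EReal.exp_neg, h, ENNReal.inv_iSup]

/-- Both ultradifferentiable classes enter the argument only through the bound `hU` for the
derivatives of `g` on `(-lam, lam)`. The index `n` also determines the cutoff, so that for each `n`
the ratio of its derivatives is of the order `n / lam`, which is what subanalyticity can absorb. -/
theorem norm_pairing_le_of_ultradifferentiable {C c L A B G H lam x : ℝ} {M : ℕ → ℝ} {g φ : ℝ → ℂ}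
    {n : ℕ}
    (hC : 0 < C) (hc : 1 ≤ c) (hL : 0 < L) (hA : 1 ≤ A) (hB : 0 < B) (hG : 0 < G) (hH : 0 < H)
    (hlam : 1 ≤ lam) (hx : 0 ≤ x)
    (hM0 : ∀ n, 0 < M n) (hM : ∀ k j n : ℕ, k + j = n → M k * (L * n) ^ j ≤ c * M n)
    (hφ : IsCutoff C n φ) (hg : LocallyIntegrable g) (hd : DiffTimes n g)
    (hU : ∀ k, ∫⁻ t in Ioo (-lam) lam, ‖iteratedDeriv k g t‖ₑ ≤
      ENNReal.ofReal (A * B ^ k * M k * G ^ k * H)) :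
    ‖pairing g φ x lam‖ₑ ≤ ENNReal.ofReal (C * c * A) *
      ((ENNReal.ofReal ((x / (B * G + 124 / L / lam)) ^ n / M n))⁻¹ * ENNReal.ofReal H) := by
  have hl0 : 0 < lam := by linarith
  have hMn := hM0 n
  set d := B * G + 124 / L / lam with hd'
  have hd0 : 0 < d := by positivity
  have h1 := hφ.pow_mul_norm_pairing_le hC.le hg hd (lam := lam) (x := x) (U := c * A * H * M n)
    (a := B * G) (b := 124 / L / lam) (V := fun k => A * B ^ k * M k * G ^ k * H) hl0 hx
    (fun k => by have := hM0 k; positivity) (fun k _ => hU k) ?_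
  · rw [← hd'] at h1
    have h2 : x ^ n * ‖pairing g φ x lam‖ ≤ C * c * A * H * M n * d ^ n := by
      refine h1.trans (le_of_eq ?_); ring
    rcases (pow_nonneg hx n).eq_or_lt with h0 | h0
    · have : (x / d) ^ n / M n = 0 := by rw [div_pow, ← h0]; simp
      rw [this, ENNReal.ofReal_zero, ENNReal.inv_zero, ENNReal.top_mul (by simpa using hH),
        ENNReal.mul_top (by rw [Ne, ENNReal.ofReal_eq_zero, not_le]; positivity)]
      exact le_top
    · rw [← ENNReal.ofReal_inv_of_pos (by rw [div_pow]; positivity),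
        ← ENNReal.ofReal_mul (by rw [div_pow]; positivity), ← ENNReal.ofReal_mul (by positivity),
        ← ofReal_norm]
      apply ENNReal.ofReal_le_ofReal
      have : C * c * A * (((x / d) ^ n / M n)⁻¹ * H) = C * c * A * H * M n * d ^ n / x ^ n := by
        rw [div_pow]; field_simp
      rw [this, le_div_iff₀ h0]
      linarith
  · intro k j hkj
    have hMk := hM0 k
    -- `24 (n + 1) ≤ 48 n` for `n ≥ 1`; for `n = 0` only `j = 0` occurs
    have h2 : (24 * ((n : ℝ) + 1)) ^ j ≤ (124 / L) ^ j * (L * n) ^ j := by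
      rw [← mul_pow]
      rcases Nat.eq_zero_or_pos n with hn | hn
      · obtain rfl : j = 0 := by omega
        simp
      · have hn' : (1 : ℝ) ≤ n := by exact_mod_cast hn
        have h3 : 24 * ((n : ℝ) + 1) ≤ 124 / L * (L * n) := by
          rw [show 124 / L * (L * n) = 124 * n by field_simp]
          linarith
        gcongr
    calc lam⁻¹ ^ j * ((24 * ((n : ℝ) + 1)) ^ j * (A * B ^ k * M k * G ^ k * H))
        ≤ lam⁻¹ ^ j * (((124 / L) ^ j * (L * n) ^ j) * (A * B ^ k * M k * G ^ k * H)) := by gcongr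
      _ = A * H * (B * G) ^ k * (124 / L / lam) ^ j * (M k * (L * n) ^ j) := by
          rw [div_pow _ lam, mul_pow B G, inv_pow]; field_simp
      _ ≤ A * H * (B * G) ^ k * (124 / L / lam) ^ j * (c * M n) := by
          exact mul_le_mul_of_nonneg_left (hM k j n hkj) (by positivity)
      _ = _ := by ring

theorem diffTimes_of_contDiff {g : ℝ → ℂ} (hg : ContDiff ℝ (⊤ : ℕ∞) g) (n : ℕ) : DiffTimes n g :=
  fun j _ => hg.differentiable_iteratedDeriv j (by exact_mod_cast WithTop.coe_lt_top j)

/-- The common conclusion for the two ultradifferentiable classes. The infimum over the order `n` of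
the bounds by `n` integrations by parts is the associated function. -/
theorem exists_le_rate_errSA {α : ℝ} (hα₀ : 0 ≤ α) (hα₁ : α < 1) (M : ℕ → ℝ) (L : ℝ)
    (hM : IsLogConvexSeq M) (hL : 0 < L) (hML : IsSubanalyticWith M L) :
    ∃ K : ℝ, 0 < K ∧ ∀ (B : ℝ) (G H : ℝ → ℝ) (A : ℝ) (g : ℝ → ℂ), 0 < B → 1 ≤ A →
      (∀ t > 0, 0 < G t) → (∀ t > 0, 0 < H t) → ContDiff ℝ (⊤ : ℕ∞) g →
      (∀ k, ∀ lam > 0, ∫⁻ t in Ioo (-lam) lam, ‖iteratedDeriv k g t‖ₑ ≤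
        ENNReal.ofReal (A * B ^ k * M k * G lam ^ k * H lam)) →
      ∀ (S : ℝ → ℂ) (X : ℝ) (F f : ℝ → ℝ), TauberianSetting S X F f α g → ∀ x, X ≤ x →
        ‖S x‖ₑ ≤ ENNReal.ofReal (K * A) * rate (errSA M B G H (124 / L)) f x := by
  obtain ⟨C, hC, h⟩ := exists_enorm_le_of_pairing_le hα₀ hα₁
  obtain ⟨c, hc, hMc⟩ := hM.exists_mul_pow_le hL hML
  refine ⟨4 * (C * c) + 2 * C, by positivity, ?_⟩
  intro B G H A g hB hA hG hH hg hgU S X F f hS x hx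
  have hKA : (0 : ℝ) < (4 * (C * c) + 2 * C) * A := by positivity
  rcases lt_or_ge x 0 with hx0 | hx0
  · rw [hS.eq_zero_of_neg hx0, enorm_zero]; exact zero_le
  refine le_mul_rate hKA fun lam hlam => ?_
  have hl0 : 0 < lam := by linarith
  rw [errSA, exp_neg_associatedFunction,
    ENNReal.iInf_mul_of_ne (by simpa using hH lam hl0) ENNReal.ofReal_ne_top, ENNReal.iInf_add,
    ENNReal.mul_iInf_of_ne (by simpa using hKA) ENNReal.ofReal_ne_top]
  refine le_iInf fun n => ?_
  exact (h n S X F f g hS x hx lam hlam _ fun φ hφ =>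
    norm_pairing_le_of_ultradifferentiable hC hc hL hA hB (hG lam hl0) (hH lam hl0) hlam hx0 hM.1
        hMc
      hφ hS.boundary.1 (diffTimes_of_contDiff hg n) (fun k => hgU k lam hl0)).trans
    (four_mul_add_le (by positivity) hC.le hA le_rfl)

theorem bound_classSA {α : ℝ} (hα₀ : 0 ≤ α) (hα₁ : α < 1) (M : ℕ → ℝ) (L : ℝ)
    (hM : IsLogConvexSeq M) (hL : 0 < L) (hML : IsSubanalyticWith M L) :
    ∃ K : ℝ, 0 < K ∧
      ∀ (B : ℝ) (G H : ℝ → ℝ) (p q : ℝ≥0∞) (A : ℝ) (g : ℝ → ℂ), 0 < B →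
        ENNReal.HolderConjugate p q → 1 ≤ A → ClassSA M B G H p q A g →
        ∀ (S : ℝ → ℂ) (X : ℝ) (F f : ℝ → ℝ), TauberianSetting S X F f α g →
        ∀ x, X ≤ x →
          ‖S x‖ₑ ≤ ENNReal.ofReal (K * A) * rate (errSA M B G H (124 / L)) f x := by
  obtain ⟨K, hK, h⟩ := exists_le_rate_errSA hα₀ hα₁ M L hM hL hML
  refine ⟨K, hK, fun B G H p q A g hB hpq hA hg S X F f hS x hx => ?_⟩
  refine h B G H A g hB hA hg.G_pos hg.H_pos hg.smooth (fun k lam hlam => ?_) S X F f hS x hx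
  obtain ⟨Gn, hGn, hGl, h1, h2⟩ := hg.bound
  have hMk := hM.1 k
  have hGp := hg.G_pos lam hlam
  calc _ ≤ _ := lintegral_Ioo_le_eLpNorm_mul hpq (hGn k) (hGl k).aestronglyMeasurable
        (aestronglyMeasurable_iteratedDeriv hS.boundary.1 k) lam
    _ ≤ ENNReal.ofReal (A * B ^ k * M k) * ENNReal.ofReal (G lam ^ k * H lam) :=
        mul_le_mul' (h1 k) (h2 k lam hlam)
    _ = _ := by
        rw [← ENNReal.ofReal_mul (by positivity)]
        congr 1; ring

theorem bound_classSAI {α : ℝ} (hα₀ : 0 ≤ α) (hα₁ : α < 1) (M : ℕ → ℝ) (L : ℝ)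
    (hM : IsLogConvexSeq M) (hL : 0 < L) (hML : IsSubanalyticWith M L) :
    ∃ K : ℝ, 0 < K ∧
      ∀ (B : ℝ) (G H : ℝ → ℝ) (A : ℝ) (g : ℝ → ℂ), 0 < B →
        1 ≤ A → ClassSAI M B G H A g →
        ∀ (S : ℝ → ℂ) (X : ℝ) (F f : ℝ → ℝ), TauberianSetting S X F f α g →
        ∀ x, X ≤ x →
          ‖S x‖ₑ ≤ ENNReal.ofReal (K * A) * rate (errSA M B G H (124 / L)) f x := by
  obtain ⟨K, hK, h⟩ := exists_le_rate_errSA hα₀ hα₁ M L hM hL hML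
  exact ⟨K, hK, fun B G H A g hB hA hg S X F f hS x hx =>
    h B G H A g hB hA hg.G_pos hg.H_pos hg.smooth (fun k lam hlam => hg.bound k lam hlam) S X F f
        hS x hx⟩

/-! ### Local oscillation -/

theorem enorm_sub_le_localOsc (h : ℝ → ℂ) {δ a t : ℝ} (ha : |a - t| ≤ δ) :
    ‖h a - h t‖ₑ ≤ localOsc h δ t := by
  have := le_iSup₂ (f := fun u (_ : u ∈ Icc (-δ) δ) => ‖h (t + u) - h t‖ₑ) (a - t) (abs_le.1 ha)
  rw [add_sub_cancel] at this
  exact this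

theorem enorm_half_sub_le_localOsc (h : ℝ → ℂ) {δ a b t : ℝ} (ha : |a - t| ≤ δ) (hb : |b - t| ≤ δ) :
    ‖(1 / 2 : ℂ) * (h a - h b)‖ₑ ≤ localOsc h δ t := by
  have h2 : ‖(1 / 2 : ℂ)‖ₑ = 2⁻¹ := by
    rw [one_div, enorm_inv two_ne_zero, ← ofReal_norm]; simp
  calc ‖(1 / 2 : ℂ) * (h a - h b)‖ₑ = 2⁻¹ * ‖(h a - h t) - (h b - h t)‖ₑ := by
        rw [enorm_mul, h2]; congr 2; ring
    _ ≤ 2⁻¹ * (localOsc h δ t + localOsc h δ t) := by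
        gcongr
        exact enorm_sub_le.trans (add_le_add (enorm_sub_le_localOsc h ha)
            (enorm_sub_le_localOsc h hb))
    _ = localOsc h δ t := by
        rw [← two_mul, ← mul_assoc, ENNReal.inv_mul_cancel two_ne_zero ENNReal.ofNat_ne_top,
            one_mul]

/-- The integrals of all measurable minorants of the local oscillation (which itself need not be
measurable) are at most `V`. -/
def OscIntegralLE (h : ℝ → ℂ) (δ lam V : ℝ) : Prop :=
  ∀ F : ℝ → ℂ, AEStronglyMeasurable F → (∀ t, ‖F t‖ₑ ≤ localOsc h δ t) →
    ∫⁻ t in Ioo (-lam) lam, ‖F t‖ₑ ≤ ENNReal.ofReal V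

/-- Telescoping over steps of length `|ℓ|`; the step function built from the increments is a
measurable minorant of the local oscillation. -/
theorem OscIntegralLE.ofReal_mul_enorm_le {h : ℝ → ℂ} {δ lam V ℓ : ℝ} (hV : OscIntegralLE h δ lam V)
    (hℓ0 : ℓ ≠ 0) (hℓ : |ℓ| ≤ δ) (n : ℕ) (hn : n * |ℓ| < lam) :
    ENNReal.ofReal |ℓ| * ‖(1 / 2 : ℂ) * (h (ℓ * n) - h 0)‖ₑ ≤ ENNReal.ofReal V := by
  set d : ℤ → ℂ := fun k => (1 / 2 : ℂ) * (h (ℓ * (k + 1)) - h (ℓ * k)) with hd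
  set F : ℝ → ℂ := fun s => d ⌊s / ℓ⌋ with hF
  have hFm : Measurable F := (measurable_of_countable d).comp
      (Int.measurable_floor.comp (by fun_prop))
  have hstep : ∀ s r : ℝ, |r - s / ℓ| ≤ 1 → |ℓ * r - s| ≤ δ := by
    intro s r hr
    rw [show ℓ * r - s = ℓ * (r - s / ℓ) by field_simp, abs_mul]
    exact (mul_le_of_le_one_right (abs_nonneg _) hr).trans hℓ
  have hFle : ∀ s, ‖F s‖ₑ ≤ localOsc h δ s := by
    intro s
    have h1 := Int.floor_le (s / ℓ)
    have h2 := Int.lt_floor_add_one (s / ℓ)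
    exact enorm_half_sub_le_localOsc h (hstep s _ (abs_le.2 ⟨by linarith, by linarith⟩))
      (hstep s _ (abs_le.2 ⟨by linarith, by linarith⟩))
  set A : ℕ → Set ℝ := fun k => (· * ℓ⁻¹) ⁻¹' Ico (k : ℝ) (k + 1) with hA
  have hAm : ∀ k, MeasurableSet (A k) := fun k => measurableSet_Ico.preimage (by fun_prop)
  have hfloor : ∀ k, ∀ s ∈ A k, ⌊s / ℓ⌋ = (k : ℤ) := by
    intro k s hs
    rw [Int.floor_eq_iff]
    simpa [hA, div_eq_mul_inv] using hs
  have hAvol : ∀ k, volume (A k) = ENNReal.ofReal |ℓ| := by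
    intro k
    rw [hA, Real.volume_preimage_mul_right (inv_ne_zero hℓ0), Real.volume_Ico]
    simp
  have hAdisj : (↑(Finset.range n) : Set ℕ).PairwiseDisjoint A := by
    intro i _ j _ hij
    refine Set.disjoint_left.2 fun s hi hj => hij ?_
    have := (hfloor i s hi).symm.trans (hfloor j s hj)
    exact_mod_cast this
  have hAsub : (⋃ k ∈ Finset.range n, A k) ⊆ Ioo (-lam) lam := by
    intro s hs
    simp only [mem_iUnion, Finset.mem_range] at hs
    obtain ⟨k, hk, hs1, hs2⟩ := hs
    have hk' : (k : ℝ) + 1 ≤ n := by exact_mod_cast hk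
    have h3 : |s * ℓ⁻¹| ≤ n := abs_le.2 ⟨by
      have : (0 : ℝ) ≤ k := k.cast_nonneg
      linarith, by linarith⟩
    have h4 : |s| ≤ n * |ℓ| := by
      calc |s| = |s * ℓ⁻¹| * |ℓ| := by rw [← abs_mul]; field_simp
        _ ≤ _ := by gcongr
    exact abs_lt.1 (h4.trans_lt hn)
  have hsum : ∑ k ∈ Finset.range n, d k = (1 / 2 : ℂ) * (h (ℓ * n) - h 0) := by
    simp only [hd, ← Finset.mul_sum]
    have := Finset.sum_range_sub (fun k : ℕ => h (ℓ * k)) n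
    push_cast at this ⊢
    rw [this, mul_zero]
  calc ENNReal.ofReal |ℓ| * ‖(1 / 2 : ℂ) * (h (ℓ * n) - h 0)‖ₑ
      ≤ ENNReal.ofReal |ℓ| * ∑ k ∈ Finset.range n, ‖d k‖ₑ := by
        rw [← hsum]; gcongr; exact enorm_sum_le _ _
    _ = ∑ k ∈ Finset.range n, ∫⁻ s in A k, ‖F s‖ₑ := by
        rw [Finset.mul_sum]
        refine Finset.sum_congr rfl fun k _ => ?_
        rw [setLIntegral_congr_fun (hAm k) (g := fun _ => ‖d k‖ₑ)
          (fun s hs => by simp only [hF, hfloor k s hs]), setLIntegral_const, hAvol, mul_comm]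
    _ = ∫⁻ s in ⋃ k ∈ Finset.range n, A k, ‖F s‖ₑ :=
        (lintegral_biUnion_finset hAdisj (fun k _ => hAm k) _).symm
    _ ≤ ∫⁻ s in Ioo (-lam) lam, ‖F s‖ₑ := lintegral_mono_set hAsub
    _ ≤ _ := hV F hFm.aestronglyMeasurable hFle

/-- An integral bound for the oscillation at one scale bounds `h` uniformly on `(-lam, lam)`. For
`|t|` smaller than the scale a single increment is used, otherwise `t` is reached by steps of length
between `δ / 2` and `δ`. -/
theorem OscIntegralLE.norm_sub_le {h : ℝ → ℂ} {δ lam V t : ℝ} (hV : OscIntegralLE h δ lam V)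
    (hV0 : 0 ≤ V) (hδ0 : 0 < δ) (hδ : δ ≤ lam) (ht : |t| < lam) :
    ‖h t - h 0‖ ≤ 4 / δ * V := by
  have hhalf : ∀ {r : ℝ} {z : ℂ}, δ / 2 ≤ r → ENNReal.ofReal r * ‖(1 / 2 : ℂ) * z‖ₑ ≤
      ENNReal.ofReal V →
      ‖z‖ ≤ 4 / δ * V := by
    intro r z hr h1
    rw [← ofReal_norm, ← ENNReal.ofReal_mul (by linarith), ENNReal.ofReal_le_ofReal_iff hV0, norm_mul] at h1
    have h2 : ‖(1 / 2 : ℂ)‖ = 1 / 2 := by simp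
    rw [h2] at h1
    rw [div_mul_eq_mul_div, le_div_iff₀ hδ0]
    nlinarith [norm_nonneg z]
  rcases le_total |t| (δ / 2) with h1 | h1
  · refine hhalf (r := δ) (by linarith) ?_
    set z := h t - h 0
    have h2 := hV (indicator (Ioo (-(δ / 2)) (δ / 2)) fun _ => (1 / 2 : ℂ) * z)
      (aestronglyMeasurable_const.indicator measurableSet_Ioo) ?_
    · refine le_trans (le_of_eq ?_) h2
      have h3 : Ioo (-(δ / 2)) (δ / 2) ⊆ Ioo (-lam) lam :=
        Ioo_subset_Ioo (by linarith) (by linarith)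
      simp only [enorm_indicator_eq_indicator_enorm]
      rw [lintegral_indicator measurableSet_Ioo, Measure.restrict_restrict measurableSet_Ioo,
        inter_eq_self_of_subset_left h3, setLIntegral_const, Real.volume_Ioo, mul_comm]
      congr 2; ring
    · intro s
      by_cases hs : s ∈ Ioo (-(δ / 2)) (δ / 2)
      · rw [indicator_of_mem hs]
        have h4 := abs_lt.2 hs
        refine enorm_half_sub_le_localOsc h ?_ (by rw [zero_sub, abs_neg]; linarith)
        exact (abs_sub _ _).trans (by linarith)
      · rw [indicator_of_notMem hs, enorm_zero]; exact zero_le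
  · have ht0 : 0 < |t| := by linarith
    set n := ⌈|t| / δ⌉₊ with hn
    have hn0 : 0 < n := Nat.ceil_pos.2 (by positivity)
    have hn' : (0 : ℝ) < n := by exact_mod_cast hn0
    have h2 : |t| ≤ n * δ := by
      have := Nat.le_ceil (|t| / δ)
      rwa [div_le_iff₀ hδ0] at this
    have h3 : n * (δ / 2) ≤ |t| := by
      rcases le_total |t| δ with h4 | h4
      · have : n ≤ 1 := Nat.ceil_le.2 (by rw [div_le_iff₀ hδ0]; simpa using h4)
        have : (n : ℝ) ≤ 1 := by exact_mod_cast this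
        nlinarith
      · have := (Nat.ceil_lt_add_one (a := |t| / δ) (by positivity)).le
        have h5 : n * δ ≤ |t| + δ := by
          calc n * δ ≤ (|t| / δ + 1) * δ := by gcongr
            _ = _ := by field_simp
        linarith
    have habs : |t / n| = |t| / n := by rw [abs_div, abs_of_pos hn']
    have h6 := hV.ofReal_mul_enorm_le (ℓ := t / n)
      (div_ne_zero (abs_pos.1 ht0) hn'.ne')
      (by rw [habs, div_le_iff₀ hn']; linarith) n (by rw [habs, mul_div_cancel₀ _ hn'.ne']; exact ht)
    rw [div_mul_cancel₀ _ hn'.ne', habs] at h6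
    refine hhalf ?_ h6
    rw [le_div_iff₀ hn']; linarith

/-- Shifting the variable by `π / x` changes the sign of `e^{ixt}`; hence the oscillatory integral
is controlled by the increments of `h` and of the cutoff over this distance. -/
theorem IsCutoff.two_mul_norm_pairing_le {C : ℝ} {n : ℕ} {φ : ℝ → ℂ} (hφ : IsCutoff C n φ)
    {lam x V P : ℝ} (hlam : 1 ≤ lam) (hx : 2 * Real.pi ≤ x) {h : ℝ → ℂ}
        (hm : AEStronglyMeasurable h)
    (hV0 : 0 ≤ V) (hV : OscIntegralLE h (Real.pi / x) lam V)
    (hP : ∀ t ∈ Ioo (-lam) lam, ‖h t‖ ≤ P) :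
    2 * ‖pairing h φ x lam‖ ≤ C * V + C * (24 * (n + 1)) * (Real.pi / x) * (2 * P) := by
  have hpi := Real.pi_pos
  have hx0 : 0 < x := by linarith
  have hl0 : 0 < lam := by linarith
  set η := Real.pi / x with hη
  have hη0 : 0 < η := by positivity
  have hη1 : η ≤ 1 / 2 := by rw [hη, div_le_iff₀ hx0]; linarith
  have hP0 : 0 ≤ P := (norm_nonneg _).trans (hP 0 ⟨by linarith, by linarith⟩)
  have hshift : AEStronglyMeasurable fun t => h (t + η) :=
    hm.comp_measurePreserving (measurePreserving_add_right volume η)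
  set T : ℝ := 24 * (n + 1) with hT
  have hT0 : 0 ≤ T := by positivity
  have hφ0 : ∀ t, ‖φ t‖ ≤ C := fun t => by simpa using hφ.norm_iteratedDeriv_le 0 (by omega) t
  -- both shifted integrands are still supported in `(-lam, lam)`, as `π / x ≤ 1 / 2 ≤ lam / 2`
  have hint : IntegrableOn h (Ioo (-lam) lam) :=
    ⟨hm.restrict, (lintegral_Ioo_le_of_norm_le hl0 hP).trans_lt ENNReal.ofReal_lt_top⟩
  have hcont := hφ.contDiff.continuous
  have hvan : ∀ t, lam / 2 ≤ |t| → φ (t / lam) = 0 := fun t ht => by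
    simpa using hφ.iteratedDeriv_div_eq_zero hl0 0 ht
  have i1 : Integrable fun t : ℝ => h t * (Complex.exp (Complex.I * x * t) * φ (t / lam)) := by
    simpa using hφ.integrable_pairing hl0 hint x 0
  have i2 : Integrable fun t : ℝ => h t * (Complex.exp (Complex.I * x * t) * φ ((t - η) / lam)) :=
      by
    have h1 : IntegrableOn (fun t : ℝ =>
        h t * (Complex.exp (Complex.I * x * t) * φ ((t - η) / lam))) (Ioo (-lam) lam) :=
      hint.mul_bdd (c := C) (Continuous.aestronglyMeasurable (by fun_prop))
        (Eventually.of_forall fun t => by rw [norm_mul, norm_exp_I_mul, one_mul]; exact hφ0 _)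
    refine h1.integrable_of_forall_notMem_eq_zero fun t ht => ?_
    have : lam ≤ |t| := by
      by_contra h2
      exact ht (abs_lt.1 (not_le.1 h2))
    rw [hvan (t - η) (by
      have := abs_sub_abs_le_abs_sub t η
      rw [abs_of_pos hη0] at this
      linarith), mul_zero, mul_zero]
  have hexp : ∀ t : ℝ, Complex.exp (Complex.I * x * ((t + η : ℝ) : ℂ)) =
      -Complex.exp (Complex.I * x * t) := by
    intro t
    have : Complex.I * x * ((t + η : ℝ) : ℂ) = Complex.I * x * t + Real.pi * Complex.I := by
      rw [hη]; push_cast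
      have : (x : ℂ) ≠ 0 := by exact_mod_cast hx0.ne'
      field_simp
    rw [this, Complex.exp_add, Complex.exp_pi_mul_I]; ring
  have hpt : ∀ t : ℝ, h (t + η) * (Complex.exp (Complex.I * x * t) * φ (t / lam)) =
      -(h (t + η) * (Complex.exp (Complex.I * x * ((t + η : ℝ) : ℂ)) * φ ((t + η - η) / lam))) := by
    intro t; rw [hexp, add_sub_cancel_right]; ring
  have i3 : Integrable fun t : ℝ => h (t + η) * (Complex.exp (Complex.I * x * t) * φ (t / lam)) :=
      by
    simp only [hpt]
    exact (i2.comp_add_right η).neg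
  have v3 : ∫ t : ℝ, h (t + η) * (Complex.exp (Complex.I * x * t) * φ (t / lam)) =
      -∫ t : ℝ, h t * (Complex.exp (Complex.I * x * t) * φ ((t - η) / lam)) := by
    simp only [hpt]
    rw [integral_neg, integral_add_right_eq_self
      (fun t : ℝ => h t * (Complex.exp (Complex.I * x * t) * φ ((t - η) / lam)))]
  have hkey : 2 * pairing h φ x lam = pairing (fun t => h t - h (t + η)) φ x lam +
      ∫ t : ℝ, h t * (Complex.exp (Complex.I * x * t) * (φ (t / lam) - φ ((t - η) / lam))) := by
    have e1 : pairing (fun t => h t - h (t + η)) φ x lam = pairing h φ x lam -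
        ∫ t : ℝ, h (t + η) * (Complex.exp (Complex.I * x * t) * φ (t / lam)) := by
      rw [pairing, pairing, ← integral_sub i1 i3]
      congr 1; ext t; ring
    have e2 : (∫ t : ℝ, h t * (Complex.exp (Complex.I * x * t) *
        (φ (t / lam) - φ ((t - η) / lam)))) =
        pairing h φ x lam -
          ∫ t : ℝ, h t * (Complex.exp (Complex.I * x * t) * φ ((t - η) / lam)) := by
      rw [pairing, ← integral_sub i1 i2]
      congr 1; ext t; ring
    rw [e1, e2, v3]; ring
  have b1 : ‖pairing (fun t => h t - h (t + η)) φ x lam‖ ≤ C * V := by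
    have := hφ.norm_pairing_le (j := 0) hl0 hV0 (by simpa using hφ0)
      (hV (fun t => h t - h (t + η)) (hm.sub hshift) fun t => by
        rw [enorm_sub_rev]
        exact enorm_sub_le_localOsc h (by rw [add_sub_cancel_left, abs_of_pos hη0])) x
    simpa using this
  have hlip : ∀ a b : ℝ, ‖φ a - φ b‖ ≤ C * T * |a - b| := by
    intro a b
    have := convex_univ.norm_image_sub_le_of_norm_deriv_le (f := φ) (C := C * T) (x := b) (y := a)
      (fun s _ => (hφ.contDiff.differentiable (by simp)).differentiableAt)
      (fun s _ => by simpa [iteratedDeriv_one] using hφ.norm_iteratedDeriv_le 1 (by omega) s)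
      (mem_univ _) (mem_univ _)
    simpa using this
  have b2 : ‖∫ t : ℝ, h t * (Complex.exp (Complex.I * x * t) * (φ (t / lam) - φ ((t - η) / lam)))‖ ≤
      C * T * η * (2 * P) := by
    have hle : ∀ t ∈ Ioo (-lam) lam,
        ‖h t * (Complex.exp (Complex.I * x * t) * (φ (t / lam) - φ ((t - η) / lam)))‖ ≤
          P * (C * T * (η / lam)) := by
      intro t ht
      rw [norm_mul, norm_mul, norm_exp_I_mul, one_mul]
      refine mul_le_mul (hP t ht) ((hlip _ _).trans (le_of_eq ?_)) (norm_nonneg _) hP0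
      rw [← sub_div, sub_sub_cancel, abs_of_pos (by positivity)]
    rw [← setIntegral_eq_integral_of_forall_compl_eq_zero (s := Ioo (-lam) lam)]
    · refine (norm_setIntegral_le_of_norm_le_const (by simp) hle).trans (le_of_eq ?_)
      rw [Real.volume_real_Ioo_of_le (by linarith)]
      field_simp; ring
    · intro t ht
      have : lam ≤ |t| := by
        by_contra h2
        exact ht (abs_lt.1 (not_le.1 h2))
      rw [hvan t (by linarith), hvan (t - η) (by
        have := abs_sub_abs_le_abs_sub t η
        rw [abs_of_pos hη0] at this
        linarith)]
      simp
  calc 2 * ‖pairing h φ x lam‖ = ‖2 * pairing h φ x lam‖ := by rw [norm_mul]; simp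
    _ ≤ C * V + C * T * η * (2 * P) := by
        rw [hkey]; exact (norm_add_le _ _).trans (add_le_add b1 b2)

/-! ### The Hölder classes -/

/-- The lower bound for a modulus extends from a neighbourhood of the origin to `(0, 1/2]`, by
monotonicity. -/
theorem IsModulus.exists_le_mul {w : ℝ → ℝ} (hw : IsModulus w) :
    ∃ c, 1 ≤ c ∧ ∀ y, 0 < y → y ≤ 1 / 2 → y ≤ c * w y := by
  obtain ⟨c, hc, h⟩ := hw.lower
  obtain ⟨r, hr, hr'⟩ := mem_nhdsGT_iff_exists_Ioc_subset.1 h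
  have hr0 : 0 < r := hr
  have hwr := hw.pos r hr0
  refine ⟨1 + 1 / c + 1 / w r, by have : 0 < 1 / c := by positivity
                                  have : 0 < 1 / w r := by positivity
                                  linarith, fun y hy hy1 => ?_⟩
  have hwy := hw.pos y hy
  rcases le_total y r with hyr | hyr
  · have h1 : c * y ≤ w y := hr' ⟨hy, hyr⟩
    calc y = 1 / c * (c * y) := by field_simp
      _ ≤ 1 / c * w y := by gcongr
      _ ≤ _ := by
          gcongr
          have : 0 < 1 / w r := by positivity
          linarith
  · have h1 : w r ≤ w y := hw.mono hr0 hy hyr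
    calc y ≤ 1 / w r * w r := by rw [one_div_mul_cancel hwr.ne']; linarith
      _ ≤ 1 / w r * w y := by gcongr
      _ ≤ _ := by
          gcongr
          have : 0 < 1 / c := by positivity
          linarith

/-- Common core of the classes `HC` and `HCI`. The `N` integrations by parts lead to integrals in
which the derivatives of `g` and of the cutoff have total order `N`. If the cutoff is differentiated
at least once, a further integration by parts gains the factor `1 / x`; the remaining integral, with
`g^{(N)}` and the cutoff itself, is treated by the shift of `π / x`. -/
theorem IsCutoff.pow_mul_norm_pairing_le_of_osc {C : ℝ} {N : ℕ} {φ : ℝ → ℂ} (hφ : IsCutoff C N φ)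
    (hC : 0 ≤ C) {g : ℝ → ℂ} (hg : LocallyIntegrable g) (hd : DiffTimes N g) {lam x P D c W : ℝ}
    (hlam : 1 ≤ lam) (hx : 2 * Real.pi ≤ x) (hD : 0 ≤ D) (hDP : D ≤ P) (hW : 0 ≤ W) (hc : 1 ≤ c)
    (hcW : Real.pi / x ≤ c * W) (h0 : ∀ j < N, ‖iteratedDeriv j g 0‖ ≤ D)
    (hP : ∀ t ∈ Ioo (-lam) lam, ‖iteratedDeriv N g t‖ ≤ P)
    (hV : OscIntegralLE (iteratedDeriv N g) (Real.pi / x) lam (P * W)) :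
    x ^ N * ‖pairing g φ x lam‖ ≤
      3 * C * (96 * (N + 1)) ^ (N + 1) * c * P * W * 2 ^ N := by
  have hpi := Real.pi_pos
  have hpi3 := Real.pi_gt_three
  have hx0 : 0 < x := by linarith
  have hl0 : 0 < lam := by linarith
  have hP0 : 0 ≤ P := hD.trans hDP
  set T : ℝ := 24 * (N + 1) with hT
  have hT1 : 1 ≤ T := by
    have : (0 : ℝ) ≤ N := N.cast_nonneg
    rw [hT]; linarith
  set R : ℝ := 3 * C * T ^ (N + 1) * 4 ^ N * P with hR
  have hR0 : 0 ≤ R := by positivity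
  have hVk : ∀ j k, k + j = N → ∫⁻ t in Ioo (-lam) lam, ‖iteratedDeriv k g t‖ₑ ≤
      ENNReal.ofReal (lam ^ (j + 1) * (3 * 4 ^ N * P)) := by
    intro j k hkj
    refine (lintegral_iteratedDeriv_le hd hlam (by positivity) hD h0
      (lintegral_Ioo_le_of_norm_le hl0 hP) j k hkj).trans (ENNReal.ofReal_le_ofReal ?_)
    have h1 : 2 * lam * P + D ≤ lam * (3 * P) := by nlinarith
    calc lam ^ j * (4 ^ j * (2 * lam * P + D)) ≤ lam ^ j * (4 ^ N * (lam * (3 * P))) := by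
          gcongr
          · norm_num
          · omega
      _ = _ := by ring
  have hpair : ∀ i j k, k + j = N → i ≤ N + 1 →
      ‖pairing (iteratedDeriv k g) (iteratedDeriv i φ) x lam‖ ≤ lam ^ (j + 1) * R := by
    intro i j k hkj hi
    refine (hφ.norm_pairing_le hl0 (by positivity) (hφ.norm_iteratedDeriv_le i hi)
      (hVk j k hkj) x).trans ?_
    calc C * T ^ i * (lam ^ (j + 1) * (3 * 4 ^ N * P))
        ≤ C * T ^ (N + 1) * (lam ^ (j + 1) * (3 * 4 ^ N * P)) := by
          gcongr
      _ = _ := by rw [hR]; ring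
  have hint : ∀ k ≤ N, IntegrableOn (iteratedDeriv k g) (Ioo (-lam) lam) := fun k hk =>
    ⟨(aestronglyMeasurable_iteratedDeriv hg k).restrict,
      (hVk (N - k) k (by omega)).trans_lt ENNReal.ofReal_lt_top⟩
  -- one more integration by parts, also when `k + j = N`
  have hone : ∀ k j, k < N → x * (lam⁻¹ ^ j * ‖pairing (iteratedDeriv k g) (iteratedDeriv j φ) x
      lam‖) ≤
      lam⁻¹ ^ j * ‖pairing (iteratedDeriv (k + 1) g) (iteratedDeriv j φ) x lam‖ +
      lam⁻¹ ^ (j + 1) * ‖pairing (iteratedDeriv k g) (iteratedDeriv (j + 1) φ) x lam‖ := by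
    intro k j hk
    have h1 := hφ.mul_norm_pairing_le hl0 hx0.le (hd k hk)
      (by rw [← iteratedDeriv_succ]; exact hint (k + 1) (by omega)) j
    rw [← iteratedDeriv_succ] at h1
    calc _ = lam⁻¹ ^ j * (x * ‖pairing (iteratedDeriv k g) (iteratedDeriv j φ) x lam‖) := by ring
      _ ≤ lam⁻¹ ^ j * _ := mul_le_mul_of_nonneg_left h1 (by positivity)
      _ = _ := by ring
  have := pow_mul_le_of_recurrence (n := N) (x := x) (U := 4 * R * c * W) (a := 1) (b := 1)
    (J := fun k j => lam⁻¹ ^ j * ‖pairing (iteratedDeriv k g) (iteratedDeriv j φ) x lam‖) hx0.le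
    (fun k j hkj => hone k j (by omega)) ?_
  · simp only [pow_zero, one_mul, iteratedDeriv_zero] at this
    refine this.trans (le_of_eq ?_)
    rw [hR, hT, show (96 : ℝ) * (N + 1) = 24 * (N + 1) * 4 by ring, mul_pow _ (4 : ℝ),
      one_add_one_eq_two]
    ring
  · intro k j hkj
    rw [one_pow, one_pow, mul_one, mul_one]
    have hcW0 : 0 ≤ c * W := by positivity
    rcases Nat.eq_zero_or_pos j with rfl | hj
    · obtain rfl : k = N := by omega
      have h1 := hφ.two_mul_norm_pairing_le hlam hx (aestronglyMeasurable_iteratedDeriv hg k)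
        (by positivity) hV hP
      have h4 : (1 : ℝ) ≤ 4 ^ k := one_le_pow₀ (by norm_num)
      have h2 : C * P * T ≤ R := by
        calc C * P * T = 1 * C * T ^ (0 + 1) * 1 * P := by ring
          _ ≤ 3 * C * T ^ (k + 1) * 4 ^ k * P := by
              gcongr
              · norm_num
              · omega
      have h3 : C * P ≤ R := (le_mul_of_one_le_right (by positivity) hT1).trans h2
      have h5 : W ≤ c * W := le_mul_of_one_le_left hW hc
      have h6 : C * (P * W) ≤ R * (c * W) := by
        calc C * (P * W) = C * P * W := by ring
          _ ≤ _ := by gcongr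
      have h7 : C * T * (Real.pi / x) * (2 * P) ≤ 2 * (R * (c * W)) := by
        calc C * T * (Real.pi / x) * (2 * P) = 2 * (C * P * T * (Real.pi / x)) := by ring
          _ ≤ _ := by gcongr
      simp only [pow_zero, one_mul, iteratedDeriv_zero]
      nlinarith [mul_nonneg hR0 hcW0]
    · obtain ⟨i, rfl⟩ : ∃ i, j = i + 1 := ⟨j - 1, by omega⟩
      have h1 := hone k (i + 1) (by omega)
      have h2 := hpair (i + 1) i (k + 1) (by omega) (by omega)
      have h3 := hpair (i + 1 + 1) (i + 1) k (by omega) (by omega)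
      set J := lam⁻¹ ^ (i + 1) * ‖pairing (iteratedDeriv k g) (iteratedDeriv (i + 1) φ) x lam‖
          with hJ
      have hJ0 : 0 ≤ J := by positivity
      have hl : ∀ m : ℕ, lam⁻¹ ^ m * (lam ^ m * R) = R := fun m => by
        rw [← mul_assoc, ← mul_pow, inv_mul_cancel₀ hl0.ne', one_pow, one_mul]
      have h4 : x * J ≤ 2 * R := by
        calc x * J ≤ _ := h1
          _ ≤ lam⁻¹ ^ (i + 1) * (lam ^ (i + 1) * R) + lam⁻¹ ^ (i + 1 + 1) * (lam ^ (i + 1 + 1) * R)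
              := by
              gcongr
          _ = 2 * R := by rw [hl, hl]; ring
      have h5 : 1 ≤ x * (c * W) := by
        rw [div_le_iff₀ hx0] at hcW
        linarith
      calc J ≤ J * (x * (c * W)) := le_mul_of_one_le_right hJ0 h5
        _ = x * J * (c * W) := by ring
        _ ≤ 2 * R * (c * W) := by gcongr
        _ ≤ 4 * R * c * W := by nlinarith [mul_nonneg hR0 hcW0]

theorem exists_pairing_le_of_osc (N : ℕ) (w : ℝ → ℝ) (D δ₀ C : ℝ) (hw : IsModulus w) (hD : 0 < D)
    (hδ₀ : 0 < δ₀) (hC : 0 < C) :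
    ∃ K : ℝ, 0 < K ∧ ∀ (g φ : ℝ → ℂ) (lam x A : ℝ) (Q : ℝ≥0∞), IsCutoff C N φ →
      LocallyIntegrable g → DiffTimes N g → (∀ j ≤ N, ‖iteratedDeriv j g 0‖ ≤ D) → 1 ≤ A → 1 ≤ lam →
      Real.pi / δ₀ ≤ x → 2 * Real.pi ≤ x →
      (∀ δ, 0 < δ → δ ≤ δ₀ → ∀ F : ℝ → ℂ, AEStronglyMeasurable F →
        (∀ t, ‖F t‖ₑ ≤ localOsc (iteratedDeriv N g) δ t) →
        ∫⁻ t in Ioo (-lam) lam, ‖F t‖ₑ ≤ ENNReal.ofReal (A * w δ) * Q) →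
      ‖pairing g φ x lam‖ₑ ≤ ENNReal.ofReal (K * A) *
        (invPow N x * ENNReal.ofReal (w (Real.pi / x)) * (1 + Q)) := by
  obtain ⟨c, hc, hcw⟩ := hw.exists_le_mul
  set δ := min δ₀ 1 with hδ
  have hδ0 : 0 < δ := lt_min hδ₀ one_pos
  have hwδ := hw.pos δ hδ0
  set C₁ := 1 + D + 4 / δ * w δ with hC₁
  have hC₁0 : 0 < C₁ := by positivity
  refine ⟨3 * C * (96 * (N + 1)) ^ (N + 1) * c * C₁ * 2 ^ N, by positivity, ?_⟩
  intro g φ lam x A Q hφ hg hd h0 hA hlam hx1 hx2 hQ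
  have hpi := Real.pi_pos
  have hx0 : 0 < x := by linarith
  have hη0 : 0 < Real.pi / x := by positivity
  have hwη := hw.pos _ hη0
  rcases eq_or_ne Q ∞ with rfl | hQt
  · rw [add_top, ENNReal.mul_top (mul_ne_zero (invPow_ne_zero N x) (by simpa using hwη)),
      ENNReal.mul_top (by rw [Ne, ENNReal.ofReal_eq_zero, not_le]; positivity)]
    exact le_top
  set r := Q.toReal with hr
  have hr0 : 0 ≤ r := ENNReal.toReal_nonneg
  have hosc : ∀ δ, 0 < δ → δ ≤ δ₀ → OscIntegralLE (iteratedDeriv N g) δ lam (A * r * w δ) := by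
    intro δ hδ hδ' F hF hF'
    have hwd := hw.pos δ hδ
    refine (hQ δ hδ hδ' F hF hF').trans (le_of_eq ?_)
    rw [← ENNReal.ofReal_toReal hQt, ← ENNReal.ofReal_mul (by positivity)]
    congr 1; ring
  set P := C₁ * (A * (1 + r)) with hP
  have hAr : 1 ≤ A * (1 + r) := by nlinarith
  have hArP : A * r ≤ P := by
    have : 0 < 4 / δ * w δ := by positivity
    have h1 : A * r ≤ A * (1 + r) := by nlinarith
    have h2 : 1 ≤ C₁ := by linarith
    nlinarith
  have hDP : D ≤ P := by
    have : 0 < 4 / δ * w δ := by positivity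
    nlinarith
  have hsup : ∀ t ∈ Ioo (-lam) lam, ‖iteratedDeriv N g t‖ ≤ P := by
    intro t ht
    have h1 := (hosc δ hδ0 (min_le_left _ _)).norm_sub_le (t := t) (by positivity) hδ0
      ((min_le_right _ _).trans hlam) (abs_lt.2 ht)
    have h2 := norm_le_norm_add_norm_sub' (iteratedDeriv N g t) (iteratedDeriv N g 0)
    have h3 := h0 N le_rfl
    have h4 : 4 / δ * (A * r * w δ) ≤ 4 / δ * w δ * (A * (1 + r)) := by
      have h5 : A * r ≤ A * (1 + r) := by nlinarith
      calc _ = 4 / δ * w δ * (A * r) := by ring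
        _ ≤ _ := by gcongr
    have h5 : D ≤ D * (A * (1 + r)) := le_mul_of_one_le_right hD.le hAr
    have h6 : P = A * (1 + r) + D * (A * (1 + r)) + 4 / δ * w δ * (A * (1 + r)) := by
      rw [hP, hC₁]; ring
    linarith
  have hηδ : Real.pi / x ≤ δ₀ := by
    rw [div_le_iff₀ hδ₀] at hx1
    rw [div_le_iff₀ hx0]; linarith
  have hη2 : Real.pi / x ≤ 1 / 2 := by rw [div_le_iff₀ hx0]; linarith
  have h1 := hφ.pow_mul_norm_pairing_le_of_osc hC.le hg hd hlam hx2 hD.le hDP hwη.le hc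
    (hcw _ hη0 hη2) (fun j hj => h0 j hj.le) hsup (fun F hF hF' =>
      (hosc _ hη0 hηδ F hF hF').trans (ENNReal.ofReal_le_ofReal (by gcongr)))
  refine (enorm_le_ofReal_mul_invPow hx0.le (by positivity) h1).trans (le_of_eq ?_)
  have h2 : 1 + Q = ENNReal.ofReal (1 + r) := by
    rw [ENNReal.ofReal_add zero_le_one hr0, ENNReal.ofReal_one, ENNReal.ofReal_toReal hQt]
  set K := 3 * C * (96 * ((N : ℝ) + 1)) ^ (N + 1) * c * C₁ * 2 ^ N with hK
  have h3 : 3 * C * (96 * ((N : ℝ) + 1)) ^ (N + 1) * c * P * w (Real.pi / x) * 2 ^ N =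
      (K * A) * w (Real.pi / x) * (1 + r) := by rw [hK, hP]; ring
  rw [h3, h2, ENNReal.ofReal_mul (by positivity), ENNReal.ofReal_mul (by positivity)]
  ring

theorem bound_classHC {α : ℝ} (hα₀ : 0 ≤ α) (hα₁ : α < 1) (N : ℕ) (w : ℝ → ℝ) (D δ₀ : ℝ)
    (hw : IsModulus w) (hD : 0 < D) (hδ₀ : 0 < δ₀) :
    ∃ K : ℝ, 0 < K ∧
      ∀ (G : ℝ → ℝ) (p q : ℝ≥0∞) (A : ℝ) (g : ℝ → ℂ),
        ENNReal.HolderConjugate p q → 1 ≤ A → ClassHC N G p w D δ₀ A g →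
        ∀ (S : ℝ → ℂ) (X : ℝ) (F f : ℝ → ℝ), TauberianSetting S X F f α g →
        ∀ x, max X (max (Real.pi / δ₀) (2 * Real.pi)) ≤ x →
          ‖S x‖ₑ ≤ ENNReal.ofReal (K * A) * rate (errHC N G q w) f x := by
  obtain ⟨C, hC, h⟩ := exists_le_rate hα₀ hα₁
  obtain ⟨K, hK, hp⟩ := exists_pairing_le_of_osc N w D δ₀ C hw hD hδ₀ hC
  refine ⟨4 * K + 2 * C, by positivity, fun G p q A g hpq hA hg S X F f hS x hx => ?_⟩
  rw [max_le_iff, max_le_iff] at hx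
  refine h N S X F f g K A _ hS hK.le hA x hx.1 fun _ lam hlam φ hφ => ?_
  refine hp g φ lam x A _ hφ hS.boundary.1 hg.diff hg.at_zero hA hlam hx.2.1 hx.2.2 ?_
  intro δ hδ hδ' m hm hm'
  refine (lintegral_Ioo_le_eLpNorm_mul hpq hg.G_pos hg.G_locallyIntegrable.aestronglyMeasurable
    hm lam).trans (mul_le_mul_left ((eLpNorm_mono_enorm fun t => ?_).trans (hg.bound δ hδ hδ')) _)
  rw [enorm_eq_self, div_eq_mul_inv, enorm_mul, enorm_inv (by exact_mod_cast (hg.G_pos t).ne'),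
    div_eq_mul_inv]
  gcongr
  · exact hm' t
  · rw [← ofReal_norm, Complex.norm_real, Real.norm_of_nonneg (hg.G_pos t).le]

theorem bound_classHCI {α : ℝ} (hα₀ : 0 ≤ α) (hα₁ : α < 1) (N : ℕ) (w : ℝ → ℝ) (D δ₀ : ℝ)
    (hw : IsModulus w) (hD : 0 < D) (hδ₀ : 0 < δ₀) :
    ∃ K : ℝ, 0 < K ∧
      ∀ (G : ℝ → ℝ) (A : ℝ) (g : ℝ → ℂ), 1 ≤ A → ClassHCI N G w D δ₀ A g →
        ∀ (S : ℝ → ℂ) (X : ℝ) (F f : ℝ → ℝ), TauberianSetting S X F f α g →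
        ∀ x, max X (max (Real.pi / δ₀) (2 * Real.pi)) ≤ x →
          ‖S x‖ₑ ≤ ENNReal.ofReal (K * A) * rate (errHCI N G w) f x := by
  obtain ⟨C, hC, h⟩ := exists_le_rate hα₀ hα₁
  obtain ⟨K, hK, hp⟩ := exists_pairing_le_of_osc N w D δ₀ C hw hD hδ₀ hC
  refine ⟨4 * K + 2 * C, by positivity, fun G A g hA hg S X F f hS x hx => ?_⟩
  rw [max_le_iff, max_le_iff] at hx
  refine h N S X F f g K A _ hS hK.le hA x hx.1 fun _ lam hlam φ hφ => ?_
  refine hp g φ lam x A _ hφ hS.boundary.1 hg.diff hg.at_zero hA hlam hx.2.1 hx.2.2 ?_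
  intro δ hδ hδ' m hm hm'
  have hl0 : 0 < lam := by linarith
  have hwd := hw.pos δ hδ
  calc _ ≤ _ := lintegral_mono hm'
    _ ≤ _ := hg.bound lam hl0 δ hδ hδ'
    _ = _ := by
        rw [← ENNReal.ofReal_mul (by positivity)]
        congr 1; ring

/-! ### Almost analytic extensions of cutoffs and Green's formula -/

/-- The extension `∑_{j ≤ n} (d/dt)^j φ(t/λ) (is)^j / j!` of `t ↦ φ(t/λ)` to `z = t + is`, for which
the Cauchy–Riemann operator only leaves the term containing the derivative of order `n + 1`. -/
noncomputable def almostAnalytic (φ : ℝ → ℂ) (n : ℕ) (lam : ℝ) (z : ℂ) : ℂ :=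
  ∑ j ∈ Finset.range (n + 1),
    iteratedDeriv j φ (z.re / lam) * (lam⁻¹ : ℂ) ^ j * ((Complex.I * z.im) ^ j / (j.factorial : ℂ))

/-- The image of `almostAnalytic φ n lam` under `∂_t + i ∂_s`. -/
noncomputable def almostAnalyticDbar (φ : ℝ → ℂ) (n : ℕ) (lam : ℝ) (z : ℂ) : ℂ :=
  iteratedDeriv (n + 1) φ (z.re / lam) * (lam⁻¹ : ℂ) ^ (n + 1) *
    ((Complex.I * z.im) ^ n / (n.factorial : ℂ))

theorem hasFDerivAt_mul_re_im {p q : ℝ → ℂ} {p' q' : ℂ} {z : ℂ} (hp : HasDerivAt p p' z.re)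
    (hq : HasDerivAt q q' z.im) :
    HasFDerivAt (fun w : ℂ => p w.re * q w.im)
      (Complex.reCLM.smulRight (p' * q z.im) + Complex.imCLM.smulRight (p z.re * q')) z := by
  have h1 : HasFDerivAt (fun w : ℂ => p w.re) (Complex.reCLM.smulRight p') z := by
    have := hp.hasFDerivAt.comp z Complex.reCLM.hasFDerivAt
    refine this.congr_fderiv ?_
    ext; simp
  have h2 : HasFDerivAt (fun w : ℂ => q w.im) (Complex.imCLM.smulRight q') z := by
    have := hq.hasFDerivAt.comp z Complex.imCLM.hasFDerivAt
    refine this.congr_fderiv ?_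
    ext; simp
  refine (h1.mul h2).congr_fderiv ?_
  ext; simp; ring

theorem exists_hasFDerivAt_almostAnalytic {C : ℝ} {n : ℕ} {φ : ℝ → ℂ} (hφ : IsCutoff C n φ)
    (lam : ℝ) (z : ℂ) :
    ∃ Φ' : ℂ →L[ℝ] ℂ, HasFDerivAt (almostAnalytic φ n lam) Φ' z ∧
      Complex.I * Φ' 1 - Φ' Complex.I = Complex.I * almostAnalyticDbar φ n lam z := by
  set p : ℕ → ℝ → ℂ := fun j t => iteratedDeriv j φ (t / lam) * (lam⁻¹ : ℂ) ^ j with hp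
  set q : ℕ → ℝ → ℂ := fun j s => (Complex.I * s) ^ j / (j.factorial : ℂ) with hq
  set q' : ℕ → ℝ → ℂ := fun j s => Nat.casesOn j 0 fun i => Complex.I * q i s with hq'
  have hpd : ∀ j t, HasDerivAt (p j) (p (j + 1) t) t := by
    intro j t
    have h2 : HasDerivAt (iteratedDeriv j φ) (iteratedDeriv (j + 1) φ (t / lam)) (t / lam) := by
      rw [iteratedDeriv_succ]
      exact (hφ.contDiff.differentiable_iteratedDeriv j
        (by exact_mod_cast WithTop.coe_lt_top _)).differentiableAt.hasDerivAt
    have h3 := (HasDerivAt.scomp t h2 ((hasDerivAt_id t).div_const lam)).mul_const ((lam⁻¹ : ℂ) ^ j)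
    refine h3.congr_deriv ?_
    simp only [hp, Complex.real_smul]
    push_cast; ring
  have hqd : ∀ j s, HasDerivAt (q j) (q' j s) s := by
    intro j s
    have h1 : HasDerivAt (fun s : ℝ => Complex.I * (s : ℂ)) (Complex.I * 1) s :=
      (Complex.ofRealCLM.hasDerivAt (x := s)).const_mul Complex.I
    have h2 := (h1.pow j).div_const (j.factorial : ℂ)
    refine h2.congr_deriv ?_
    cases j with
    | zero => simp [hq']
    | succ i =>
      have : ((i : ℂ) + 1) ≠ 0 := by exact_mod_cast Nat.succ_ne_zero i
      have : (i.factorial : ℂ) ≠ 0 := by exact_mod_cast i.factorial_ne_zero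
      simp only [hq', hq, Nat.factorial_succ, Nat.add_sub_cancel]
      push_cast; field_simp
  refine ⟨∑ j ∈ Finset.range (n + 1), (Complex.reCLM.smulRight (p (j + 1) z.re * q j z.im) +
    Complex.imCLM.smulRight (p j z.re * q' j z.im)),
    HasFDerivAt.fun_sum fun j _ => hasFDerivAt_mul_re_im (hpd j z.re) (hqd j z.im), ?_⟩
  simp only [sum_apply, add_apply,
    ContinuousLinearMap.smulRight_apply, Complex.reCLM_apply, Complex.imCLM_apply, Complex.one_re,
    Complex.one_im, Complex.I_re, Complex.I_im, one_smul, zero_smul, add_zero, zero_add]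
  rw [Finset.sum_range_succ, Finset.sum_range_succ' (fun j => p j z.re * q' j z.im)]
  have : ∀ j, p (j + 1) z.re * q' (j + 1) z.im = Complex.I * (p (j + 1) z.re * q j z.im) := fun j
      => by
    simp only [hq']; ring
  simp only [this, ← Finset.mul_sum]
  have h0 : q' 0 z.im = 0 := rfl
  rw [h0, almostAnalyticDbar]
  ring

theorem continuous_almostAnalytic {C : ℝ} {n : ℕ} {φ : ℝ → ℂ} (hφ : IsCutoff C n φ) (lam : ℝ) :
    Continuous (almostAnalytic φ n lam) := by
  refine continuous_finsetSum _ fun j _ => ?_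
  have := hφ.continuous_iteratedDeriv j
  fun_prop

theorem continuous_almostAnalyticDbar {C : ℝ} {n : ℕ} {φ : ℝ → ℂ} (hφ : IsCutoff C n φ) (lam : ℝ) :
    Continuous (almostAnalyticDbar φ n lam) := by
  have := hφ.continuous_iteratedDeriv (n + 1)
  unfold almostAnalyticDbar
  fun_prop

theorem almostAnalytic_ofReal (φ : ℝ → ℂ) (n : ℕ) (lam t : ℝ) :
    almostAnalytic φ n lam t = φ (t / lam) := by
  rw [almostAnalytic, Finset.sum_range_succ']
  simp

theorem almostAnalytic_eq_zero {C : ℝ} {n : ℕ} {φ : ℝ → ℂ} (hφ : IsCutoff C n φ) {lam : ℝ}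
    (hlam : 0 < lam) {z : ℂ} (hz : lam / 2 ≤ |z.re|) : almostAnalytic φ n lam z = 0 :=
  Finset.sum_eq_zero fun j _ => by rw [hφ.iteratedDeriv_div_eq_zero hlam j hz]; simp

theorem norm_almostAnalytic_le {C : ℝ} {n : ℕ} {φ : ℝ → ℂ} (hφ : IsCutoff C n φ) (hC : 0 ≤ C)
    {lam : ℝ} (hlam : 0 < lam) (z : ℂ) :
    ‖almostAnalytic φ n lam z‖ ≤ C * Real.exp (24 * (n + 1) / lam * |z.im|) := by
  calc ‖almostAnalytic φ n lam z‖
      ≤ ∑ j ∈ Finset.range (n + 1), C * ((24 * (n + 1) / lam * |z.im|) ^ j / j.factorial) := by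
        refine (norm_sum_le _ _).trans (Finset.sum_le_sum fun j hj => ?_)
        have h1 := hφ.norm_iteratedDeriv_le j (by have := Finset.mem_range.1 hj; omega) (z.re / lam)
        rw [norm_mul, norm_mul, norm_div, norm_pow, norm_pow, norm_inv, Complex.norm_real,
          Real.norm_of_nonneg hlam.le, norm_mul, Complex.norm_I, one_mul, Complex.norm_real,
          Real.norm_eq_abs, Complex.norm_natCast]
        calc _ ≤ C * (24 * (n + 1)) ^ j * lam⁻¹ ^ j * (|z.im| ^ j / j.factorial) := by gcongr
          _ = _ := by generalize 24 * ((n : ℝ) + 1) = b; ring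
    _ ≤ _ := by
        rw [← Finset.mul_sum]
        gcongr
        exact Real.sum_le_exp_of_nonneg (by positivity) _

theorem norm_almostAnalyticDbar_le {C : ℝ} {n : ℕ} {φ : ℝ → ℂ} (hφ : IsCutoff C n φ)
    {lam : ℝ} (hlam : 0 < lam) (z : ℂ) :
    ‖almostAnalyticDbar φ n lam z‖ ≤
      C * (24 * (n + 1) / lam) * ((24 * (n + 1) / lam * |z.im|) ^ n / n.factorial) := by
  have h1 := hφ.norm_iteratedDeriv_le (n + 1) le_rfl (z.re / lam)
  rw [almostAnalyticDbar, norm_mul, norm_mul, norm_div, norm_pow, norm_pow, norm_inv,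
      Complex.norm_real,
    Real.norm_of_nonneg hlam.le, norm_mul, Complex.norm_I, one_mul, Complex.norm_real,
    Real.norm_eq_abs, Complex.norm_natCast]
  calc _ ≤ C * (24 * (n + 1)) ^ (n + 1) * lam⁻¹ ^ (n + 1) * (|z.im| ^ n / n.factorial) := by gcongr
    _ = _ := by generalize 24 * ((n : ℝ) + 1) = b; ring

/-- Green's formula on the rectangle `[-lam/2, lam/2] × [0, h]`; the vertical sides do not
contribute. -/
theorem IsCutoff.green {C : ℝ} {n : ℕ} {φ : ℝ → ℂ} (hφ : IsCutoff C n φ) {lam h : ℝ}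
    (hlam : 0 < lam) (hh : 0 ≤ h) {W : ℂ → ℂ}
    (hWc : ContinuousOn W (Icc (-(lam / 2)) (lam / 2) ×ℂ Icc 0 h))
    (hWd : DifferentiableOn ℂ W (Ioo (-(lam / 2)) (lam / 2) ×ℂ Ioo 0 h)) :
    ∫ t in -(lam / 2)..lam / 2, W t * φ (t / lam) =
      (∫ t in -(lam / 2)..lam / 2, W (t + h * Complex.I) * almostAnalytic φ n lam
          (t + h * Complex.I)) +
      ∫ t in -(lam / 2)..lam / 2, ∫ s in 0..h,
        W (t + s * Complex.I) * (Complex.I * almostAnalyticDbar φ n lam (t + s * Complex.I)) := by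
  choose Φ' hΦ hΦ' using exists_hasFDerivAt_almostAnalytic hφ lam
  set Φ := almostAnalytic φ n lam with hΦdef
  have hcont : Continuous Φ := continuous_almostAnalytic hφ lam
  set f' : ℂ → ℂ →L[ℝ] ℂ := fun z =>
    W z • Φ' z + Φ z • (ContinuousLinearMap.toSpanSingleton ℂ (deriv W z)).restrictScalars ℝ
        with hf'
  have hf'v : ∀ z, Complex.I • f' z 1 - f' z Complex.I =
      W z * (Complex.I * almostAnalyticDbar φ n lam z) := by
    intro z
    rw [← hΦ']
    simp [hf']
    ring
  have hre : -(lam / 2) ≤ lam / 2 := by linarith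
  have key := Complex.integral_boundary_rect_of_hasFDerivAt_real_off_countable
    (fun z => W z * Φ z) f' ((-(lam / 2) : ℝ) : ℂ) (((lam / 2 : ℝ) : ℂ) + (h : ℂ) * Complex.I) ∅
    countable_empty ?_ ?_ ?_
  · simp only [Complex.add_re, Complex.add_im, Complex.mul_re, Complex.mul_im, Complex.ofReal_re,
      Complex.ofReal_im, Complex.I_re, Complex.I_im, mul_zero, mul_one, zero_mul, sub_zero,
          add_zero,
      zero_add, hf'v, Complex.ofReal_zero] at key
    have hΦr : ∀ t : ℝ, Φ t = φ (t / lam) := almostAnalytic_ofReal φ n lam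
    have hz : ∀ y : ℝ, ∀ c : ℝ, |c| = lam / 2 → Φ ((c : ℂ) + (y : ℂ) * Complex.I) = 0 := by
      intro y c hc
      exact almostAnalytic_eq_zero hφ hlam (by simp [hc])
    have hv1 : ∀ y : ℝ, Φ (((lam / 2 : ℝ) : ℂ) + (y : ℂ) * Complex.I) = 0 := fun y =>
      hz y _ (abs_of_pos (by positivity))
    have hv2 : ∀ y : ℝ, Φ (((-(lam / 2) : ℝ) : ℂ) + (y : ℂ) * Complex.I) = 0 := fun y =>
      hz y _ (by rw [abs_neg, abs_of_pos (by positivity)])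
    simp only [hv1, hv2, mul_zero, intervalIntegral.integral_zero, smul_zero, add_zero, sub_zero,
      hΦr] at key
    rw [← key]; ring
  · simp only [Complex.add_re, Complex.add_im, Complex.mul_re, Complex.mul_im, Complex.ofReal_re,
      Complex.ofReal_im, Complex.I_re, Complex.I_im, mul_zero, mul_one, sub_zero, add_zero,
      zero_add]
    rw [uIcc_of_le hre, uIcc_of_le hh]
    exact hWc.mul hcont.continuousOn
  · simp only [Complex.add_re, Complex.add_im, Complex.mul_re, Complex.mul_im, Complex.ofReal_re,
      Complex.ofReal_im, Complex.I_re, Complex.I_im, mul_zero, mul_one, sub_zero, add_zero,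
      zero_add, Set.sdiff_empty]
    rw [min_eq_left hre, max_eq_right hre, min_eq_left hh, max_eq_right hh]
    intro z hz
    have hopen : IsOpen (Ioo (-(lam / 2)) (lam / 2) ×ℂ Ioo 0 h) := isOpen_Ioo.reProdIm isOpen_Ioo
    have hW := ((hWd z hz).differentiableAt (hopen.mem_nhds
        hz)).hasDerivAt.hasFDerivAt.restrictScalars ℝ
    refine (hW.mul (hΦ z)).congr_fderiv ?_
    ext; simp [hf']
  · simp only [Complex.add_re, Complex.add_im, Complex.mul_re, Complex.mul_im, Complex.ofReal_re,
      Complex.ofReal_im, Complex.I_re, Complex.I_im, mul_zero, mul_one, sub_zero, add_zero,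
      zero_add, hf'v]
    rw [uIcc_of_le hre, uIcc_of_le hh]
    exact (hWc.mul (continuous_const.mul (continuous_almostAnalyticDbar hφ
        lam)).continuousOn).integrableOn_compact
      (isCompact_Icc.reProdIm isCompact_Icc)

/-! ### Shifting the contour -/

theorem lintegral_comp_abs_le (k : ℝ → ℝ≥0∞) (a : ℝ) :
    ∫⁻ t in Ioo (-a) a, k |t| ≤ 2 * ∫⁻ t in Ioo 0 a, k t := by
  have h1 : ∫⁻ t in Ioo 0 a, k |t| = ∫⁻ t in Ioo 0 a, k t :=
    setLIntegral_congr_fun measurableSet_Ioo fun t ht => by simp only [abs_of_pos ht.1]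
  have h2 : ∫⁻ t in Ioo (-a) 0, k |t| = ∫⁻ t in Ioo 0 a, k t := by
    rw [← h1]
    have := (Measure.measurePreserving_neg (volume : Measure ℝ)).setLIntegral_comp_preimage_emb
      (MeasurableEquiv.neg ℝ).measurableEmbedding (fun t => k |t|) (Ioo 0 a)
    simpa using this
  calc ∫⁻ t in Ioo (-a) a, k |t| ≤ ∫⁻ t in (Ioo (-a) 0 ∪ Ioo 0 a) ∪ {0}, k |t| := by
        refine lintegral_mono_set fun t ht => ?_
        rcases lt_trichotomy t 0 with h | h | h
        · exact Or.inl (Or.inl ⟨ht.1, h⟩)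
        · exact Or.inr h
        · exact Or.inl (Or.inr ⟨h, ht.2⟩)
    _ ≤ (∫⁻ t in Ioo (-a) 0, k |t|) + (∫⁻ t in Ioo 0 a, k |t|) + ∫⁻ t in ({0} : Set ℝ), k |t| :=
        (lintegral_union_le _ _ _).trans (by gcongr; exact lintegral_union_le _ _ _)
    _ = _ := by rw [h1, h2]; simp [two_mul]

/-- Since `t H(t)` is non-decreasing, `H(|z|)` is at most `2 H(|Re z| + |Im z|)`; the integral of
the latter along a horizontal segment is an integral of `H` along the real axis. -/
theorem lintegral_horizontal_le {H : ℝ → ℝ} (hH : ∀ t ≥ 0, 0 < H t)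
    (hm : MonotoneOn (fun t => t * H t) (Ici 0)) {s a lam : ℝ} (hs : 0 ≤ s) (hsl : a + s ≤ lam) :
    ∫⁻ t in Ioo (-a) a, ENNReal.ofReal (H ‖(t : ℂ) + s * Complex.I‖) ≤
      4 * ∫⁻ t in Ioo 0 lam, ENNReal.ofReal (H t) := by
  have hpt : ∀ t : ℝ, H ‖(t : ℂ) + s * Complex.I‖ ≤ 2 * H (|t| + s) := by
    intro t
    set r := ‖(t : ℂ) + s * Complex.I‖ with hr
    have h1 : |t| ≤ r := by
      have := Complex.abs_re_le_norm ((t : ℂ) + s * Complex.I)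
      simpa using this
    have h2 : s ≤ r := by
      have := Complex.abs_im_le_norm ((t : ℂ) + s * Complex.I)
      simp at this
      exact (le_abs_self s).trans this
    have h3 : r ≤ |t| + s := by
      refine (norm_add_le _ _).trans (le_of_eq ?_)
      rw [norm_mul, Complex.norm_I, mul_one, Complex.norm_real, Complex.norm_real,
        Real.norm_of_nonneg hs, Real.norm_eq_abs]
    have hr0 : 0 ≤ r := norm_nonneg _
    have hpos := hH (|t| + s) (by positivity)
    rcases hr0.eq_or_lt with h0 | h0
    · have h4 : |t| + s = r := by linarith [abs_nonneg t]
      rw [h4] at hpos ⊢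
      linarith
    · have h5 : r * H r ≤ (|t| + s) * H (|t| + s) := hm hr0 (mem_Ici.2 (by positivity)) h3
      have h6 : (|t| + s) * H (|t| + s) ≤ (2 * r) * H (|t| + s) := by gcongr; linarith
      have h7 : r * H r ≤ r * (2 * H (|t| + s)) := by linarith
      exact le_of_mul_le_mul_left h7 h0
  calc _ ≤ ∫⁻ t in Ioo (-a) a, 2 * ENNReal.ofReal (H (|t| + s)) := by
        refine lintegral_mono fun t => ?_
        rw [← ENNReal.ofReal_ofNat 2, ← ENNReal.ofReal_mul zero_le_two]
        exact ENNReal.ofReal_le_ofReal (hpt t)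
    _ = 2 * ∫⁻ t in Ioo (-a) a, ENNReal.ofReal (H (|t| + s)) :=
        lintegral_const_mul' _ _ ENNReal.ofNat_ne_top
    _ ≤ 2 * (2 * ∫⁻ t in Ioo 0 a, ENNReal.ofReal (H (t + s))) := by
        gcongr
        exact lintegral_comp_abs_le (fun r => ENNReal.ofReal (H (r + s))) a
    _ = 4 * ∫⁻ t in Ioo s (a + s), ENNReal.ofReal (H t) := by
        rw [← mul_assoc]
        congr 1
        · norm_num
        · have := (measurePreserving_add_right (volume : Measure ℝ)
              s).setLIntegral_comp_preimage_emb
            (measurableEmbedding_addRight s) (fun t => ENNReal.ofReal (H t)) (Ioo s (a + s))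
          rw [← this]
          congr 2
          ext t; simp
    _ ≤ _ := by
        gcongr

theorem reProdIm_mono {s s' t t' : Set ℝ} (hs : s ⊆ s') (ht : t ⊆ t') : s ×ℂ t ⊆ s' ×ℂ t' :=
  inter_subset_inter (preimage_mono hs) (preimage_mono ht)

theorem enorm_intervalIntegral_le {f : ℝ → ℂ} {a b : ℝ} (hab : a ≤ b) :
    ‖∫ t in a..b, f t‖ₑ ≤ ∫⁻ t in Ioo a b, ‖f t‖ₑ := by
  rw [intervalIntegral.integral_of_le hab, integral_Ioc_eq_integral_Ioo]
  exact enorm_integral_le_lintegral_enorm _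

/-- The contour is moved upwards by `1 / G(lam)`, where `e^{ixz}` is small; the price is the
integral over the rectangle of the image of the almost analytic cutoff under the Cauchy–Riemann
operator. -/
theorem IsCutoff.enorm_pairing_le_of_classAn {C : ℝ} {n : ℕ} {φ : ℝ → ℂ} (hφ : IsCutoff C n φ)
    (hC : 0 ≤ C) {G H : ℝ → ℝ} {g : ℝ → ℂ} (hg : ClassAn G H g) {x lam b B : ℝ}
    (hlam : 2 / G 0 ≤ lam) (hB : B = 24 * (n + 1) / lam)
    (hb : ∀ s ∈ Ioo 0 (1 / G lam), (B * s) ^ n / n.factorial * Real.exp (-(x * s)) ≤ b) :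
    ‖pairing g φ x lam‖ₑ ≤ ENNReal.ofReal (4 * C *
      (Real.exp (B * (1 / G lam) - x * (1 / G lam)) + B * (1 / G lam) * b)) *
        ∫⁻ t in Ioo 0 lam, ENNReal.ofReal (H t) := by
  have hG0 := hg.G_pos 0 le_rfl
  have hl0 : 0 < lam := (by positivity : 0 < 2 / G 0).trans_le hlam
  have hGl := hg.G_pos lam hl0.le
  have hG0l : G 0 ≤ G lam := hg.G_mono (mem_Ici.2 le_rfl) hl0.le hl0.le
  set h := 1 / G lam with hh
  have hh0 : 0 < h := by positivity
  have hhl : h ≤ lam / 2 := by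
    have h1 : h ≤ 1 / G 0 := one_div_le_one_div_of_le hG0 hG0l
    have h2 : 2 / G 0 = 2 * (1 / G 0) := by ring
    linarith
  have hB0 : 0 ≤ B := by rw [hB]; positivity
  have hb0 : 0 ≤ b := by
    have h1 := hb (h / 2) ⟨by positivity, by linarith⟩
    have : 0 ≤ h / 2 := by positivity
    exact le_trans (by positivity) h1
  obtain ⟨E, hEg, hEc, hEd, hEH⟩ := hg.extension
  have hreg : Icc (-lam) lam ×ℂ Icc (-h) h ⊆ analyticRegion G := by
    intro z hz
    obtain ⟨hz1, hz2⟩ := hz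
    have h1 : G |z.re| ≤ G lam := hg.G_mono (mem_Ici.2 (abs_nonneg _)) hl0.le (abs_le.2 hz1)
    exact (abs_le.2 hz2).trans (one_div_le_one_div_of_le (hg.G_pos _ (abs_nonneg _)) h1)
  have hint : Ioo (-lam) lam ×ℂ Ioo (-h) h ⊆ interior (analyticRegion G) :=
    interior_maximal ((reProdIm_mono Ioo_subset_Icc_self Ioo_subset_Icc_self).trans hreg)
      (isOpen_Ioo.reProdIm isOpen_Ioo)
  set W : ℂ → ℂ := fun z => E z * Complex.exp (Complex.I * x * z) with hW
  have hWc : ContinuousOn W (Icc (-(lam / 2)) (lam / 2) ×ℂ Icc 0 h) := by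
    refine ContinuousOn.mul (hEc.mono (Subset.trans ?_ hreg)) (by fun_prop)
    exact reProdIm_mono (Icc_subset_Icc (by linarith) (by linarith))
      (Icc_subset_Icc (by linarith) le_rfl)
  have hWd : DifferentiableOn ℂ W (Ioo (-(lam / 2)) (lam / 2) ×ℂ Ioo 0 h) := by
    refine DifferentiableOn.mul (hEd.mono (Subset.trans ?_ hint)) (by fun_prop)
    exact reProdIm_mono (Ioo_subset_Ioo (by linarith) (by linarith))
      (Ioo_subset_Ioo (by linarith) le_rfl)
  have hWn : ∀ t ∈ Ioo (-(lam / 2)) (lam / 2), ∀ s ∈ Icc 0 h, ‖W (t + s * Complex.I)‖ ≤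
      H ‖(t : ℂ) + s * Complex.I‖ * Real.exp (-(x * s)) := by
    intro t ht s hs
    rw [hW, norm_mul, Complex.norm_exp]
    refine mul_le_mul (hEH _ (hreg ⟨?_, ?_⟩)) (le_of_eq ?_) (Real.exp_pos _).le
      (hg.H_pos _ (norm_nonneg _)).le
    · have h1 : -lam ≤ t := by linarith [ht.1]
      have h2 : t ≤ lam := by linarith [ht.2]
      simpa using ⟨h1, h2⟩
    · have h1 : -h ≤ s := by linarith [hs.1]
      simpa using ⟨h1, hs.2⟩
    · simp
  have hpair : pairing g φ x lam = ∫ t in -(lam / 2)..lam / 2, W t * φ (t / lam) := by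
    rw [intervalIntegral.integral_of_le (by linarith), integral_Ioc_eq_integral_Ioo,
      setIntegral_eq_integral_of_forall_compl_eq_zero]
    · rw [pairing]
      congr 1; ext t
      rw [hW]; simp only [hEg]; ring
    · intro t ht
      have : lam / 2 ≤ |t| := by
        by_contra h2
        exact ht (abs_lt.1 (not_le.1 h2))
      have h3 := hφ.iteratedDeriv_div_eq_zero hl0 0 this
      rw [iteratedDeriv_zero] at h3
      rw [h3, mul_zero]
  set Q := ∫⁻ t in Ioo 0 lam, ENNReal.ofReal (H t) with hQ
  have hHor : ∀ s ∈ Icc 0 h, ∀ c : ℝ, 0 ≤ c → ∀ F : ℝ → ℂ,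
      (∀ t ∈ Ioo (-(lam / 2)) (lam / 2), ‖F t‖ ≤ c * H ‖(t : ℂ) + s * Complex.I‖) →
      ∫⁻ t in Ioo (-(lam / 2)) (lam / 2), ‖F t‖ₑ ≤ ENNReal.ofReal (4 * c) * Q := by
    intro s hs c hc F hF
    calc ∫⁻ t in Ioo (-(lam / 2)) (lam / 2), ‖F t‖ₑ
        ≤ ∫⁻ t in Ioo (-(lam / 2)) (lam / 2),
            ENNReal.ofReal c * ENNReal.ofReal (H ‖(t : ℂ) + s * Complex.I‖) := by
          refine setLIntegral_mono' measurableSet_Ioo fun t ht => ?_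
          rw [← ofReal_norm, ← ENNReal.ofReal_mul hc]
          exact ENNReal.ofReal_le_ofReal (hF t ht)
      _ = ENNReal.ofReal c * ∫⁻ t in Ioo (-(lam / 2)) (lam / 2),
            ENNReal.ofReal (H ‖(t : ℂ) + s * Complex.I‖) :=
          lintegral_const_mul' _ _ ENNReal.ofReal_ne_top
      _ ≤ ENNReal.ofReal c * (4 * Q) := by
          gcongr
          exact lintegral_horizontal_le hg.H_pos hg.H_mono hs.1 (by linarith [hs.2])
      _ = _ := by
          rw [ENNReal.ofReal_mul zero_le_four, ENNReal.ofReal_ofNat]; ring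
  have hHn : ∀ z : ℂ, 0 < H ‖z‖ := fun z => hg.H_pos _ (norm_nonneg _)
  -- the upper side of the rectangle
  have htop : ‖∫ t in -(lam / 2)..lam / 2,
      W (t + h * Complex.I) * almostAnalytic φ n lam (t + h * Complex.I)‖ₑ ≤
      ENNReal.ofReal (4 * (C * Real.exp (B * h - x * h))) * Q := by
    refine (enorm_intervalIntegral_le (by linarith)).trans
      (hHor h ⟨hh0.le, le_rfl⟩ _ (by positivity) _ fun t ht => ?_)
    have h1 := hWn t ht h ⟨hh0.le, le_rfl⟩
    have h2 := norm_almostAnalytic_le hφ hC hl0 ((t : ℂ) + h * Complex.I)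
    rw [← hB] at h2
    have him : ((t : ℂ) + h * Complex.I).im = h := by simp
    rw [him, abs_of_pos hh0] at h2
    rw [norm_mul]
    have := hHn ((t : ℂ) + h * Complex.I)
    calc _ ≤ (H ‖(t : ℂ) + h * Complex.I‖ * Real.exp (-(x * h))) * (C * Real.exp (B * h)) :=
          mul_le_mul h1 h2 (norm_nonneg _) (by positivity)
      _ = C * (Real.exp (B * h) * Real.exp (-(x * h))) * H ‖(t : ℂ) + h * Complex.I‖ := by ring
      _ = _ := by rw [← Real.exp_add, sub_eq_add_neg]
  -- the interior of the rectangle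
  have hbulk : ‖∫ t in -(lam / 2)..lam / 2, ∫ s in 0..h,
      W (t + s * Complex.I) * (Complex.I * almostAnalyticDbar φ n lam (t + s * Complex.I))‖ₑ ≤
      ENNReal.ofReal (4 * (C * (B * h * b))) * Q := by
    set f : ℝ → ℝ → ℂ := fun t s =>
      W (t + s * Complex.I) * (Complex.I * almostAnalyticDbar φ n lam (t + s * Complex.I)) with hf
    have hfm : AEMeasurable (Function.uncurry fun t s => ‖f t s‖ₑ)
        ((volume.restrict (Ioo (-(lam / 2)) (lam / 2))).prod (volume.restrict (Ioo 0 h))) := by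
      rw [Measure.prod_restrict]
      refine ContinuousOn.aemeasurable ?_ (measurableSet_Ioo.prod measurableSet_Ioo)
      refine ContinuousOn.enorm (ContinuousOn.mul (hWc.comp (by fun_prop) ?_) ?_)
      · intro z hz
        simpa [Complex.mem_reProdIm] using ⟨⟨hz.1.1.le, hz.1.2.le⟩, hz.2.1.le, hz.2.2.le⟩
      · have := continuous_almostAnalyticDbar hφ lam
        fun_prop
    calc _ ≤ ∫⁻ t in Ioo (-(lam / 2)) (lam / 2), ‖∫ s in 0..h, f t s‖ₑ :=
          enorm_intervalIntegral_le (by linarith)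
      _ ≤ ∫⁻ t in Ioo (-(lam / 2)) (lam / 2), ∫⁻ s in Ioo 0 h, ‖f t s‖ₑ :=
          lintegral_mono fun t => enorm_intervalIntegral_le hh0.le
      _ = ∫⁻ s in Ioo 0 h, ∫⁻ t in Ioo (-(lam / 2)) (lam / 2), ‖f t s‖ₑ :=
          lintegral_lintegral_swap hfm
      _ ≤ ∫⁻ s in Ioo 0 h, ENNReal.ofReal (4 * (C * B * b)) * Q := by
          refine setLIntegral_mono' measurableSet_Ioo fun s hs => ?_
          refine hHor s ⟨hs.1.le, hs.2.le⟩ _ (by positivity) _ fun t ht => ?_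
          have h1 := hWn t ht s ⟨hs.1.le, hs.2.le⟩
          have h2 := norm_almostAnalyticDbar_le hφ hl0 ((t : ℂ) + s * Complex.I)
          rw [← hB] at h2
          have him : ((t : ℂ) + s * Complex.I).im = s := by simp
          rw [him, abs_of_pos hs.1] at h2
          have := hHn ((t : ℂ) + s * Complex.I)
          change ‖W _ * (Complex.I * _)‖ ≤ _
          rw [norm_mul, norm_mul Complex.I, Complex.norm_I, one_mul]
          calc _ ≤ (H ‖(t : ℂ) + s * Complex.I‖ * Real.exp (-(x * s))) *
                (C * B * ((B * s) ^ n / n.factorial)) :=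
                mul_le_mul h1 h2 (norm_nonneg _) (by positivity)
            _ = C * B * ((B * s) ^ n / n.factorial * Real.exp (-(x * s))) *
                H ‖(t : ℂ) + s * Complex.I‖ := by ring
            _ ≤ _ := by
                gcongr
                exact hb s hs
      _ = ENNReal.ofReal h * ENNReal.ofReal (4 * (C * B * b)) * Q := by
          rw [setLIntegral_const, Real.volume_Ioo, sub_zero]; ring
      _ = _ := by
          rw [← ENNReal.ofReal_mul hh0.le]
          congr 2; ring
  rw [hpair, hφ.green hl0 hh0.le hWc hWd]
  refine (enorm_add_le _ _).trans ((add_le_add htop hbulk).trans (le_of_eq ?_))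
  rw [← add_mul, ← ENNReal.ofReal_add (by positivity) (by positivity)]
  congr 2; ring

/-! ### The analytic class -/

/-- Choice of the order `n` of the cutoff as a function of `x` and `lam`: with `n = ⌈Y⌉`, where `-Y`
is the exponent of the claimed error term, both contributions of `enorm_pairing_le_of_classAn` are
`O(e^{-Y})`. -/
theorem exists_rectangle_bound {G lam x Y : ℝ} (hG : 0 < G) (hlam : 0 < lam) (hm : 2 ≤ G * lam)
    (hx : 0 ≤ x) (hY : Y = x / (G * (1 + 675 / (G * lam)))) :
    ∃ b, (∀ s ∈ Ioo 0 (1 / G), (24 * ((⌈Y⌉₊ : ℝ) + 1) / lam * s) ^ ⌈Y⌉₊ / (⌈Y⌉₊).factorial *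
        Real.exp (-(x * s)) ≤ b) ∧
      Real.exp (24 * ((⌈Y⌉₊ : ℝ) + 1) / lam * (1 / G) - x * (1 / G)) +
        24 * ((⌈Y⌉₊ : ℝ) + 1) / lam * (1 / G) * b ≤ 25 * Real.exp 25 * Real.exp (-Y) := by
  set m := G * lam with hmdef
  have hm0 : 0 < m := by positivity
  have hY0 : 0 ≤ Y := by rw [hY]; positivity
  have hxY : x * lam = Y * (m + 675) := by
    rw [hY, hmdef]; field_simp
  have hxh : x * (1 / G) = Y + 675 * Y / m := by
    have h1 : x * (1 / G) = x * lam / m := by rw [hmdef]; field_simp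
    rw [h1, hxY]; field_simp
  set n := ⌈Y⌉₊ with hn
  have hnY : Y ≤ n := Nat.le_ceil Y
  have hnY' : (n : ℝ) + 1 ≤ Y + 2 := by linarith [Nat.ceil_lt_add_one hY0]
  set B := 24 * ((n : ℝ) + 1) / lam with hB
  have hB0 : 0 < B := by positivity
  have hBh : B * (1 / G) = 24 * (n + 1) / m := by rw [hB, hmdef]; field_simp
  have h12 : 24 * ((n : ℝ) + 1) / m ≤ 12 * (n + 1) := by
    rw [div_le_iff₀ hm0]
    have : (0 : ℝ) ≤ n := n.cast_nonneg
    nlinarith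
  have hexp1 : Real.exp (B * (1 / G) - x * (1 / G)) ≤ Real.exp 25 * Real.exp (-Y) := by
    rw [← Real.exp_add, hBh, hxh]
    apply Real.exp_le_exp.2
    have h1 : 24 * ((n : ℝ) + 1) / m ≤ 675 * Y / m + 24 := by
      rw [div_add' _ _ _ hm0.ne']
      gcongr
      nlinarith
    linarith
  rcases lt_or_ge Y 1 with h1 | h1
  · have hn1 : n ≤ 1 := Nat.ceil_le.2 (by simpa using h1.le)
    have hn1' : (n : ℝ) ≤ 1 := by exact_mod_cast hn1
    have hB24 : B * (1 / G) ≤ 24 := by rw [hBh]; linarith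
    refine ⟨Real.exp 24, fun s hs => ?_, ?_⟩
    · have hs0 := hs.1
      calc (B * s) ^ n / n.factorial * Real.exp (-(x * s)) ≤ Real.exp (B * s) * 1 := by
            gcongr
            · exact Real.pow_div_factorial_le_exp _ (by positivity) n
            · exact Real.exp_le_one_iff.2 (neg_nonpos.2 (by positivity))
        _ ≤ Real.exp 24 := by
            rw [mul_one]
            exact Real.exp_le_exp.2 (le_trans (by gcongr; exact hs.2.le) hB24)
    · have h2 : Real.exp 24 ≤ Real.exp 25 * Real.exp (-Y) := by
        rw [← Real.exp_add]; exact Real.exp_le_exp.2 (by linarith)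
      have h3 : B * (1 / G) * Real.exp 24 ≤ 24 * (Real.exp 25 * Real.exp (-Y)) := by gcongr
      linarith
  · have hx0 : 0 < x := by
      have : 0 < x * lam := by rw [hxY]; positivity
      exact pos_of_mul_pos_left this hlam.le
    refine ⟨(B / x) ^ n, fun s hs => ?_, ?_⟩
    · have hs0 := hs.1
      have h2 := Real.pow_div_factorial_le_exp (x * s) (by positivity) n
      calc (B * s) ^ n / n.factorial * Real.exp (-(x * s))
          = (B / x) ^ n * ((x * s) ^ n / n.factorial * Real.exp (-(x * s))) := by
            rw [div_pow, mul_pow, mul_pow]; field_simp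
        _ ≤ (B / x) ^ n * (Real.exp (x * s) * Real.exp (-(x * s))) := by gcongr
        _ = _ := by rw [← Real.exp_add, add_neg_cancel, Real.exp_zero, mul_one]
    · -- `24 (n + 1) ≤ 72 Y` and `lam x ≥ 675 Y`
      have h2 : B / x ≤ 1 / 9 := by
        rw [hB, div_div, mul_comm lam x, hxY, div_le_div_iff₀ (by positivity) (by norm_num)]
        nlinarith
      -- `n + 1 ≤ 2 ^ n` and `2 / 9 ≤ 1 / e`
      have h3 : ((n : ℝ) + 1) ≤ 2 ^ n := by exact_mod_cast Nat.lt_two_pow_self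
      have h4 : (2 / 9 : ℝ) ≤ Real.exp (-1) := by
        rw [Real.exp_neg, le_inv_comm₀ (by norm_num) (Real.exp_pos 1)]
        linarith [Real.exp_one_lt_d9]
      have h5 : B * (1 / G) * (B / x) ^ n ≤ 12 * Real.exp (-Y) := by
        calc B * (1 / G) * (B / x) ^ n ≤ 12 * 2 ^ n * (1 / 9) ^ n := by
              rw [hBh]
              gcongr
              linarith
          _ = 12 * (2 / 9) ^ n := by
              rw [mul_assoc, ← mul_pow]; norm_num
          _ ≤ 12 * Real.exp (-1) ^ n := by gcongr
          _ ≤ 12 * Real.exp (-Y) := by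
              rw [← Real.exp_nat_mul]
              gcongr
              linarith
      have h6 : (1 : ℝ) ≤ Real.exp 25 := Real.one_le_exp (by norm_num)
      have h7 : 12 * Real.exp (-Y) ≤ 24 * (Real.exp 25 * Real.exp (-Y)) := by
        nlinarith [Real.exp_pos (-Y), mul_le_mul_of_nonneg_right h6 (Real.exp_pos (-Y)).le]
      linarith

/-- For the analytic class, every error term that dominates `e^{-Y} ∫₀^lam H` is admissible, with
one constant for all `G` and `H`. -/
theorem exists_le_rate_of_classAn {α : ℝ} (hα₀ : 0 ≤ α) (hα₁ : α < 1) :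
    ∃ K : ℝ, 0 < K ∧ ∀ (G H : ℝ → ℝ) (g : ℝ → ℂ), ClassAn G H g →
      ∀ (S : ℝ → ℂ) (X : ℝ) (F f : ℝ → ℝ), TauberianSetting S X F f α g →
      ∀ (E : ℝ → ℝ → ℝ≥0∞) (x : ℝ), X ≤ x →
        (0 ≤ x → ∀ lam, 1 ≤ lam → E x lam = ∞ ∨ 2 / G 0 ≤ lam ∧
          ENNReal.ofReal (Real.exp (-(x / (G lam * (1 + 675 / (G lam * lam)))))) *
            (∫⁻ t in Ioo 0 lam, ENNReal.ofReal (H t)) ≤ E x lam) →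
        ‖S x‖ₑ ≤ ENNReal.ofReal K * rate E f x := by
  obtain ⟨C, hC, h⟩ := exists_enorm_le_of_pairing_le hα₀ hα₁
  set K₀ := 4 * C * (25 * Real.exp 25) with hK₀
  have hK0 : 0 < K₀ := by positivity
  refine ⟨4 * K₀ + 2 * C, by positivity, fun G H g hg S X F f hS E x hx hE => ?_⟩
  rcases lt_or_ge x 0 with hx0 | hx0
  · rw [hS.eq_zero_of_neg hx0, enorm_zero]; exact zero_le
  have hK : 0 < 4 * K₀ + 2 * C := by positivity
  refine le_mul_rate hK fun lam hlam => ?_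
  rcases hE hx0 lam hlam with hE | ⟨hlG, hE⟩
  · rw [hE, top_add, ENNReal.mul_top (by simpa using hK)]
    exact le_top
  have hl0 : 0 < lam := by linarith
  have hGl := hg.G_pos lam hl0.le
  have hG0 := hg.G_pos 0 le_rfl
  have hm : 2 ≤ G lam * lam := by
    have h1 : G 0 ≤ G lam := hg.G_mono (mem_Ici.2 le_rfl) hl0.le hl0.le
    rw [div_le_iff₀ hG0] at hlG
    nlinarith
  set Y := x / (G lam * (1 + 675 / (G lam * lam))) with hY
  obtain ⟨b, hb, hbY⟩ := exists_rectangle_bound hGl hl0 hm hx0 hY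
  have h1 := h ⌈Y⌉₊ S X F f g hS x hx lam hlam
    (ENNReal.ofReal (K₀ * 1) * (ENNReal.ofReal (Real.exp (-Y)) * ∫⁻ t in Ioo 0 lam, ENNReal.ofReal
        (H t)))
    fun φ hφ => ?_
  · refine h1.trans ((four_mul_add_le hK0.le hC.le le_rfl le_rfl).trans ?_)
    rw [mul_one]
    gcongr
  · refine (hφ.enorm_pairing_le_of_classAn hC.le hg hlG rfl hb).trans ?_
    rw [← mul_assoc, ← ENNReal.ofReal_mul (by positivity)]
    refine mul_le_mul_left (ENNReal.ofReal_le_ofReal ?_) _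
    calc _ ≤ 4 * C * (25 * Real.exp 25 * Real.exp (-Y)) := by gcongr
      _ = _ := by rw [hK₀]; ring

theorem bound_classAn {α : ℝ} (hα₀ : 0 ≤ α) (hα₁ : α < 1) :
    ∃ K : ℝ, 0 < K ∧
      ∀ (G H : ℝ → ℝ) (g : ℝ → ℂ), ClassAn G H g →
        ∀ (S : ℝ → ℂ) (X : ℝ) (F f : ℝ → ℝ), TauberianSetting S X F f α g →
        ∀ x, X ≤ x → ‖S x‖ₑ ≤ ENNReal.ofReal K * rate (errAn G H 675) f x := by
  obtain ⟨K, hK, h⟩ := exists_le_rate_of_classAn hα₀ hα₁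
  refine ⟨K, hK, fun G H g hg S X F f hS x hx => h G H g hg S X F f hS _ x hx fun _ lam _ => ?_⟩
  by_cases hlG : 2 / G 0 ≤ lam
  · refine Or.inr ⟨hlG, ?_⟩
    rw [errAn, if_pos hlG]
    gcongr
    exact le_self_add
  · exact Or.inl (if_neg hlG)

theorem bound_classAn' {α : ℝ} (hα₀ : 0 ≤ α) (hα₁ : α < 1) :
    ∃ K : ℝ, 0 < K ∧
      ∀ (G H : ℝ → ℝ) (g : ℝ → ℂ), ClassAn G H g →
        ∀ (S : ℝ → ℂ) (X : ℝ) (F f : ℝ → ℝ), TauberianSetting S X F f α g →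
        ∀ x, X ≤ x →
          ‖S x‖ₑ ≤ ENNReal.ofReal K * rate (errAn' G H (675 * max 1 (1 / G 0))) f x := by
  obtain ⟨K, hK, h⟩ := exists_le_rate_of_classAn hα₀ hα₁
  refine ⟨K, hK, fun G H g hg S X F f hS x hx => h G H g hg S X F f hS _ x hx fun hx0 lam hlam =>
      ?_⟩
  by_cases hlG : 2 / G 0 ≤ lam
  · refine Or.inr ⟨hlG, ?_⟩
    have hl0 : 0 < lam := by linarith
    have hGl := hg.G_pos lam hl0.le
    have hG0 := hg.G_pos 0 le_rfl
    have h1 : G 0 ≤ G lam := hg.G_mono (mem_Ici.2 le_rfl) hl0.le hl0.le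
    have h2 : 675 / (G lam * lam) ≤ 675 * max 1 (1 / G 0) / lam := by
      rw [← div_div]
      gcongr
      calc 675 / G lam = 675 * (1 / G lam) := by ring
        _ ≤ 675 * max 1 (1 / G 0) := by
          gcongr
          exact (one_div_le_one_div_of_le hG0 h1).trans (le_max_right _ _)
    rw [errAn', if_pos hlG]
    gcongr
  · exact Or.inl (if_neg hlG)

end FlexTauberian

theorem theorem2p1 (α : ℝ) (hα₀ : 0 ≤ α) (hα₁ : α < 1) :
    -- the class Dif
    (∀ (N : ℕ) (D : ℝ), 0 < D → ∃ K : ℝ, 0 < K ∧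
      ∀ (G : ℝ → ℝ) (p q : ℝ≥0∞) (A : ℝ) (g : ℝ → ℂ),
        ENNReal.HolderConjugate p q → 1 ≤ A → FlexTauberian.ClassDif N G p D A g →
        ∀ (S : ℝ → ℂ) (X : ℝ) (F f : ℝ → ℝ), FlexTauberian.TauberianSetting S X F f α g →
        ∀ x, X ≤ x →
          ‖S x‖ₑ ≤ ENNReal.ofReal (K * A) *
            FlexTauberian.rate (FlexTauberian.errDif N G q) f x) ∧
    -- the class DifI
    (∀ (N : ℕ) (D : ℝ), 0 < D → ∃ K : ℝ, 0 < K ∧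
      ∀ (G : ℝ → ℝ) (A : ℝ) (g : ℝ → ℂ),
        1 ≤ A → FlexTauberian.ClassDifI N G D A g →
        ∀ (S : ℝ → ℂ) (X : ℝ) (F f : ℝ → ℝ), FlexTauberian.TauberianSetting S X F f α g →
        ∀ x, X ≤ x →
          ‖S x‖ₑ ≤ ENNReal.ofReal (K * A) *
            FlexTauberian.rate (FlexTauberian.errDifI N G) f x) ∧
    -- the class HC
    (∀ (N : ℕ) (w : ℝ → ℝ) (D δ₀ : ℝ), FlexTauberian.IsModulus w → 0 < D → 0 < δ₀ →
      ∃ K : ℝ, 0 < K ∧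
      ∀ (G : ℝ → ℝ) (p q : ℝ≥0∞) (A : ℝ) (g : ℝ → ℂ),
        ENNReal.HolderConjugate p q → 1 ≤ A → FlexTauberian.ClassHC N G p w D δ₀ A g →
        ∀ (S : ℝ → ℂ) (X : ℝ) (F f : ℝ → ℝ), FlexTauberian.TauberianSetting S X F f α g →
        ∀ x, max X (max (Real.pi / δ₀) (2 * Real.pi)) ≤ x →
          ‖S x‖ₑ ≤ ENNReal.ofReal (K * A) *
            FlexTauberian.rate (FlexTauberian.errHC N G q w) f x) ∧
    -- the class HCI
    (∀ (N : ℕ) (w : ℝ → ℝ) (D δ₀ : ℝ), FlexTauberian.IsModulus w → 0 < D → 0 < δ₀ →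
      ∃ K : ℝ, 0 < K ∧
      ∀ (G : ℝ → ℝ) (A : ℝ) (g : ℝ → ℂ),
        1 ≤ A → FlexTauberian.ClassHCI N G w D δ₀ A g →
        ∀ (S : ℝ → ℂ) (X : ℝ) (F f : ℝ → ℝ), FlexTauberian.TauberianSetting S X F f α g →
        ∀ x, max X (max (Real.pi / δ₀) (2 * Real.pi)) ≤ x →
          ‖S x‖ₑ ≤ ENNReal.ofReal (K * A) *
            FlexTauberian.rate (FlexTauberian.errHCI N G w) f x) ∧
    -- the class SA
    (∀ (M : ℕ → ℝ) (L : ℝ), FlexTauberian.IsLogConvexSeq M → 0 < L →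
      FlexTauberian.IsSubanalyticWith M L → ∃ K : ℝ, 0 < K ∧
      ∀ (B : ℝ) (G H : ℝ → ℝ) (p q : ℝ≥0∞) (A : ℝ) (g : ℝ → ℂ), 0 < B →
        ENNReal.HolderConjugate p q → 1 ≤ A → FlexTauberian.ClassSA M B G H p q A g →
        ∀ (S : ℝ → ℂ) (X : ℝ) (F f : ℝ → ℝ), FlexTauberian.TauberianSetting S X F f α g →
        ∀ x, X ≤ x →
          ‖S x‖ₑ ≤ ENNReal.ofReal (K * A) *
            FlexTauberian.rate (FlexTauberian.errSA M B G H (124 / L)) f x) ∧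
    -- the class SAI
    (∀ (M : ℕ → ℝ) (L : ℝ), FlexTauberian.IsLogConvexSeq M → 0 < L →
      FlexTauberian.IsSubanalyticWith M L → ∃ K : ℝ, 0 < K ∧
      ∀ (B : ℝ) (G H : ℝ → ℝ) (A : ℝ) (g : ℝ → ℂ), 0 < B →
        1 ≤ A → FlexTauberian.ClassSAI M B G H A g →
        ∀ (S : ℝ → ℂ) (X : ℝ) (F f : ℝ → ℝ), FlexTauberian.TauberianSetting S X F f α g →
        ∀ x, X ≤ x →
          ‖S x‖ₑ ≤ ENNReal.ofReal (K * A) *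
            FlexTauberian.rate (FlexTauberian.errSA M B G H (124 / L)) f x) ∧
    -- the class An, with a constant independent of G and H
    (∃ K : ℝ, 0 < K ∧
      ∀ (G H : ℝ → ℝ) (g : ℝ → ℂ), FlexTauberian.ClassAn G H g →
        ∀ (S : ℝ → ℂ) (X : ℝ) (F f : ℝ → ℝ), FlexTauberian.TauberianSetting S X F f α g →
        ∀ x, X ≤ x →
          ‖S x‖ₑ ≤ ENNReal.ofReal K *
            FlexTauberian.rate (FlexTauberian.errAn G H 675) f x) ∧
    -- the class An, simplified error term with a constant depending on G(0) and H
    (∀ (g₀ : ℝ) (H : ℝ → ℝ), 0 < g₀ → BddAbove (H '' Set.Icc 0 (5 / g₀)) →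
      ∃ K : ℝ, 0 < K ∧
      ∀ (G : ℝ → ℝ) (g : ℝ → ℂ), G 0 = g₀ → FlexTauberian.ClassAn G H g →
        ∀ (S : ℝ → ℂ) (X : ℝ) (F f : ℝ → ℝ), FlexTauberian.TauberianSetting S X F f α g →
        ∀ x, X ≤ x →
          ‖S x‖ₑ ≤ ENNReal.ofReal K *
            FlexTauberian.rate (FlexTauberian.errAn' G H (675 * max 1 (1 / g₀))) f x) := by
  refine ⟨FlexTauberian.bound_classDif hα₀ hα₁, FlexTauberian.bound_classDifI hα₀ hα₁,
    FlexTauberian.bound_classHC hα₀ hα₁, FlexTauberian.bound_classHCI hα₀ hα₁,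
    FlexTauberian.bound_classSA hα₀ hα₁, FlexTauberian.bound_classSAI hα₀ hα₁,
    FlexTauberian.bound_classAn hα₀ hα₁, fun g₀ H _ _ => ?_⟩
  obtain ⟨K, hK, h⟩ := FlexTauberian.bound_classAn' hα₀ hα₁
  refine ⟨K, hK, fun G g hG₀ hg S X F f hS x hx => ?_⟩
  subst hG₀
  exact h G H g hg S X F f hS x hx
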